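/- Let $-\infty\le a<b\le\infty$ and let $S=(a,b)\times S^1$ carry the Riemannian metric $ds^2=dr^2+f(r)^2d\varphi^2$, where $(r,\varphi \bmod 2\pi)\in(a,b)\times S^1$ and $f\colon(a,b)\to\mathbb R$ is $C^\infty$ and positive. A central potential is a $C^\infty$ function $V\colon(a,b)\to\mathbb R$. Trajectories are the solutions of the Euler--Lagrange equations of $L=\frac12(\dot r^2+f(r)^2\dot\varphi^2)-V(r)$, and $K=f(r)^2\dot\varphi$ is the angular momentum. The orbit of a trajectory is its image in $S$. A trajectory (or its orbit) is called *nonsingular* if $K\ne0$; *bounded* if it is defined for all $t\in\mathbb R$ and contained in some $[r_1,r_2]\times S^1\subset(a,b)\times S^1$; *circular* if its orbit is a circle $\{r_0\}\times S^1$; *closed* if it is periodic in $t$ as a motion on $S$. A circular orbit $\{r_0\}\times S^1$ with angular momentum $K_0\ne0$ is *strongly stable* if $V(r)+\frac{K_0^2}{2f(r)^2}$ has a nondegenerate local minimum at $r_0$; it is *orbitally stable* if the corresponding phase orbit is (Lyapunov) orbitally stable within the level set $\{K=K_0\}$. Consider the following conditions on $V$. * $(\exists)$ There is a nonsingular bounded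 noncircular orbit $\gamma$. * $(\forall)$ Every nonsingular bounded orbit is closed. * $(\exists)^{\rm loc}$ There is a strongly stable circular orbit. * $(\forall)^{\rm loc}$ For every strongly stable circular orbit $\{r_0\}\times S^1$ with angular momentum $K_0$ there is $\varepsilon>0$ such that every nonsingular bounded orbit contained in $[r_0-\varepsilon,r_0+\varepsilon]\times S^1$ with angular momentum in $(K_0-\varepsilon,K_0+\varepsilon)$ is closed. * $(\forall)^{\rm s\text{-}loc}$ Every nonsingular bounded orbit contained in $[\inf r|_\gamma,\sup r|_\gamma]\times S^1$ with the same angular momentum as $\gamma$ is closed, where $\gamma$ is the orbit in $(\exists)$. The potential $V$ is *closing* if $(\exists)$ and $(\forall)$ hold; *locally closing* if $(\exists)^{\rm loc}$ and $(\forall)^{\rm loc}$ hold; *semilocally closing* if $(\exists)$ and $(\forall)^{\rm s\text{-}loc}$ hold for some $\gamma$ and $(\forall)^{\rm loc}$ holds; *strongly closing* if every circle $\{r\}\times S^1$ is a strongly stable circular orbit and $(\forall)^{\rm loc}$ holds; *weakly closing* if every circle $\{r\}\times S^1$ is an orbitally stable circular orbit and the analogue of $(\forall)^{\rm loc}$ for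 all orbitally stable circular orbits holds. **Theorem (surfaces of Bertrand type II).** Assume that $f$ has no critical points on $(a,b)$ and that for no rational $\xi>0$ the identity $f''f-(f')^2=-\xi^2$ holds on all of $(a,b)$. Then, for each of the five senses of "closing": 1. There is at most one closing central potential, up to an additive and a positive multiplicative constant. 2. There is exactly one (up to these constants) if and only if there exist a positive rational $\mu$, a real $c$, a real $d\ne0$ and a $C^\infty$ function $\theta=\theta(r)$ on $(a,b)$ without zeros and with $\theta'(r)>0$, such that in the coordinates $(\theta,\varphi \bmod 2\pi)$ $$ds^2=\frac{d\theta^2}{(\theta^2+c-d\theta^{-2})^2}+\frac{d\varphi^2}{\mu^2(\theta^2+c-d\theta^{-2})}.$$ 3. The function $\theta$ and the triple $(\mu,c,d)$ are unique if they exist. Suppose that they exist. Then: 4. The closing potentials, in each of the five senses, are exactly the oscillator potentials $V(r)=\frac{A}{2\theta(r)^2}+B$ with real $A,B$ such that $A(\theta(r)^4+d)>0$ on $(a,b)$. For every such potential: 5. Each nonsingular noncircular bounded orbit is given by a periodic function $r=r(\varphi)$ with minimal positive period $\pi\mu$. 6. For every $r\in(a,b)$ the possible values of the angular momentum on the circular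 orbit $\{r\}\times S^1$ are exactly $K=\pm\frac1\mu\sqrt{\frac{A}{\theta(r)^4+d}}$. 7. At one of the two ends of $(a,b)$, $f$ tends to $\inf f$; and at an end of $(a,b)$, $f$ tends to $\inf f$ if and only if $A|\theta|$ tends to $\sup A|\theta|$, and if and only if $V$ tends to $\inf V$ (infima and suprema over $(a,b)$, in $[-\infty,\infty]$). That is, the boundary circle at which $\inf f$ is attained is the attracting centre of the field. -/

import Mathlib

open scoped ContDiff Topology

namespace Bertrand

/-- The open interval `(a, b)` of the real line, where `-∞ ≤ a` and `b ≤ ∞`. -/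
def interval (a b : EReal) : Set ℝ := {r : ℝ | a < (r : EReal) ∧ (r : EReal) < b}

/-- The metric `dr² + f(r)² dφ²` on `(a, b) × S¹`, evaluated on the tangent vector
`u ∂_r + v ∂_φ` at a point with first coordinate `r`. -/
def revolutionMetric (f : ℝ → ℝ) (r u v : ℝ) : ℝ := u ^ 2 + f r ^ 2 * v ^ 2

/-- `Q(x) = x² + c - d x⁻²`. -/
noncomputable def Q (c d x : ℝ) : ℝ := x ^ 2 + c - d / x ^ 2

/-- The quadratic form `dθ² / Q(θ)² + dφ² / (μ² Q(θ))`, evaluated at `θ = x` on the tangent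
vector `u ∂_θ + v ∂_φ`. -/
noncomputable def normalFormMetric (μ c d x u v : ℝ) : ℝ :=
  u ^ 2 / Q c d x ^ 2 + v ^ 2 / (μ ^ 2 * Q c d x)

/-- `θ` is a smooth coordinate on `(a, b)`, increasing and without zeros, such that the metric
`dr² + f(r)² dφ²` takes the normal form with the constants `μ, c, d` in the coordinates
`(θ, φ mod 2π)`; here `μ` is a positive rational and `d ≠ 0`. -/
structure HasNormalForm (a b : EReal) (f θ : ℝ → ℝ) (μ : ℚ) (c d : ℝ) : Prop where
  mu_pos : 0 < μ
  d_ne : d ≠ 0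
  smooth : ContDiffOn ℝ ∞ θ (interval a b)
  ne_zero : ∀ r ∈ interval a b, θ r ≠ 0
  deriv_pos : ∀ r ∈ interval a b, 0 < deriv θ r
  metric_eq : ∀ r ∈ interval a b, ∀ u v : ℝ,
    revolutionMetric f r u v = normalFormMetric μ c d (θ r) (deriv θ r * u) v

/-- `t ↦ (r t, φ t mod 2π)` solves, on the open time interval `J`, the equations of motion of the
central potential `V` on the surface with the metric `dr² + f(r)² dφ²`, that is, the
Euler-Lagrange equations of `(ṙ² + f(r)² φ̇²) / 2 - V(r)`. The function `φ` is a continuous lift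
of the angle to the real line. -/
structure IsTrajectoryOn (a b : EReal) (f V : ℝ → ℝ) (J : Set ℝ) (r φ : ℝ → ℝ) : Prop where
  isOpen : IsOpen J
  ordConnected : J.OrdConnected
  mem : ∀ t ∈ J, r t ∈ interval a b
  differentiable_r : ∀ t ∈ J, DifferentiableAt ℝ r t
  differentiable_phi : ∀ t ∈ J, DifferentiableAt ℝ φ t
  radial : ∀ t ∈ J, HasDerivAt (deriv r)
    (f (r t) * deriv f (r t) * deriv φ t ^ 2 - deriv V (r t)) t
  angular : ∀ t ∈ J, HasDerivAt (fun s => f (r s) ^ 2 * deriv φ s) 0 t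

/-- The integral of angular momentum `f(r)² φ̇` has the value `K` along the trajectory. -/
def HasMomentum (f : ℝ → ℝ) (J : Set ℝ) (r φ : ℝ → ℝ) (K : ℝ) : Prop :=
  ∀ t ∈ J, f (r t) ^ 2 * deriv φ t = K

/-- A bounded trajectory: defined for all times and contained in a compact annulus
`[r₁, r₂] × S¹` of the surface. -/
def IsBoundedTrajectory (a b : EReal) (f V r φ : ℝ → ℝ) : Prop :=
  IsTrajectoryOn a b f V Set.univ r φ ∧
    ∃ r₁ r₂ : ℝ, Set.Icc r₁ r₂ ⊆ interval a b ∧ ∀ t, r t ∈ Set.Icc r₁ r₂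

/-- The orbit on the surface of a trajectory that is defined for all times. -/
def orbit (r φ : ℝ → ℝ) : Set (ℝ × Real.Angle) := Set.range fun t => (r t, (φ t : Real.Angle))

/-- The orbit is a circle `{r₀} × S¹`. -/
def IsCircular (r φ : ℝ → ℝ) : Prop := ∃ r₀ : ℝ, orbit r φ = {r₀} ×ˢ Set.univ

/-- The orbit is closed, i.e. the motion on the surface is periodic. -/
def IsClosedOrbit (r φ : ℝ → ℝ) : Prop :=
  ∃ T : ℝ, 0 < T ∧ ∀ t, r (t + T) = r t ∧ (φ (t + T) : Real.Angle) = (φ t : Real.Angle)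

/-- `(r, φ)` is a nonsingular bounded trajectory, and `K ≠ 0` is its angular momentum. -/
def IsNonsingularBounded (a b : EReal) (f V r φ : ℝ → ℝ) (K : ℝ) : Prop :=
  IsBoundedTrajectory a b f V r φ ∧ HasMomentum f Set.univ r φ K ∧ K ≠ 0

/-- The circle `{r₀} × S¹` is the orbit of a trajectory with angular momentum `K₀`. -/
def IsCircularOrbit (a b : EReal) (f V : ℝ → ℝ) (r₀ K₀ : ℝ) : Prop :=
  ∃ r φ : ℝ → ℝ, IsTrajectoryOn a b f V Set.univ r φ ∧ HasMomentum f Set.univ r φ K₀ ∧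
    orbit r φ = {r₀} ×ˢ Set.univ

/-- The effective potential `V(r) + K² / (2 f(r)²)`. -/
noncomputable def effectivePotential (f V : ℝ → ℝ) (K r : ℝ) : ℝ := V r + K ^ 2 / (2 * f r ^ 2)

/-- `{r₀} × S¹` is a circular orbit with angular momentum `K₀ ≠ 0`, and the effective potential
for `K₀` has a nondegenerate local minimum at `r₀`. -/
def IsStronglyStable (a b : EReal) (f V : ℝ → ℝ) (r₀ K₀ : ℝ) : Prop :=
  IsCircularOrbit a b f V r₀ K₀ ∧ K₀ ≠ 0 ∧ IsLocalMin (effectivePotential f V K₀) r₀ ∧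
    deriv (deriv (effectivePotential f V K₀)) r₀ ≠ 0

/-- `{r₀} × S¹` is a circular orbit with angular momentum `K₀`, and the corresponding phase orbit
is Lyapunov orbitally stable within the level set of angular momentum `K₀`. On this level set,
`(r, φ mod 2π, ṙ)` are global coordinates (as `φ̇ = K₀ / f(r)²`), and the phase orbit is
`{r = r₀, ṙ = 0}`. -/
def IsOrbitallyStable (a b : EReal) (f V : ℝ → ℝ) (r₀ K₀ : ℝ) : Prop :=
  IsCircularOrbit a b f V r₀ K₀ ∧
    ∀ ε > 0, ∃ δ > 0, ∀ (J : Set ℝ) (r φ : ℝ → ℝ), IsTrajectoryOn a b f V J r φ →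
      HasMomentum f J r φ K₀ → 0 ∈ J → |r 0 - r₀| < δ → |deriv r 0| < δ →
        ∀ t ∈ J, 0 ≤ t → |r t - r₀| < ε ∧ |deriv r t| < ε

/-- Condition `(∃)`, for a given trajectory: it is bounded, nonsingular (with angular momentum
`K`) and noncircular. -/
def IsOscillating (a b : EReal) (f V r φ : ℝ → ℝ) (K : ℝ) : Prop :=
  IsNonsingularBounded a b f V r φ K ∧ ¬ IsCircular r φ

/-- For some `ε > 0`, all nonsingular bounded orbits that lie in `[r₀ - ε, r₀ + ε] × S¹` and have
angular momentum in `(K₀ - ε, K₀ + ε)` are closed. -/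
def ClosesNear (a b : EReal) (f V : ℝ → ℝ) (r₀ K₀ : ℝ) : Prop :=
  ∃ ε > 0, ∀ (r φ : ℝ → ℝ) (K : ℝ), IsNonsingularBounded a b f V r φ K →
    (∀ t, r t ∈ Set.Icc (r₀ - ε) (r₀ + ε)) → K ∈ Set.Ioo (K₀ - ε) (K₀ + ε) → IsClosedOrbit r φ

/-- Condition `(∀)^loc`. -/
def ForallLoc (a b : EReal) (f V : ℝ → ℝ) : Prop :=
  ∀ r₀ K₀ : ℝ, IsStronglyStable a b f V r₀ K₀ → ClosesNear a b f V r₀ K₀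

/-- The five senses in which a central potential may be closing. -/
inductive Sense
  | closing
  | locally
  | semilocally
  | strongly
  | weakly

/-- The condition on the orbits that defines each sense. -/
def ClosingCondition (a b : EReal) (f V : ℝ → ℝ) : Sense → Prop
  | .closing =>
      (∃ (r φ : ℝ → ℝ) (K : ℝ), IsOscillating a b f V r φ K) ∧
      ∀ (r φ : ℝ → ℝ) (K : ℝ), IsNonsingularBounded a b f V r φ K → IsClosedOrbit r φ
  | .locally =>
      (∃ r₀ K₀ : ℝ, IsStronglyStable a b f V r₀ K₀) ∧ ForallLoc a b f V
  | .semilocally =>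
      (∃ (r φ : ℝ → ℝ) (K : ℝ), IsOscillating a b f V r φ K ∧
        ∀ r' φ' : ℝ → ℝ, IsNonsingularBounded a b f V r' φ' K →
          (∀ t, r' t ∈ Set.Icc (sInf (Set.range r)) (sSup (Set.range r))) →
            IsClosedOrbit r' φ') ∧
      ForallLoc a b f V
  | .strongly =>
      (∀ r₀ ∈ interval a b, ∃ K₀ : ℝ, IsStronglyStable a b f V r₀ K₀) ∧ ForallLoc a b f V
  | .weakly =>
      (∀ r₀ ∈ interval a b, ∃ K₀ : ℝ, IsOrbitallyStable a b f V r₀ K₀) ∧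
      ∀ r₀ K₀ : ℝ, IsOrbitallyStable a b f V r₀ K₀ → ClosesNear a b f V r₀ K₀

/-- `V` is a smooth central potential that is closing in the sense `s`. -/
def IsClosing (a b : EReal) (f : ℝ → ℝ) (s : Sense) (V : ℝ → ℝ) : Prop :=
  ContDiffOn ℝ ∞ V (interval a b) ∧ ClosingCondition a b f V s

/-- The potentials agree on `(a, b)` up to an additive and a positive multiplicative constant. -/
def SameUpToConstants (a b : EReal) (V W : ℝ → ℝ) : Prop :=
  ∃ α β : ℝ, 0 < α ∧ ∀ r ∈ interval a b, W r = α * V r + β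

/-- The lifted orbit is the graph `r = R(φ)`, `φ ∈ ℝ`, of a periodic function `R` whose minimal
positive period is `Φ`. -/
def IsGraphOfPeriod (r φ : ℝ → ℝ) (Φ : ℝ) : Prop :=
  ∃ R : ℝ → ℝ, (Set.range fun t => (r t, φ t)) = (Set.range fun ψ => (R ψ, ψ)) ∧
    IsLeast {T : ℝ | 0 < T ∧ Function.Periodic R T} Φ

/-- The two ends of the interval `(a, b)` (equivalently, the two boundary circles of the surface),
as filters: `r → a+` and `r → b-`. -/
def ends (a b : EReal) : Set (Filter ℝ) :=
  {Filter.comap Real.toEReal (𝓝[>] a), Filter.comap Real.toEReal (𝓝[<] b)}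

/-- The infimum of `g` over `(a, b)`, possibly `-∞`, is attained as a limit at the end `l`. -/
def AttainsInfAt (a b : EReal) (g : ℝ → ℝ) (l : Filter ℝ) : Prop :=
  Filter.Tendsto (fun r => (g r : EReal)) l (𝓝 (⨅ r ∈ interval a b, (g r : EReal)))

/-- The supremum of `g` over `(a, b)`, possibly `∞`, is attained as a limit at the end `l`. -/
def AttainsSupAt (a b : EReal) (g : ℝ → ℝ) (l : Filter ℝ) : Prop :=
  Filter.Tendsto (fun r => (g r : EReal)) l (𝓝 (⨆ r ∈ interval a b, (g r : EReal)))

end Bertrand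

/-! Fix the angular momentum `K`, take the angle as time and a coordinate `y` with `dy = dr / f²`.
The orbits become motions of Newton's equation in the potential `G + P / K²`, where `G = 1 / (2 f²)`
and `P = V` are regarded as functions of `y`. A nonsingular bounded orbit is closed exactly when its
motion in `y` has some `2πn` as a period (`IsNonsingularBounded.isClosedOrbit_iff`). The problem is
now one about a one-parameter family of potentials on an interval.

Necessity. Near a nondegenerate minimum `W` of this family the period is a continuous function of
the amplitude with values in the rational multiples of `2π`, hence constant. At amplitude zero this
says that `W''` is a rational square; to second order in the amplitude it says `5 W'''² = 3 W''
W''''` (`isochronicity_of_periodic`). Rationality also prevents the frequency from varying with the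
circle, and a connectedness argument spreads one frequency `ν` over the whole surface
(`frequency_rigid`): `G'' P' - G' P'' = ν² P'`. Eliminating `G` with the isochronicity condition
leaves `4 P''² = 3 P' P'''`, so `P'` is constant or proportional to `(y - m)⁻³`. In the first case
`G'' = ν²`, that is `f'' f - f'² = -ν²`, which is excluded. In the second the equation is linear in
`G'` and yields `G = ν² (y - m)² / 8 + C - D / (2 (y - m)²)`, where `D = 0` is excluded for the same
reason (`exists_oscillator_of_isochronicity`). Rescaling `y - m` gives `θ` and the normal form.

Sufficiency. In the normal form both `G` and `V` are combinations of `θ²`, `θ⁻²` and constants, so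
`θ²` is a constant plus a harmonic oscillation of frequency `2 / μ` in the angle
(`HasNormalForm.exists_theta_sq_eq`). Its period `πμ` is commensurable with `2π`, and every
nonsingular bounded orbit closes.

The five senses. Each implies the local one. In the closing and semilocal cases the well traversed
by the given orbit has a bottom, and motions launched from it share a common period; at a degenerate
bottom slow motions could not return in that time (`second_deriv_pos_of_periodic`). In the weak
case, if no circle were strongly stable, stability would force a constant effective potential for
some `K`, in which orbits drift away. Conversely an oscillator potential has all circles strongly
stable and all nonsingular bounded orbits closed, which suffices for every sense. -/

namespace Bertrand

/-! ### Global inverses and extension of smooth germs -/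

/-- A function on the line whose derivative keeps its sign and stays away from zero has a
differentiable inverse defined on the whole line. -/
theorem exists_inverse_of_deriv_bound {φ q : ℝ → ℝ} {c : ℝ} (hc : 0 < c)
    (hφ : ∀ t, HasDerivAt φ (q t) t) (hq : (∀ t, c ≤ q t) ∨ ∀ t, q t ≤ -c) :
    ∃ τ : ℝ → ℝ, (∀ t, τ (φ t) = t) ∧ (∀ s, φ (τ s) = s) ∧
      ∀ s, HasDerivAt τ (q (τ s))⁻¹ s := by
  have main : ∀ {φ q : ℝ → ℝ}, (∀ t, HasDerivAt φ (q t) t) → (∀ t, c ≤ q t) →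
      ∃ τ : ℝ → ℝ, (∀ t, τ (φ t) = t) ∧ (∀ s, φ (τ s) = s) ∧
        ∀ s, HasDerivAt τ (q (τ s))⁻¹ s := by
    intro φ q hφ hq
    have hmono : StrictMono φ := strictMono_of_deriv_pos fun t => by
      rw [(hφ t).deriv]; linarith [hq t]
    have hcont : Continuous φ := continuous_iff_continuousAt.2 fun t => (hφ t).continuousAt
    -- The bound away from zero gives at least linear growth, which is what makes `φ` onto;
    -- positivity of the derivative alone would not.
    have hlin : Monotone fun t => φ t - c * t := by
      have hd : ∀ t, HasDerivAt (fun t => φ t - c * t) (q t - c * 1) t := fun t =>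
        (hφ t).sub ((hasDerivAt_id t).const_mul c)
      exact monotone_of_deriv_nonneg (fun t => (hd t).differentiableAt) fun t => by
        rw [(hd t).deriv]; linarith [hq t]
    have htop : Filter.Tendsto φ Filter.atTop Filter.atTop := by
      have h1 : Filter.Tendsto (fun t => φ 0 + c * t) Filter.atTop Filter.atTop :=
        Filter.tendsto_atTop_add_const_left _ _ (Filter.tendsto_id.const_mul_atTop hc)
      refine Filter.tendsto_atTop_mono' _ ?_ h1
      filter_upwards [Filter.eventually_ge_atTop 0] with t ht
      have := hlin ht
      simp only [mul_zero, sub_zero] at this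
      linarith
    have hbot : Filter.Tendsto φ Filter.atBot Filter.atBot := by
      have h1 : Filter.Tendsto (fun t => φ 0 + c * t) Filter.atBot Filter.atBot :=
        Filter.tendsto_atBot_add_const_left _ _ (Filter.tendsto_id.const_mul_atBot hc)
      refine Filter.tendsto_atBot_mono' _ ?_ h1
      filter_upwards [Filter.eventually_le_atBot 0] with t ht
      have := hlin ht
      simp only [mul_zero, sub_zero] at this
      linarith
    have hsurj : Function.Surjective φ := hcont.surjective htop hbot
    let e := hmono.orderIsoOfSurjective φ hsurj
    have he : ∀ s, φ (e.symm s) = s := fun s => e.apply_symm_apply s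
    refine ⟨e.symm, fun t => e.symm_apply_apply t, he, fun s => ?_⟩
    exact HasDerivAt.of_local_left_inverse (f := φ) e.symm.continuous.continuousAt
      (hφ _) (by linarith [hq (e.symm s)]) (Filter.Eventually.of_forall he)
  rcases hq with hq | hq
  · exact main hφ hq
  · obtain ⟨τ, h1, h2, h3⟩ := main (φ := fun t => -φ t) (q := fun t => -q t)
      (fun t => (hφ t).neg) fun t => by linarith [hq t]
    refine ⟨fun s => τ (-s), fun t => h1 t, fun s => ?_, fun s => ?_⟩
    · have := h2 (-s); linarith
    · have := (h3 (-s)).comp s (hasDerivAt_neg s)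
      convert! this using 1
      rw [← neg_inv, mul_neg, mul_one, neg_neg]

/-- A germ of a smooth function extends to a smooth function on the whole line. -/
theorem exists_contDiff_eventuallyEq {n : WithTop ℕ∞} (hn : n ≤ ∞) {F : ℝ → ℝ} {U : Set ℝ}
    {x₀ : ℝ} (hU : U ∈ 𝓝 x₀) (hF : ContDiffOn ℝ n F U) :
    ∃ g : ℝ → ℝ, ContDiff ℝ n g ∧ g =ᶠ[𝓝 x₀] F := by
  obtain ⟨r, hr, hball⟩ := Metric.mem_nhds_iff.1 hU
  let b : ContDiffBump x₀ := ⟨r / 4, r / 2, by positivity, by linarith⟩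
  have hb : ContDiff ℝ n b := b.contDiff.of_le hn
  refine ⟨fun x => b x * F x, contDiff_iff_contDiffAt.2 fun x => ?_, ?_⟩
  · by_cases hx : x ∈ Metric.ball x₀ r
    · exact hb.contDiffAt.mul
        (hF.contDiffAt (Filter.mem_of_superset (Metric.isOpen_ball.mem_nhds hx) hball))
    · have hx' : x ∈ (Metric.closedBall x₀ (r / 2))ᶜ := by
        simp only [Metric.mem_ball, not_lt, Set.mem_compl_iff, Metric.mem_closedBall,
          not_le] at hx ⊢
        linarith
      have : (fun x => b x * F x) =ᶠ[𝓝 x] fun _ => 0 := by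
        filter_upwards [Metric.isClosed_closedBall.isOpen_compl.mem_nhds hx'] with z hz
        simp only [Set.mem_compl_iff, Metric.mem_closedBall, not_le] at hz
        rw [b.zero_of_le_dist hz.le, zero_mul]
      exact contDiffAt_const.congr_of_eventuallyEq this
  · filter_upwards [b.eventuallyEq_one] with x hx
    simp [hx]

/-! ### Newton's equation on the line: existence, uniqueness, energy, periods -/

/-- `x` is a solution, for all times, of Newton's equation `ẍ = F(x)`, with velocity `y`. -/
structure IsNewtonSolution (F x y : ℝ → ℝ) : Prop where
  hasDerivAt_pos : ∀ t, HasDerivAt x (y t) t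
  hasDerivAt_vel : ∀ t, HasDerivAt y (F (x t)) t

/-- The map `c` acts on the velocity so that one statement covers both the Newton field itself (`c`
the identity) and the bounded field obtained by truncating the velocity. -/
theorem lipschitzWith_newtonField {F : ℝ → ℝ} {L : NNReal} (hF : LipschitzWith L F) {c : ℝ → ℝ}
    (hc : LipschitzWith 1 c) :
    LipschitzWith (max 1 L) fun p : ℝ × ℝ => (c p.2, F p.1) := by
  have h1 : LipschitzWith (1 * 1) fun p : ℝ × ℝ => c p.2 := hc.comp LipschitzWith.prod_snd
  have h2 : LipschitzWith (L * 1) fun p : ℝ × ℝ => F p.1 := hF.comp LipschitzWith.prod_fst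
  simpa using h1.prodMk h2

theorem IsNewtonSolution.hasDerivAt_prod {F x y : ℝ → ℝ} (h : IsNewtonSolution F x y) (t : ℝ) :
    HasDerivAt (fun s => (x s, y s)) (y t, F (x t)) t :=
  (h.hasDerivAt_pos t).prodMk (h.hasDerivAt_vel t)

theorem IsNewtonSolution.dist_le {F x y x' y' : ℝ → ℝ} {L : NNReal} (hF : LipschitzWith L F)
    (h : IsNewtonSolution F x y) (h' : IsNewtonSolution F x' y') (h0 : x 0 = x' 0) {t : ℝ}
    (ht : 0 ≤ t) :
    |x t - x' t| ≤ |y 0 - y' 0| * Real.exp ((max 1 L : NNReal) * t) ∧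
      |y t - y' t| ≤ |y 0 - y' 0| * Real.exp ((max 1 L : NNReal) * t) := by
  have hc : ∀ {x y : ℝ → ℝ}, IsNewtonSolution F x y →
      ContinuousOn (fun s => (x s, y s)) (Set.Icc 0 t) := fun h s _ =>
    (h.hasDerivAt_prod s).continuousAt.continuousWithinAt
  have := dist_le_of_trajectories_ODE (v := fun _ (p : ℝ × ℝ) => (p.2, F p.1)) (a := 0) (b := t)
    (f := fun s => (x s, y s)) (g := fun s => (x' s, y' s)) (δ := |y 0 - y' 0|)
    (fun _ => lipschitzWith_newtonField hF LipschitzWith.id) (hc h)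
    (fun s _ => (h.hasDerivAt_prod s).hasDerivWithinAt) (hc h')
    (fun s _ => (h'.hasDerivAt_prod s).hasDerivWithinAt)
    (by simp [Prod.dist_eq, h0, Real.dist_eq]) t ⟨ht, le_rfl⟩
  rw [Prod.dist_eq, sub_zero] at this
  exact ⟨(le_max_left _ _).trans this, (le_max_right _ _).trans this⟩

/-- The Picard–Lindelöf theorem wants a bounded field, so the velocity is truncated at `M = |v| + B
N`. As the force is at most `B`, the velocity cannot exceed `M` during a time `N`, and the
truncation is never felt. -/
theorem exists_newton_solution_on_Ioo {F : ℝ → ℝ} {L : NNReal} {B : ℝ} (hF : LipschitzWith L F)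
    (hB : ∀ x, |F x| ≤ B) (x₀ v : ℝ) {N : ℝ} (hN : 0 < N) :
    ∃ x y : ℝ → ℝ, x 0 = x₀ ∧ y 0 = v ∧
      ∀ t ∈ Set.Ioo (-N) N, HasDerivAt x (y t) t ∧ HasDerivAt y (F (x t)) t := by
  have hB0 : 0 ≤ B := (abs_nonneg _).trans (hB 0)
  set M : ℝ := |v| + B * N with hM
  have hM0 : 0 ≤ M := by positivity
  let c : ℝ → ℝ := fun y => max (min y M) (-M)
  have hc : LipschitzWith 1 c := (LipschitzWith.id.min_const M).max_const (-M)
  have hcM : ∀ y, |c y| ≤ M := fun y => abs_le.2 ⟨le_max_right _ _,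
    max_le (min_le_right _ _) (by linarith)⟩
  have hcid : ∀ y, |y| ≤ M → c y = y := fun y hy => by
    rw [abs_le] at hy
    simp only [c]
    rw [min_eq_left hy.2, max_eq_left hy.1]
  let C : NNReal := ⟨max M B, le_max_of_le_left hM0⟩
  have hPL : IsPicardLindelof (fun _ (p : ℝ × ℝ) => (c p.2, F p.1)) (tmin := -N) (tmax := N)
      ⟨0, by constructor <;> linarith⟩ (x₀, v) (C * ⟨N, hN.le⟩) 0 C (max 1 L) := by
    refine IsPicardLindelof.of_time_independent (fun p _ => ?_)
      (lipschitzWith_newtonField hF hc).lipschitzOnWith ?_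
    · rw [Prod.norm_def]
      exact max_le_max (hcM _) (hB _)
    · simp only [sub_zero, zero_sub, neg_neg, max_self, NNReal.coe_zero]
      exact (NNReal.coe_mul C ⟨N, hN.le⟩).ge
  obtain ⟨α, hα0, hα⟩ := hPL.exists_eq_forall_mem_Icc_hasDerivWithinAt₀
  have hd : ∀ t ∈ Set.Ioo (-N) N, HasDerivAt α (c (α t).2, F (α t).1) t := fun t ht =>
    (hα t (Set.Ioo_subset_Icc_self ht)).hasDerivAt (Icc_mem_nhds ht.1 ht.2)
  have hy : ∀ t ∈ Set.Ioo (-N) N, HasDerivAt (fun s => (α s).2) (F (α t).1) t := fun t ht =>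
    (hasFDerivAt_snd.comp_hasDerivAt t (hd t ht) :)
  have hx : ∀ t ∈ Set.Ioo (-N) N, HasDerivAt (fun s => (α s).1) (c (α t).2) t := fun t ht =>
    (hasFDerivAt_fst.comp_hasDerivAt t (hd t ht) :)
  have h00 : α 0 = (x₀, v) := hα0
  refine ⟨fun s => (α s).1, fun s => (α s).2, by simp [h00], by simp [h00], fun t ht => ⟨?_, hy t ht⟩⟩
  have hbd : |(α t).2| ≤ M := by
    have h := (convex_Ioo (-N) N).norm_image_sub_le_of_norm_hasDerivWithin_le
      (f := fun s => (α s).2) (C := B) (x := 0) (y := t)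
      (fun s hs => (hy s hs).hasDerivWithinAt) (fun s _ => hB _) ⟨by linarith, hN⟩ ht
    simp only [h00, Real.norm_eq_abs, sub_zero] at h
    have h1 : |t| ≤ N := abs_le.2 ⟨ht.1.le, ht.2.le⟩
    have h2 : B * |t| ≤ B * N := mul_le_mul_of_nonneg_left h1 hB0
    have h3 : |(α t).2| ≤ |(α t).2 - v| + |v| := by simpa using abs_add_le ((α t).2 - v) v
    linarith
  have := hx t ht
  rwa [hcid _ hbd] at this

/-- Newton's equation with a bounded Lipschitz force has a solution for all times. -/
theorem exists_newton_solution {F : ℝ → ℝ} {L : NNReal} {B : ℝ} (hF : LipschitzWith L F)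
    (hB : ∀ x, |F x| ≤ B) (x₀ v : ℝ) :
    ∃ x y : ℝ → ℝ, IsNewtonSolution F x y ∧ x 0 = x₀ ∧ y 0 = v := by
  have hex : ∀ n : ℕ, ∃ α : ℝ → ℝ × ℝ, α 0 = (x₀, v) ∧ ∀ t ∈ Set.Ioo (-(n + 1 : ℝ)) (n + 1),
      HasDerivAt α ((α t).2, F (α t).1) t := fun n => by
    obtain ⟨x, y, hx, hy, h⟩ := exists_newton_solution_on_Ioo hF hB x₀ v
      (by positivity : (0 : ℝ) < n + 1)
    exact ⟨fun s => (x s, y s), by simp [hx, hy], fun t ht => (h t ht).1.prodMk (h t ht).2⟩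
  choose α hα0 hα using hex
  have heq : ∀ m n : ℕ, m ≤ n → Set.EqOn (α m) (α n) (Set.Ioo (-(m + 1 : ℝ)) (m + 1)) := by
    intro m n hmn
    have hmn' : (m : ℝ) ≤ n := by exact_mod_cast hmn
    refine ODE_solution_unique_of_mem_Ioo (v := fun _ (p : ℝ × ℝ) => (p.2, F p.1))
      (s := fun _ => Set.univ) (t₀ := 0) (K := max 1 L)
      (fun _ _ => (lipschitzWith_newtonField hF LipschitzWith.id).lipschitzOnWith) ?_
      (fun t ht => ⟨hα m t ht, trivial⟩) (fun t ht => ⟨hα n t ?_, trivial⟩) ?_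
    · constructor <;> linarith [(Nat.cast_nonneg m : (0 : ℝ) ≤ m)]
    · exact ⟨by linarith [ht.1], by linarith [ht.2]⟩
    · rw [hα0, hα0]
  -- Near `t` the solution with index `⌈|t|⌉` is used. Its interval has radius `⌈|t|⌉ + 1`, so `t`
  -- is an interior point and derivatives can be taken there.
  let γ : ℝ → ℝ × ℝ := fun t => α ⌈|t|⌉₊ t
  have hγ : ∀ (n : ℕ) (t : ℝ), t ∈ Set.Ioo (-(n + 1 : ℝ)) (n + 1) → γ t = α n t := by
    intro n t ht
    have hc : |t| ≤ ⌈|t|⌉₊ := Nat.le_ceil _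
    have ht' : t ∈ Set.Ioo (-((⌈|t|⌉₊ : ℕ) + 1 : ℝ)) ((⌈|t|⌉₊ : ℕ) + 1) := by
      rw [Set.mem_Ioo, ← abs_lt]; linarith
    rcases le_total ⌈|t|⌉₊ n with h | h
    · exact heq _ _ h ht'
    · exact (heq _ _ h ht).symm
  have hd : ∀ t, HasDerivAt γ ((γ t).2, F (γ t).1) t := by
    intro t
    have ht : t ∈ Set.Ioo (-((⌈|t|⌉₊ : ℕ) + 1 : ℝ)) ((⌈|t|⌉₊ : ℕ) + 1) := by
      rw [Set.mem_Ioo, ← abs_lt]; linarith [Nat.le_ceil |t|]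
    have h := hα ⌈|t|⌉₊ t ht
    rw [← hγ _ t ht] at h
    refine h.congr_of_eventuallyEq ?_
    filter_upwards [isOpen_Ioo.mem_nhds ht] with s hs using hγ _ s hs
  have h0 : γ 0 = (x₀, v) := hα0 _
  exact ⟨fun s => (γ s).1, fun s => (γ s).2,
    ⟨fun t => (hasFDerivAt_fst.comp_hasDerivAt t (hd t) :),
      fun t => (hasFDerivAt_snd.comp_hasDerivAt t (hd t) :)⟩, by simp [h0], by simp [h0]⟩

theorem IsNewtonSolution.energy_eq {W W' x y : ℝ → ℝ} (hW : ∀ t, HasDerivAt W (W' (x t)) (x t))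
    (h : IsNewtonSolution (fun s => -W' s) x y) (s t : ℝ) :
    y s ^ 2 / 2 + W (x s) = y t ^ 2 / 2 + W (x t) := by
  have hd : ∀ t, HasDerivAt (fun t => y t ^ 2 / 2 + W (x t)) 0 t := fun t => by
    have h1 := ((h.hasDerivAt_vel t).pow 2).div_const 2
    have h2 := (hW t).comp t (h.hasDerivAt_pos t)
    convert! h1.add h2 using 1
    push_cast; ring
  exact is_const_of_deriv_eq_zero (fun t => (hd t).differentiableAt) (fun t => (hd t).deriv) s t

/-- The image is connected and countable, hence a point. This is how closedness of orbits turns into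
constancy of periods. -/
theorem IsPreconnected.eq_of_rational_multiple {s : Set ℝ} (hs : IsPreconnected s) {g : ℝ → ℝ}
    {c : ℝ} (hg : ContinuousOn g s) (hq : ∀ x ∈ s, ∃ q : ℚ, g x = q * c) {x y : ℝ} (hx : x ∈ s)
    (hy : y ∈ s) : g x = g y := by
  have hcount : (Set.range fun q : ℚ => (q : ℝ) * c).Countable := Set.countable_range _
  refine hcount.isTotallyDisconnected (g '' s) ?_ (hs.image g hg) ⟨x, hx, rfl⟩ ⟨y, hy, rfl⟩
  rintro _ ⟨z, hz, rfl⟩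
  obtain ⟨q, h⟩ := hq z hz
  exact ⟨q, h.symm⟩

/-- Two periods with irrational ratio generate a dense group of periods, and a continuous function
with a dense group of periods is constant. -/
theorem exists_rational_of_periodic {x : ℝ → ℝ} (hx : Continuous x) {p q : ℝ} (hq : q ≠ 0)
    (hp : Function.Periodic x p) (hxq : Function.Periodic x q) (hne : ∃ t, x t ≠ x 0) :
    ∃ r : ℚ, p = r * q := by
  by_contra hcon
  have hirr : Irrational (p / q) := by
    rintro ⟨r, hr⟩
    exact hcon ⟨r, by rw [hr]; field_simp⟩
  have hd := dense_addSubgroupClosure_pair_iff.2 hirr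
  let P : AddSubgroup ℝ :=
    { carrier := {c | Function.Periodic x c}
      zero_mem' := fun t => by simp
      add_mem' := fun h1 h2 => h1.add_period h2
      neg_mem' := fun h => h.neg }
  have hle : AddSubgroup.closure {p, q} ≤ P := by
    rw [AddSubgroup.closure_le]
    rintro c (rfl | rfl)
    · exact hp
    · exact hxq
  have hcl : IsClosed {c | x c = x 0} := isClosed_eq hx continuous_const
  have hsub : (AddSubgroup.closure {p, q} : Set ℝ) ⊆ {c | x c = x 0} := fun c hc => by
    have := hle hc 0
    simpa using this
  obtain ⟨t, ht⟩ := hne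
  exact ht (hcl.closure_subset_iff.2 hsub (hd t))

theorem IsNewtonSolution.shift {F x y : ℝ → ℝ} (h : IsNewtonSolution F x y) (T : ℝ) :
    IsNewtonSolution F (fun t => x (t + T)) fun t => y (t + T) :=
  ⟨fun t => (h.hasDerivAt_pos (t + T)).comp_add_const t T,
    fun t => (h.hasDerivAt_vel (t + T)).comp_add_const t T⟩

theorem IsNewtonSolution.continuous {F x y : ℝ → ℝ} (h : IsNewtonSolution F x y) :
    Continuous x := continuous_iff_continuousAt.2 fun t => (h.hasDerivAt_pos t).continuousAt

theorem IsNewtonSolution.continuous_vel {F x y : ℝ → ℝ} (h : IsNewtonSolution F x y) :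
    Continuous y := continuous_iff_continuousAt.2 fun t => (h.hasDerivAt_vel t).continuousAt

theorem IsNewtonSolution.periodic {F x y : ℝ → ℝ} {L : NNReal} (hF : LipschitzWith L F)
    (h : IsNewtonSolution F x y) {T : ℝ} (hx : x T = x 0) (hy : y T = y 0) :
    Function.Periodic x T := by
  have := ODE_solution_unique_univ (v := fun _ (p : ℝ × ℝ) => (p.2, F p.1))
    (s := fun _ => Set.univ) (t₀ := 0) (K := max 1 L) (f := fun t => (x (t + T), y (t + T)))
    (g := fun t => (x t, y t))
    (fun _ => (lipschitzWith_newtonField hF LipschitzWith.id).lipschitzOnWith)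
    (fun t => ⟨(h.shift T).hasDerivAt_prod t, trivial⟩) (fun t => ⟨h.hasDerivAt_prod t, trivial⟩)
    (by simp [hx, hy])
  intro t
  exact congrArg Prod.fst (congrFun this t)

theorem IsNewtonSolution.periodic_vel {F x y : ℝ → ℝ} (h : IsNewtonSolution F x y) {T : ℝ}
    (hx : Function.Periodic x T) : Function.Periodic y T := by
  intro t
  have h1 := (h.shift T).hasDerivAt_pos t
  have h2 : (fun t => x (t + T)) = x := funext hx
  rw [h2] at h1
  exact h1.unique (h.hasDerivAt_pos t)

/-! ### Motions in a potential well and near a potential hill -/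

/-- Near an equilibrium that is not a nondegenerate minimum, a slow motion to the right does not
turn back for a long time. -/
theorem IsNewtonSolution.lt_of_small_velocity {F x y : ℝ → ℝ} {θ δ κ T : ℝ}
    (h : IsNewtonSolution F x y) (hκ : 0 < κ) (hT : 0 < T) (hκT : κ * T < Real.pi / 2)
    (hF : ∀ s, θ ≤ s → s < θ + δ → -κ ^ 2 * (s - θ) ≤ F s) (hx0 : x 0 = θ) (hy0 : 0 < y 0)
    (hx : ∀ t ∈ Set.Icc 0 T, x t < θ + δ) : θ < x T := by
  have hmono : ∀ t₁ ∈ Set.Icc 0 T, (∀ t ∈ Set.Ico 0 t₁, 0 < y t) →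
      StrictMonoOn x (Set.Icc 0 t₁) := by
    intro t₁ _ hpos
    refine strictMonoOn_of_deriv_pos (convex_Icc 0 t₁) h.continuous.continuousOn fun t ht => ?_
    rw [interior_Icc] at ht
    rw [(h.hasDerivAt_pos t).deriv]
    exact hpos t ⟨ht.1.le, ht.2⟩
  have hpos : ∀ t ∈ Set.Icc 0 T, 0 < y t := by
    by_contra! hcon
    have hne : (Set.Icc 0 T ∩ {t | y t ≤ 0}).Nonempty := by
      obtain ⟨t, ht, hyt⟩ := hcon; exact ⟨t, ht, hyt⟩
    have hcpt : IsCompact (Set.Icc 0 T ∩ {t | y t ≤ 0}) :=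
      isCompact_Icc.inter_right (isClosed_le h.continuous_vel continuous_const)
    obtain ⟨t₁, ⟨ht₁, hyt₁⟩, hleast⟩ := hcpt.exists_isLeast hne
    have hbefore : ∀ t ∈ Set.Ico 0 t₁, 0 < y t := fun t ht => by
      by_contra! hle
      exact absurd (hleast ⟨⟨ht.1, ht.2.le.trans ht₁.2⟩, hle⟩) (not_le.2 ht.2)
    have ht₁0 : 0 < t₁ := by
      rcases ht₁.1.eq_or_lt with h0 | h0
      · rw [← h0] at hyt₁; exact absurd hyt₁ (not_le.2 hy0)
      · exact h0
    have hxm := hmono t₁ ht₁ hbefore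
    have hxge : ∀ t ∈ Set.Icc 0 t₁, θ ≤ x t := fun t ht => by
      rw [← hx0]; exact hxm.monotoneOn ⟨le_rfl, ht₁0.le⟩ ht ht.1
    have hcosarg : ∀ t ∈ Set.Icc 0 t₁, 0 ≤ κ * t ∧ κ * t < Real.pi / 2 := fun t ht =>
      ⟨mul_nonneg hκ.le ht.1,
        (mul_le_mul_of_nonneg_left (ht.2.trans ht₁.2) hκ.le).trans_lt hκT⟩
    -- Sturm comparison: `N` is the Wronskian of `x - θ` and `sin (κ t)`. It vanishes at `0` and is
    -- nondecreasing up to `t₁`, whereas a nonpositive velocity at `t₁` would make it negative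
    -- there.
    let N : ℝ → ℝ := fun t => y t * Real.sin (κ * t) - κ * (x t - θ) * Real.cos (κ * t)
    have hN : ∀ t, HasDerivAt N ((F (x t) + κ ^ 2 * (x t - θ)) * Real.sin (κ * t)) t := fun t => by
      have hl : HasDerivAt (fun t => κ * t) κ t := by simpa using (hasDerivAt_id t).const_mul κ
      have h1 := (h.hasDerivAt_vel t).mul hl.sin
      have h2 := (((h.hasDerivAt_pos t).sub_const θ).const_mul κ).mul hl.cos
      convert! h1.sub h2 using 1
      ring
    have hNmono : MonotoneOn N (Set.Icc 0 t₁) := by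
      refine monotoneOn_of_deriv_nonneg (convex_Icc 0 t₁)
        (fun t _ => (hN t).continuousAt.continuousWithinAt)
        (fun t _ => (hN t).differentiableAt.differentiableWithinAt) fun t ht => ?_
      have ht' := interior_subset ht
      rw [(hN t).deriv]
      have h1 := hF (x t) (hxge t ht') (hx t ⟨ht'.1, ht'.2.trans ht₁.2⟩)
      exact mul_nonneg (by linarith) (Real.sin_nonneg_of_nonneg_of_le_pi (hcosarg t ht').1
        (by linarith [(hcosarg t ht').2, Real.pi_pos]))
    have h0 := hNmono ⟨le_rfl, ht₁0.le⟩ ⟨ht₁0.le, le_rfl⟩ ht₁0.le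
    simp only [N, hx0, mul_zero, Real.sin_zero, sub_self, zero_mul] at h0
    have hc := hcosarg t₁ ⟨ht₁0.le, le_rfl⟩
    have hcos : 0 < Real.cos (κ * t₁) := Real.cos_pos_of_mem_Ioo ⟨by linarith [Real.pi_pos], hc.2⟩
    have hsin : 0 ≤ Real.sin (κ * t₁) :=
      Real.sin_nonneg_of_nonneg_of_le_pi hc.1 (by linarith [Real.pi_pos])
    have hZ : 0 < x t₁ - θ := by
      have := hxm ⟨le_rfl, ht₁0.le⟩ ⟨ht₁0.le, le_rfl⟩ ht₁0
      linarith
    have h3 : y t₁ * Real.sin (κ * t₁) ≤ 0 := mul_nonpos_of_nonpos_of_nonneg hyt₁ hsin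
    have h4 : 0 < κ * (x t₁ - θ) * Real.cos (κ * t₁) := by positivity
    linarith
  have := hmono T ⟨hT.le, le_rfl⟩ (fun t ht => hpos t ⟨ht.1, ht.2.le⟩) ⟨le_rfl, hT.le⟩
    ⟨hT.le, le_rfl⟩ hT
  rwa [hx0] at this

/-- A potential on `[α, β]` with Lipschitz derivative extends to the line, with a constant force
on either side. -/
theorem exists_clamped_potential {W W' : ℝ → ℝ} {α β : ℝ} {L : NNReal} (hαβ : α ≤ β)
    (hW : ∀ s ∈ Set.Icc α β, HasDerivAt W (W' s) s) (hL : LipschitzOnWith L W' (Set.Icc α β)) :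
    ∃ P P' : ℝ → ℝ, LipschitzWith L P' ∧ (∃ B, ∀ s, |P' s| ≤ B) ∧ (∀ s, HasDerivAt P (P' s) s) ∧
      (∀ s ∈ Set.Icc α β, P s = W s) ∧ (∀ s ∈ Set.Icc α β, P' s = W' s) ∧
      (∀ s, β ≤ s → P' s = W' β) ∧ ∀ s, s ≤ α → P' s = W' α := by
  let P' : ℝ → ℝ := fun s => W' (Set.projIcc α β hαβ s)
  have hP'L : LipschitzWith L P' := by
    have h1 : LipschitzWith L fun z : Set.Icc α β => W' z := by
      intro z w; exact hL z.2 w.2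
    have h2 := h1.comp (LipschitzWith.projIcc hαβ)
    rw [mul_one] at h2
    exact h2
  have hP'W : ∀ s ∈ Set.Icc α β, P' s = W' s := fun s hs => by
    simp only [P']; rw [Set.projIcc_of_mem hαβ hs]
  have hcont := hP'L.continuous
  let P : ℝ → ℝ := fun s => W α + ∫ z in α..s, P' z
  have hP : ∀ s, HasDerivAt P (P' s) s := fun s =>
    (intervalIntegral.integral_hasDerivAt_right (hcont.intervalIntegrable _ _)
      (hcont.stronglyMeasurableAtFilter _ _) hcont.continuousAt).const_add _
  refine ⟨P, P', hP'L, ?_, hP, fun s hs => ?_, hP'W, fun s hs => ?_, fun s hs => ?_⟩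
  · obtain ⟨B, hB⟩ := isCompact_Icc.exists_bound_of_continuousOn hL.continuousOn
    exact ⟨B, fun s => hB _ (Set.projIcc α β hαβ s).2⟩
  · have hsub : ∀ z ∈ Set.uIcc α s, z ∈ Set.Icc α β := fun z hz => by
      rw [Set.uIcc_of_le hs.1] at hz; exact ⟨hz.1, hz.2.trans hs.2⟩
    have := intervalIntegral.integral_eq_sub_of_hasDerivAt (f := W) (f' := P') (a := α) (b := s)
      (fun z hz => by rw [hP'W z (hsub z hz)]; exact hW z (hsub z hz))
      (hcont.intervalIntegrable _ _)
    simp only [P, this]; ring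
  · simp only [P']; rw [Set.projIcc_of_right_le hαβ hs]
  · simp only [P']; rw [Set.projIcc_of_le_left hαβ hs]

/-- A motion whose energy is less than the potential at the ends of an interval does not leave the
interval. -/
theorem IsNewtonSolution.mem_Ioo {P P' x y : ℝ → ℝ} {α β : ℝ} (hP : ∀ s, HasDerivAt P (P' s) s)
    (h : IsNewtonSolution (fun s => -P' s) x y) (h0 : x 0 ∈ Set.Ioo α β)
    (hα : y 0 ^ 2 / 2 + P (x 0) < P α) (hβ : y 0 ^ 2 / 2 + P (x 0) < P β) (t : ℝ) :
    x t ∈ Set.Ioo α β := by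
  have hen : ∀ t, P (x t) ≤ y 0 ^ 2 / 2 + P (x 0) := fun t => by
    have := h.energy_eq (fun s => hP (x s)) t 0
    nlinarith [sq_nonneg (y t)]
  constructor
  · by_contra! hle
    obtain ⟨s, hs⟩ := mem_range_of_exists_le_of_exists_ge h.continuous ⟨t, hle⟩ ⟨0, h0.1.le⟩
    have := hen s; rw [hs] at this; linarith
  · by_contra! hle
    obtain ⟨s, hs⟩ := mem_range_of_exists_le_of_exists_ge h.continuous ⟨0, h0.2.le⟩ ⟨t, hle⟩
    have := hen s; rw [hs] at this; linarith

/-- Let all motions with a Lipschitz force that start at `θ` with a velocity in `(0, v₁)` have an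
integer multiple of `2π` as a period. Then they have a common period of this kind. -/
theorem exists_common_period {P P' : ℝ → ℝ} {L : NNReal} {θ v₁ : ℝ} (hL : LipschitzWith L P')
    (hP : ∀ s, HasDerivAt P (P' s) s) (hv₁ : 0 < v₁) {x y : ℝ → ℝ → ℝ}
    (hsol : ∀ v, IsNewtonSolution (fun s => -P' s) (x v) (y v)) (hx0 : ∀ v, x v 0 = θ)
    (hy0 : ∀ v, y v 0 = v)
    (hper : ∀ v ∈ Set.Ioo 0 v₁, ∃ n : ℕ, 0 < n ∧ Function.Periodic (x v) (2 * Real.pi * n)) :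
    ∃ n : ℕ, 0 < n ∧ ∀ v ∈ Set.Ioo 0 v₁, Function.Periodic (x v) (2 * Real.pi * n) := by
  have hFL : LipschitzWith L fun s => -P' s := hL.neg
  set K : ℝ := ((max 1 L : NNReal) : ℝ) with hK
  have hK0 : 0 ≤ K := NNReal.coe_nonneg _
  have hdist : ∀ v v' t : ℝ, 0 ≤ t → |x v t - x v' t| ≤ |v - v'| * Real.exp (K * t) ∧
      |y v t - y v' t| ≤ |v - v'| * Real.exp (K * t) := fun v v' t ht => by
    have := (hsol v).dist_le hFL (hsol v') (by rw [hx0, hx0]) ht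
    rwa [hy0, hy0] at this
  have hcontx : ∀ t : ℝ, 0 ≤ t → Continuous fun v => x v t := fun t ht =>
    (LipschitzWith.of_dist_le' (K := Real.exp (K * t)) fun v v' => by
      rw [Real.dist_eq, Real.dist_eq, mul_comm]; exact (hdist v v' t ht).1).continuous
  have hconty : ∀ t : ℝ, 0 ≤ t → Continuous fun v => y v t := fun t ht =>
    (LipschitzWith.of_dist_le' (K := Real.exp (K * t)) fun v v' => by
      rw [Real.dist_eq, Real.dist_eq, mul_comm]; exact (hdist v v' t ht).2).continuous
  obtain ⟨n, hn, hnper⟩ := hper (v₁ / 2) ⟨by linarith, by linarith⟩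
  refine ⟨n, hn, ?_⟩
  set T : ℝ := 2 * Real.pi * n with hT
  have hT0 : 0 < T := by positivity
  have hiff : ∀ v, Function.Periodic (x v) T ↔ x v T = θ ∧ y v T = v := fun v => by
    constructor
    · intro h
      have h1 := h 0
      have h2 := (hsol v).periodic_vel h 0
      rw [zero_add] at h1 h2
      rw [h1, h2]; exact ⟨hx0 v, hy0 v⟩
    · rintro ⟨h1, h2⟩
      exact (hsol v).periodic hFL (by rw [h1, hx0]) (by rw [h2, hy0])
  -- Near a speed `v₀` with period `T` the return time `τ v` to `θ` close to `T` depends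
  -- continuously on `v`. It is itself a period and a rational multiple of `2π`, hence constantly
  -- `T`.
  have hopen : IsOpen {v | v ∈ Set.Ioo 0 v₁ ∧ Function.Periodic (x v) T} := by
    rw [Metric.isOpen_iff]
    rintro v₀ ⟨hv₀, hper₀⟩
    obtain ⟨hxT, hyT⟩ := (hiff v₀).1 hper₀
    obtain ⟨δ', hδ', hyδ⟩ := Metric.continuousAt_iff.1 ((hsol v₀).continuous_vel.continuousAt (x := T))
      (v₀ / 4) (by linarith [hv₀.1])
    set δ := min (δ' / 2) (T / 2) with hδdef
    have hδ : 0 < δ := lt_min (by linarith) (by linarith)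
    have hδδ' : δ < δ' := (min_le_left _ _).trans_lt (by linarith)
    have hδT : δ < T := (min_le_right _ _).trans_lt (by linarith)
    have hy₀ : ∀ t ∈ Set.Icc (T - δ) (T + δ), 3 / 4 * v₀ ≤ y v₀ t := fun t ht => by
      have : dist t T < δ' := by
        rw [Real.dist_eq, abs_lt]; constructor <;> linarith [ht.1, ht.2]
      have := hyδ this
      rw [Real.dist_eq, hyT, abs_lt] at this
      linarith
    have hm₀ : StrictMonoOn (x v₀) (Set.Icc (T - δ) (T + δ)) :=
      strictMonoOn_of_deriv_pos (convex_Icc _ _) (hsol v₀).continuous.continuousOn fun t ht => by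
        rw [((hsol v₀).hasDerivAt_pos t).deriv]
        linarith [hy₀ t (interior_subset ht), hv₀.1]
    have hl : x v₀ (T - δ) < θ := by
      rw [← hxT]; exact hm₀ ⟨by linarith, by linarith⟩ ⟨by linarith, by linarith⟩ (by linarith)
    have hr : θ < x v₀ (T + δ) := by
      rw [← hxT]; exact hm₀ ⟨by linarith, by linarith⟩ ⟨by linarith, by linarith⟩ (by linarith)
    set C := Real.exp (K * (T + δ)) with hC
    have hC0 : 0 < C := Real.exp_pos _
    have hCle : ∀ t, t ≤ T + δ → Real.exp (K * t) ≤ C := fun t ht =>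
      Real.exp_le_exp.2 (mul_le_mul_of_nonneg_left ht hK0)
    have hev : ∀ᶠ v in 𝓝 v₀, v ∈ Set.Ioo 0 v₁ ∧ |v - v₀| * C < v₀ / 4 ∧ x v (T - δ) < θ ∧
        θ < x v (T + δ) := by
      refine Filter.Eventually.and (isOpen_Ioo.mem_nhds hv₀) (Filter.Eventually.and ?_
        (Filter.Eventually.and ?_ ?_))
      · have : Filter.Tendsto (fun v => |v - v₀| * C) (𝓝 v₀) (𝓝 (|v₀ - v₀| * C)) :=
          Continuous.tendsto (by fun_prop) v₀
        rw [sub_self, abs_zero, zero_mul] at this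
        exact this.eventually (gt_mem_nhds (by linarith [hv₀.1]))
      · exact (hcontx _ (by linarith)).continuousAt.eventually (gt_mem_nhds hl)
      · exact (hcontx _ (by linarith)).continuousAt.eventually (lt_mem_nhds hr)
    obtain ⟨η, hη, hball⟩ := Metric.eventually_nhds_iff_ball.1 hev
    have hyv : ∀ v ∈ Metric.ball v₀ η, ∀ t ∈ Set.Icc (T - δ) (T + δ), v₀ / 2 ≤ y v t := by
      intro v hv t ht
      have h1 := (hdist v v₀ t (by linarith [ht.1])).2
      have h2 := mul_le_mul_of_nonneg_left (hCle t ht.2) (abs_nonneg (v - v₀))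
      have h3 := (hball v hv).2.1
      have h4 := hy₀ t ht
      have h5 := (abs_le.1 (h1.trans h2)).1
      linarith
    have hex : ∀ v ∈ Metric.ball v₀ η, ∃ τ ∈ Set.Icc (T - δ) (T + δ), x v τ = θ := by
      intro v hv
      obtain ⟨_, _, h3, h4⟩ := hball v hv
      exact intermediate_value_Icc (by linarith) (hsol v).continuous.continuousOn ⟨h3.le, h4.le⟩
    choose! τ hτ hxτ using hex
    have hτper : ∀ v ∈ Metric.ball v₀ η, Function.Periodic (x v) (τ v) := by
      intro v hv
      refine (hsol v).periodic hFL (by rw [hxτ v hv, hx0]) ?_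
      -- At the return to `θ` energy conservation gives the velocity up to sign; the lower bound
      -- near `T` makes it positive, so the motion is back in its initial state.
      have h1 := (hsol v).energy_eq (fun s => hP (x v s)) (τ v) 0
      rw [hxτ v hv, hx0, hy0] at h1
      have h2 := hyv v hv _ (hτ v hv)
      have h3 := (hball v hv).1.1
      have h4 : (y v (τ v) - v) * (y v (τ v) + v) = 0 := by linarith
      rcases mul_eq_zero.1 h4 with h | h
      · rw [hy0]; linarith
      · linarith [hv₀.1]
    have hτlip : ∀ v ∈ Metric.ball v₀ η, ∀ v' ∈ Metric.ball v₀ η,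
        v₀ / 2 * |τ v - τ v'| ≤ |v - v'| * C := by
      intro v hv v' hv'
      have hτv := hτ v hv
      have h1 := (hdist v' v (τ v) (by linarith [hτv.1])).1
      have h2 := h1.trans (mul_le_mul_of_nonneg_left (hCle _ hτv.2) (abs_nonneg (v' - v)))
      rw [hxτ v hv, ← hxτ v' hv', abs_sub_comm v' v] at h2
      refine le_trans ?_ h2
      have hmul : ∀ p ∈ Set.Icc (T - δ) (T + δ), ∀ q ∈ Set.Icc (T - δ) (T + δ), p ≤ q →
          v₀ / 2 * (q - p) ≤ x v' q - x v' p := fun p hp q hq hpq =>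
        (convex_Icc (T - δ) (T + δ)).mul_sub_le_image_sub_of_le_deriv
          (hsol v').continuous.continuousOn
          (fun t _ => ((hsol v').hasDerivAt_pos t).differentiableAt.differentiableWithinAt)
          (fun t ht => by
            rw [((hsol v').hasDerivAt_pos t).deriv]; exact hyv v' hv' t (interior_subset ht))
          p hp q hq hpq
      rcases le_total (τ v) (τ v') with hle | hle
      · have := hmul _ (hτ v hv) _ (hτ v' hv') hle
        rw [abs_sub_comm, abs_of_nonneg (by linarith), abs_sub_comm]
        exact this.trans (le_abs_self _)
      · have := hmul _ (hτ v' hv') _ (hτ v hv) hle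
        rw [abs_of_nonneg (by linarith)]
        exact this.trans (le_abs_self _)
    have hτcont : ContinuousOn τ (Metric.ball v₀ η) := by
      refine (LipschitzOnWith.of_dist_le' (K := 2 * C / v₀)
        fun v hv v' hv' => ?_).continuousOn
      have := hτlip v hv v' hv'
      have hv0 := hv₀.1
      rw [Real.dist_eq, Real.dist_eq, div_mul_eq_mul_div, le_div_iff₀ hv0]
      linarith
    have hτrat : ∀ v ∈ Metric.ball v₀ η, ∃ q : ℚ, τ v = q * (2 * Real.pi) := by
      intro v hv
      have hvI := (hball v hv).1
      obtain ⟨m, hm, hmper⟩ := hper v hvI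
      obtain ⟨r, hr⟩ := exists_rational_of_periodic (hsol v).continuous
        (q := 2 * Real.pi * m) (by positivity) (hτper v hv) hmper (by
          by_contra! hcon
          have h1 : x v = fun _ => x v 0 := funext hcon
          have h2 := (hsol v).hasDerivAt_pos 0
          rw [h1, hy0] at h2
          exact hvI.1.ne (((hasDerivAt_const 0 (x v 0)).unique h2)))
      exact ⟨r * m, by rw [hr]; push_cast; ring⟩
    have hv₀ball : v₀ ∈ Metric.ball v₀ η := Metric.mem_ball_self hη
    have hτv₀ : τ v₀ = T := by
      refine hm₀.injOn (hτ v₀ hv₀ball) ⟨by linarith, by linarith⟩ ?_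
      rw [hxτ v₀ hv₀ball, hxT]
    refine ⟨η, hη, fun v hv => ⟨(hball v hv).1, ?_⟩⟩
    have := IsPreconnected.eq_of_rational_multiple (convex_ball v₀ η).isPreconnected hτcont hτrat hv
      hv₀ball
    rw [← hτv₀, ← this]
    exact hτper v hv
  -- The set of speeds with period `T` is also relatively closed, by continuous dependence on the
  -- initial velocity, so it is the whole interval.
  have hsub := (isPreconnected_Ioo (a := 0) (b := v₁)).subset_of_closure_inter_subset hopen
    ⟨v₁ / 2, ⟨by linarith, by linarith⟩, ⟨by linarith, by linarith⟩, hnper⟩ (by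
      rintro v ⟨hv, hvI⟩
      refine ⟨hvI, (hiff v).2 ?_⟩
      have hcl : IsClosed {v | x v T = θ ∧ y v T = v} :=
        (isClosed_eq (hcontx T hT0.le) continuous_const).inter
          (isClosed_eq (hconty T hT0.le) continuous_id)
      exact closure_minimal (fun w hw => (hiff w).1 hw.2) hcl hv)
  exact fun v hv => (hsub hv).2

theorem eventually_le_of_hasDerivAt_nonpos {g : ℝ → ℝ} {θ w c : ℝ} (hg : HasDerivAt g w θ)
    (h0 : g θ = 0) (hw : w ≤ 0) (hc : 0 < c) :
    ∀ᶠ s in 𝓝 θ, θ ≤ s → g s ≤ c * (s - θ) := by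
  have h1 := hg.isLittleO.bound hc
  filter_upwards [h1] with s hs hθs
  rw [h0, sub_zero, smul_eq_mul, Real.norm_eq_abs, Real.norm_eq_abs,
    abs_of_nonneg (sub_nonneg.2 hθs)] at hs
  have h2 := (abs_le.1 hs).2
  have h3 : (s - θ) * w ≤ 0 := mul_nonpos_of_nonneg_of_nonpos (sub_nonneg.2 hθs) hw
  linarith

/-- If all motions confined to a potential well have an integer multiple of `2π` as a period, then
every equilibrium below the rim is a nondegenerate minimum. -/
theorem second_deriv_pos_of_periodic {W W' : ℝ → ℝ} {α β θ w : ℝ} {L : NNReal} (hαθ : α < θ)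
    (hθβ : θ < β) (hW : ∀ s ∈ Set.Icc α β, HasDerivAt W (W' s) s)
    (hL : LipschitzOnWith L W' (Set.Icc α β)) (hα : W θ < W α) (hβ : W θ < W β) (hθ : W' θ = 0)
    (hd : HasDerivAt W' w θ)
    (hper : ∀ x y, IsNewtonSolution (fun s => -W' s) x y → (∀ t, x t ∈ Set.Ioo α β) →
      ∃ n : ℕ, 0 < n ∧ Function.Periodic x (2 * Real.pi * n)) : 0 < w := by
  obtain ⟨P, P', hP'L, ⟨B, hB⟩, hP, hPW, hP'W, -, -⟩ :=
    exists_clamped_potential (hαθ.trans hθβ).le hW hL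
  have hαm : α ∈ Set.Icc α β := ⟨le_rfl, (hαθ.trans hθβ).le⟩
  have hβm : β ∈ Set.Icc α β := ⟨(hαθ.trans hθβ).le, le_rfl⟩
  have hθm : θ ∈ Set.Icc α β := ⟨hαθ.le, hθβ.le⟩
  have hFB : ∀ s, |-P' s| ≤ B := fun s => by rw [abs_neg]; exact hB s
  choose x y hsol hx0 hy0 using fun v => exists_newton_solution (F := fun s => -P' s) hP'L.neg hFB θ v
  -- `D` is the depth of the well above `θ`; a motion launched from `θ` with speed below `√(2 D)`
  -- stays inside.
  set D := min (W α) (W β) - W θ with hD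
  have hD0 : 0 < D := sub_pos.2 (lt_min hα hβ)
  set v₁ := √(2 * D) with hv₁
  have hv₁0 : 0 < v₁ := Real.sqrt_pos.2 (by linarith)
  have hmem : ∀ v ∈ Set.Ioo 0 v₁, ∀ t, x v t ∈ Set.Ioo α β := by
    intro v hv
    have hv2 : v ^ 2 / 2 < D := by
      have := (Real.lt_sqrt hv.1.le).1 hv.2
      linarith
    refine (hsol v).mem_Ioo hP (by rw [hx0]; exact ⟨hαθ, hθβ⟩) ?_ ?_
    · rw [hx0, hy0, hPW _ hθm, hPW _ hαm]
      linarith [min_le_left (W α) (W β)]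
    · rw [hx0, hy0, hPW _ hθm, hPW _ hβm]
      linarith [min_le_right (W α) (W β)]
  obtain ⟨n, hn, hcommon⟩ := exists_common_period hP'L hP hv₁0 hsol hx0 hy0 fun v hv => by
    refine hper (x v) (y v) ⟨(hsol v).hasDerivAt_pos, fun t => ?_⟩ (hmem v hv)
    have := (hsol v).hasDerivAt_vel t
    rwa [hP'W _ (Set.Ioo_subset_Icc_self (hmem v hv t))] at this
  set T : ℝ := 2 * Real.pi * n with hT
  have hT0 : 0 < T := by positivity
  -- If `w ≤ 0`, the restoring force to the right of `θ` is weaker than that of an oscillator of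
  -- frequency `1 / T`. Since `1 < π / 2`, a slow motion is still strictly to the right of `θ` at
  -- the common period `T`.
  by_contra! hw
  have hd' : HasDerivAt P' w θ := by
    refine hd.congr_of_eventuallyEq ?_
    filter_upwards [Icc_mem_nhds hαθ hθβ] with s hs using hP'W s hs
  have hev := eventually_le_of_hasDerivAt_nonpos hd' (by rw [hP'W _ hθm, hθ]) hw
    (by positivity : 0 < (1 / T) ^ 2)
  obtain ⟨δ, hδ, hball⟩ := Metric.eventually_nhds_iff.1 hev
  set K : ℝ := ((max 1 L : NNReal) : ℝ) with hK
  have hK0 : 0 ≤ K := NNReal.coe_nonneg _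
  set C := Real.exp (K * T) with hC
  have hC0 : 0 < C := Real.exp_pos _
  -- Slow enough that, by Grönwall comparison with the rest solution, the motion stays within `δ` of
  -- `θ` up to time `T`.
  set v := min (v₁ / 2) (δ / (2 * C)) with hv
  have hv0 : 0 < v := lt_min (by linarith) (by positivity)
  have hvm : v ∈ Set.Ioo 0 v₁ := ⟨hv0, (min_le_left _ _).trans_lt (by linarith)⟩
  have hvC : v * C < δ := by
    calc v * C ≤ δ / (2 * C) * C := mul_le_mul_of_nonneg_right (min_le_right _ _) hC0.le
      _ = δ / 2 := by field_simp
      _ < δ := by linarith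
  have heq : IsNewtonSolution (fun s => -P' s) (fun _ => θ) fun _ => 0 :=
    ⟨fun t => hasDerivAt_const t θ, fun t => by
      rw [hP'W _ hθm, hθ, neg_zero]; exact hasDerivAt_const t 0⟩
  have hlt := (hsol v).lt_of_small_velocity (κ := 1 / T) (T := T) (θ := θ) (δ := δ)
    (by positivity) hT0 (by rw [one_div_mul_cancel hT0.ne']; linarith [Real.pi_gt_three])
    (fun s hs hsδ => by
      have := hball (y := s) (by rw [Real.dist_eq, abs_of_nonneg (by linarith)]; linarith) hs
      linarith)
    (hx0 v) (by rw [hy0]; exact hv0) (fun t ht => by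
      have h1 := ((hsol v).dist_le hP'L.neg heq (hx0 v) ht.1).1
      rw [hy0, sub_zero, abs_of_pos hv0] at h1
      have h2 : Real.exp (K * t) ≤ C := Real.exp_le_exp.2 (mul_le_mul_of_nonneg_left ht.2 hK0)
      have h3 := mul_le_mul_of_nonneg_left h2 hv0.le
      linarith [(abs_le.1 (h1.trans h3)).2])
  have := hcommon v hvm 0
  rw [zero_add, hx0] at this
  exact hlt.ne' this

/-- A particle that starts with positive velocity at the top of a potential hill does not slow
down. -/
theorem exists_escaping_solution {W W' : ℝ → ℝ} {θ δ v : ℝ} {L : NNReal} (hδ : 0 < δ)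
    (hW : ∀ s ∈ Set.Icc (θ - δ) (θ + δ), HasDerivAt W (W' s) s)
    (hL : LipschitzOnWith L W' (Set.Icc (θ - δ) (θ + δ)))
    (hr : ∀ s ∈ Set.Icc θ (θ + δ), W' s ≤ 0) (hl : ∀ s ∈ Set.Icc (θ - δ) θ, 0 ≤ W' s)
    (hv : 0 < v) :
    ∃ x y : ℝ → ℝ, (∀ t, HasDerivAt x (y t) t) ∧
      (∀ t, x t ∈ Set.Icc (θ - δ) (θ + δ) → HasDerivAt y (-W' (x t)) t) ∧ x 0 = θ ∧ y 0 = v ∧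
      ∀ t, v ≤ y t := by
  obtain ⟨P, P', hP'L, ⟨B, hB⟩, hP, -, hP'W, hright, hleft⟩ :=
    exists_clamped_potential (by linarith : θ - δ ≤ θ + δ) hW hL
  obtain ⟨x, y, hsol, hx0, hy0⟩ := exists_newton_solution (F := fun s => -P' s) (B := B) hP'L.neg
    (fun s => by rw [abs_neg]; exact hB s) θ v
  -- With the force constant outside the interval the sign conditions persist, so `θ` is a global
  -- maximum of the extended potential. Energy conservation then keeps the speed at least `v`, and
  -- the velocity cannot change sign.
  have hle : ∀ s, P s ≤ P θ := by
    intro s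
    have hc : Continuous P := continuous_iff_continuousAt.2 fun t => (hP t).continuousAt
    rcases le_total θ s with h | h
    · refine antitoneOn_of_deriv_nonpos (convex_Ici θ) hc.continuousOn
        (fun t _ => (hP t).differentiableAt.differentiableWithinAt) (fun t ht => ?_)
        (Set.mem_Ici.2 le_rfl) (Set.mem_Ici.2 h) h
      rw [(hP t).deriv]
      have ht' : θ ≤ t := interior_subset ht
      rcases le_total t (θ + δ) with h1 | h1
      · rw [hP'W t ⟨by linarith, h1⟩]; exact hr t ⟨ht', h1⟩
      · rw [hright t h1]; exact hr _ ⟨by linarith, le_rfl⟩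
    · refine monotoneOn_of_deriv_nonneg (convex_Iic θ) hc.continuousOn
        (fun t _ => (hP t).differentiableAt.differentiableWithinAt) (fun t ht => ?_)
        (Set.mem_Iic.2 h) (Set.mem_Iic.2 le_rfl) h
      rw [(hP t).deriv]
      have ht' : t ≤ θ := Set.mem_Iic.1 (interior_subset ht)
      rcases le_total (θ - δ) t with h1 | h1
      · rw [hP'W t ⟨h1, by linarith⟩]; exact hl t ⟨h1, ht'⟩
      · rw [hleft t h1]; exact hl _ ⟨le_rfl, by linarith⟩
  have hsq : ∀ t, v ^ 2 ≤ y t ^ 2 := fun t => by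
    have h1 := hsol.energy_eq (fun s => hP (x s)) t 0
    rw [hx0, hy0] at h1
    linarith [hle (x t)]
  have hpos : ∀ t, 0 < y t := by
    intro t
    by_contra! hneg
    obtain ⟨s, hs⟩ := mem_range_of_exists_le_of_exists_ge hsol.continuous_vel ⟨t, hneg⟩
      ⟨0, by rw [hy0]; exact hv.le⟩
    have := hsq s
    rw [hs] at this
    nlinarith
  refine ⟨x, y, hsol.hasDerivAt_pos, fun t ht => ?_, hx0, hy0, fun t =>
    (sq_le_sq₀ hv.le (hpos t).le).1 (hsq t)⟩
  have := hsol.hasDerivAt_vel t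
  rwa [hP'W _ ht] at this

/-! ### Parameter integrals, Hadamard's lemma and the energy coordinate -/

/-- The derivative is again an integral of the same form, with weight `w c`, so the statement can be
iterated. It serves the Hadamard quotient (`c s = s`) and the oscillation period (`c = sin`). -/
theorem hasDerivAt_integral_comp_mul {Φ w c : ℝ → ℝ} (hΦ : ContDiff ℝ 1 Φ) (hw : Continuous w)
    (hc : Continuous c) (a b x : ℝ) :
    HasDerivAt (fun x => ∫ s in a..b, w s * Φ (c s * x))
      (∫ s in a..b, w s * c s * deriv Φ (c s * x)) x := by
  have hΦ' : Continuous (deriv Φ) := hΦ.continuous_deriv le_rfl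
  have hΦc : Continuous Φ := hΦ.continuous
  have hcont : Continuous fun p : ℝ × ℝ => w p.2 * c p.2 * deriv Φ (c p.2 * p.1) := by fun_prop
  obtain ⟨B, hB⟩ := ((isCompact_closedBall x 1).prod
    (isCompact_uIcc (a := a) (b := b))).exists_bound_of_continuousOn hcont.continuousOn
  refine (intervalIntegral.hasDerivAt_integral_of_dominated_loc_of_deriv_le
    (F := fun x s => w s * Φ (c s * x)) (F' := fun x s => w s * c s * deriv Φ (c s * x))
    (bound := fun _ => B) (Metric.ball_mem_nhds x one_pos) ?_ ?_ ?_ ?_ ?_ ?_).2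
  · exact Filter.Eventually.of_forall fun z =>
      (by fun_prop : Continuous fun s => w s * Φ (c s * z)).aestronglyMeasurable
  · exact (by fun_prop : Continuous fun s => w s * Φ (c s * x)).intervalIntegrable _ _
  · exact (by fun_prop : Continuous fun s => w s * c s * deriv Φ (c s * x)).aestronglyMeasurable
  · exact Filter.Eventually.of_forall fun s hs z hz =>
      hB (z, s) ⟨Metric.ball_subset_closedBall hz, Set.uIoc_subset_uIcc hs⟩
  · exact intervalIntegrable_const
  · refine Filter.Eventually.of_forall fun s _ z _ => ?_
    have h1 : HasDerivAt (fun z => c s * z) (c s) z := by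
      simpa using (hasDerivAt_id z).const_mul (c s)
    have h2 := ((hΦ.differentiable one_ne_zero).differentiableAt.hasDerivAt.comp z h1).const_mul
      (w s)
    convert! h2 using 1
    ring

theorem contDiff_integral_comp_mul {c : ℝ → ℝ} (hc : Continuous c) (a b : ℝ) (n : ℕ) :
    ∀ {Φ w : ℝ → ℝ}, ContDiff ℝ ∞ Φ → Continuous w →
      ContDiff ℝ n fun x => ∫ s in a..b, w s * Φ (c s * x) := by
  induction n with
  | zero =>
    intro Φ w hΦ hw
    have hd := hasDerivAt_integral_comp_mul (hΦ.of_le (by norm_cast)) hw hc a b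
    exact contDiff_zero.2 (continuous_iff_continuousAt.2 fun x => (hd x).continuousAt)
  | succ n ih =>
    intro Φ w hΦ hw
    have hd := hasDerivAt_integral_comp_mul (hΦ.of_le (by norm_cast)) hw hc a b
    rw [show ((n + 1 : ℕ) : WithTop ℕ∞) = (n : WithTop ℕ∞) + 1 by norm_cast,
      contDiff_succ_iff_deriv]
    refine ⟨fun x => (hd x).differentiableAt, by simp, ?_⟩
    rw [show (deriv fun x => ∫ s in a..b, w s * Φ (c s * x)) = _ from funext fun x => (hd x).deriv]
    exact ih (contDiff_infty_iff_deriv.1 hΦ).2 (hw.mul hc)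

/-- Hadamard's lemma on the line. -/
theorem exists_contDiff_eq_sub_mul {F : ℝ → ℝ} (hF : ContDiff ℝ ∞ F) (x₀ : ℝ) (h0 : F x₀ = 0) :
    ∃ g : ℝ → ℝ, ContDiff ℝ ∞ g ∧ ∀ x, F x = (x - x₀) * g x := by
  let Φ : ℝ → ℝ := fun z => deriv F (x₀ + z)
  have hF' : ContDiff ℝ ∞ (deriv F) := (contDiff_infty_iff_deriv.1 hF).2
  have hΦ : ContDiff ℝ ∞ Φ := hF'.comp (contDiff_const.add contDiff_id)
  have hg : ContDiff ℝ ∞ fun x => ∫ s in (0 : ℝ)..1, 1 * Φ (s * x) :=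
    contDiff_infty.2 fun n => contDiff_integral_comp_mul continuous_id 0 1 n hΦ continuous_const
  refine ⟨fun x => ∫ s in (0 : ℝ)..1, 1 * Φ (s * (x - x₀)), hg.comp (contDiff_id.sub contDiff_const),
    fun x => ?_⟩
  have hd : ∀ s ∈ Set.uIcc (0 : ℝ) 1, HasDerivAt (fun s => F (x₀ + s * (x - x₀)))
      ((x - x₀) * (1 * Φ (s * (x - x₀)))) s := fun s _ => by
    have h1 : HasDerivAt (fun s => x₀ + s * (x - x₀)) (x - x₀) s := by
      simpa using ((hasDerivAt_id s).mul_const (x - x₀)).const_add x₀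
    have h2 := ((hF.differentiable (by simp)).differentiableAt.hasDerivAt).comp s h1
    convert! h2 using 1
    simp only [Φ]; ring
  have hc : Continuous fun s => (x - x₀) * (1 * Φ (s * (x - x₀))) := by
    have := hΦ.continuous; fun_prop
  have := intervalIntegral.integral_eq_sub_of_hasDerivAt hd (hc.intervalIntegrable _ _)
  rw [intervalIntegral.integral_const_mul] at this
  simp only [one_mul, add_sub_cancel, zero_mul, add_zero, h0, sub_zero] at this
  simp only [one_mul]
  exact this.symm

/-- Near a nondegenerate minimum a potential is half the square of a coordinate `u`; here `k` is
the inverse of this coordinate. -/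
theorem exists_energy_coordinate {W : ℝ → ℝ} (hW : ContDiff ℝ ∞ W) {x₀ : ℝ}
    (h1 : deriv W x₀ = 0) (h2 : 0 < deriv (deriv W) x₀) :
    ∃ k : ℝ → ℝ, ContDiff ℝ 4 k ∧ k 0 = x₀ ∧
      ∀ᶠ u in 𝓝 0, W (k u) = W x₀ + u ^ 2 / 2 ∧ 0 < deriv k u := by
  -- Hadamard's lemma applied twice gives `W = W x₀ + (x - x₀)² g` with `2 g x₀ = W'' x₀ > 0`.
  obtain ⟨g₁, hg₁, hW1⟩ := exists_contDiff_eq_sub_mul (F := fun x => W x - W x₀)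
    (hW.sub contDiff_const) x₀ (sub_self _)
  have hdW : ∀ x, deriv W x = g₁ x + (x - x₀) * deriv g₁ x := fun x => by
    have h3 : HasDerivAt (fun x => (x - x₀) * g₁ x) (1 * g₁ x + (x - x₀) * deriv g₁ x) x :=
      ((hasDerivAt_id x).sub_const x₀).mul
        (hg₁.differentiable (by simp)).differentiableAt.hasDerivAt
    have h4 : W = fun x => W x₀ + (x - x₀) * g₁ x := funext fun x => by rw [← hW1]; ring
    have h5 := h3.const_add (W x₀)
    rw [← h4] at h5
    rw [h5.deriv, one_mul]
  have hg₁0 : g₁ x₀ = 0 := by have := hdW x₀; rw [h1, sub_self, zero_mul, add_zero] at this; exact this.symm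
  obtain ⟨g, hg, hg₁g⟩ := exists_contDiff_eq_sub_mul hg₁ x₀ hg₁0
  have hWg : ∀ x, W x = W x₀ + (x - x₀) ^ 2 * g x := fun x => by
    have := hW1 x; rw [hg₁g] at this; linarith
  have hg0 : deriv (deriv W) x₀ = 2 * g x₀ := by
    have hd1 : deriv g₁ x₀ = g x₀ := by
      have h3 : HasDerivAt (fun x => (x - x₀) * g x) (1 * g x₀ + (x₀ - x₀) * deriv g x₀) x₀ :=
        ((hasDerivAt_id x₀).sub_const x₀).mul
          (hg.differentiable (by simp)).differentiableAt.hasDerivAt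
      rw [← funext hg₁g] at h3
      rw [h3.deriv]; ring
    have hg₁' : ContDiff ℝ ∞ (deriv g₁) := (contDiff_infty_iff_deriv.1 hg₁).2
    have h3 : HasDerivAt (fun x => g₁ x + (x - x₀) * deriv g₁ x)
        (deriv g₁ x₀ + (1 * deriv g₁ x₀ + (x₀ - x₀) * deriv (deriv g₁) x₀)) x₀ :=
      (hg₁.differentiable (by simp)).differentiableAt.hasDerivAt.add
        (((hasDerivAt_id x₀).sub_const x₀).mul
          (hg₁'.differentiable (by simp)).differentiableAt.hasDerivAt)
    rw [← funext hdW] at h3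
    rw [h3.deriv, hd1]; ring
  have hgpos : 0 < g x₀ := by linarith
  -- Chosen so that `W - W x₀ = h² / 2` near `x₀`; `k` will be a local inverse of `h`.
  let h : ℝ → ℝ := fun x => (x - x₀) * √(2 * g x)
  have hhC : ContDiffAt ℝ 4 h x₀ := by
    refine (contDiffAt_id.sub contDiffAt_const).mul (ContDiffAt.sqrt ?_ (by positivity))
    exact contDiffAt_const.mul (hg.contDiffAt.of_le (by norm_cast))
  have hh0 : h x₀ = 0 := by simp [h]
  have hs0 : 0 < √(2 * g x₀) := Real.sqrt_pos.2 (by linarith)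
  have hhd : HasDerivAt h (√(2 * g x₀)) x₀ := by
    have h3 : DifferentiableAt ℝ (fun x => √(2 * g x)) x₀ :=
      DifferentiableAt.sqrt ((hg.differentiable (by simp)).differentiableAt.const_mul 2)
        (by positivity)
    have h4 := ((hasDerivAt_id x₀).sub_const x₀).mul h3.hasDerivAt
    convert! h4 using 1
    simp
  let e : ℝ ≃L[ℝ] ℝ := ContinuousLinearEquiv.unitsEquivAut ℝ (Units.mk0 _ hs0.ne')
  have hhe : HasFDerivAt h (e : ℝ →L[ℝ] ℝ) x₀ := by
    convert! hhd.hasFDerivAt using 1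
  have hstrict : HasStrictFDerivAt h (e : ℝ →L[ℝ] ℝ) x₀ :=
    hhC.hasStrictFDerivAt' hhe (by norm_num)
  let k₀ := hhC.localInverse hhe (by norm_num)
  have hk₀C : ContDiffAt ℝ 4 k₀ 0 := by
    have := hhC.to_localInverse hhe (by norm_num)
    rwa [hh0] at this
  have hk₀0 : k₀ 0 = x₀ := by
    have := hhC.localInverse_apply_image hhe (by norm_num)
    rwa [hh0] at this
  have hright : ∀ᶠ u in 𝓝 0, h (k₀ u) = u := by
    have := hstrict.eventually_right_inverse
    rwa [hh0] at this
  -- The inverse function theorem gives only a germ, which is extended to the line. Four derivatives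
  -- are kept because `W (k u)` will be differentiated four times.
  obtain ⟨U, hU, hkU⟩ := hk₀C.contDiffOn (m := 4) le_rfl (by simp)
  obtain ⟨k, hk, hkk₀⟩ := exists_contDiff_eventuallyEq (by norm_cast) hU hkU
  have hk0 : k 0 = x₀ := by rw [hkk₀.self_of_nhds, hk₀0]
  have hinv : ∀ᶠ u in 𝓝 0, h (k u) = u := by
    filter_upwards [hright, hkk₀] with u hu hku
    rw [hku, hu]
  have hkc : Continuous k := hk.continuous
  have hgk : ∀ᶠ u in 𝓝 0, 0 < g (k u) :=
    (hg.continuous.comp hkc).continuousAt.eventually (lt_mem_nhds (by simpa [hk0] using hgpos))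
  have hk'0 : 0 < deriv k 0 := by
    have h3 : HasDerivAt k (deriv k 0) 0 :=
      (hk.differentiable (by norm_num)).differentiableAt.hasDerivAt
    have h4 : HasDerivAt h (√(2 * g x₀)) (k 0) := by rw [hk0]; exact hhd
    have h5 := (h4.comp 0 h3).congr_of_eventuallyEq (f₁ := id) (by
      filter_upwards [hinv] with u hu using hu.symm)
    have h6 := h5.unique (hasDerivAt_id 0)
    by_contra! hle
    nlinarith
  have hk'c : Continuous (deriv k) := hk.continuous_deriv (by norm_num)
  refine ⟨k, hk, hk0, ?_⟩
  filter_upwards [hinv, hgk, hk'c.continuousAt.eventually (lt_mem_nhds hk'0)] with u hu hgu hku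
  refine ⟨?_, hku⟩
  rw [hWg (k u)]
  nth_rewrite 3 [← hu]
  simp only [h]
  rw [mul_pow, Real.sq_sqrt (by linarith)]
  ring

/-! ### The period of small oscillations and isochronicity -/

/-- The time that a motion of energy `ρ² / 2` in a potential with energy coordinate `k⁻¹` needs
for a full oscillation. -/
noncomputable def oscillationPeriod (k : ℝ → ℝ) (ρ : ℝ) : ℝ :=
  ∫ ψ in (0 : ℝ)..(2 * Real.pi), deriv k (Real.sin ψ * ρ)

/-- In the energy coordinate the phase curve is the circle `u = ρ sin ψ`, `ẋ = ρ cos ψ`. From `ẋ =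
k'(u) u̇` the time is `dt = k'(ρ sin ψ) dψ`; as `k'` has a positive minimum on `[-ρ, ρ]`, this can
be inverted for all times. -/
theorem exists_oscillation {W k : ℝ → ℝ} {x₀ u₁ ρ : ℝ} (hW : Differentiable ℝ W)
    (hk : ContDiff ℝ 4 k)
    (hu : ∀ u ∈ Set.Ioo (-u₁) u₁, W (k u) = W x₀ + u ^ 2 / 2 ∧ 0 < deriv k u)
    (hρ : ρ ∈ Set.Ioo 0 u₁) :
    ∃ x y ψ : ℝ → ℝ, IsNewtonSolution (fun s => -deriv W s) x y ∧ ψ 0 = 0 ∧ StrictMono ψ ∧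
      (∀ t, x t = k (Real.sin (ψ t) * ρ)) ∧ (∀ t, y t = ρ * Real.cos (ψ t)) ∧
      ∀ t, (∫ s in (0 : ℝ)..ψ t, deriv k (Real.sin s * ρ)) = t := by
  have hk'c : Continuous (deriv k) := hk.continuous_deriv (by norm_num)
  have harg : ∀ s, Real.sin s * ρ ∈ Set.Icc (-ρ) ρ := fun s =>
    ⟨by nlinarith [Real.neg_one_le_sin s, hρ.1], by nlinarith [Real.sin_le_one s, hρ.1]⟩
  have harg' : ∀ s, Real.sin s * ρ ∈ Set.Ioo (-u₁) u₁ := fun s =>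
    ⟨by linarith [(harg s).1, hρ.2], by linarith [(harg s).2, hρ.2]⟩
  obtain ⟨z, hz, hzmin⟩ := isCompact_Icc.exists_isMinOn (s := Set.Icc (-ρ) ρ)
    ⟨0, by constructor <;> linarith [hρ.1]⟩ hk'c.continuousOn
  have hc : 0 < deriv k z := (hu z ⟨by linarith [hz.1, hρ.2], by linarith [hz.2, hρ.2]⟩).2
  set p : ℝ → ℝ := fun s => deriv k (Real.sin s * ρ) with hp
  have hpc : Continuous p := by fun_prop
  have hpz : ∀ s, deriv k z ≤ p s := fun s => hzmin (harg s)
  have hΦ : ∀ s, HasDerivAt (fun s => ∫ σ in (0 : ℝ)..s, p σ) (p s) s := fun s =>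
    intervalIntegral.integral_hasDerivAt_right (hpc.intervalIntegrable _ _)
      (hpc.stronglyMeasurableAtFilter _ _) hpc.continuousAt
  obtain ⟨ψ, hψΦ, hΦψ, hψd⟩ := exists_inverse_of_deriv_bound hc hΦ (Or.inl hpz)
  have hψ0 : ψ 0 = 0 := by simpa using hψΦ 0
  have hpos : ∀ s, 0 < p s := fun s => hc.trans_le (hpz s)
  have hforce : ∀ u ∈ Set.Ioo (-u₁) u₁, deriv W (k u) * deriv k u = u := by
    intro u hu'
    have h1 := (hW (k u)).hasDerivAt.comp u
      ((hk.differentiable (by norm_num)).differentiableAt (x := u)).hasDerivAt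
    have h2 : HasDerivAt (fun u => W x₀ + u ^ 2 / 2) u u := by
      have := (((hasDerivAt_id u).pow 2).div_const 2).const_add (W x₀)
      convert! this using 1
      simp
    refine h1.unique (h2.congr_of_eventuallyEq ?_)
    filter_upwards [isOpen_Ioo.mem_nhds hu'] with v hv using (hu v hv).1
  refine ⟨fun t => k (Real.sin (ψ t) * ρ), fun t => ρ * Real.cos (ψ t), ψ, ⟨fun t => ?_, fun t => ?_⟩,
    hψ0, strictMono_of_deriv_pos fun t => ?_, fun t => rfl, fun t => rfl, hΦψ⟩
  · have h1 := ((hψd t).sin).mul_const ρ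
    have h2 := ((hk.differentiable (by norm_num)).differentiableAt
      (x := Real.sin (ψ t) * ρ)).hasDerivAt.comp t h1
    convert! h2 using 1
    have := (hpos (ψ t)).ne'
    rw [show deriv k (Real.sin (ψ t) * ρ) = p (ψ t) from rfl]
    field_simp
  · have h1 := ((hψd t).cos).const_mul ρ
    convert! h1 using 1
    have h2 := hforce _ (harg' (ψ t))
    have := (hpos (ψ t)).ne'
    simp only [hp] at this ⊢
    field_simp
    linarith
  · rw [(hψd t).deriv]; exact inv_pos.2 (hpos _)

/-- When the motion has returned at time `2πn`, the phase has made `m > 0` full turns, each of which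
takes one oscillation period. So that period is `n / m` times `2π`. -/
theorem exists_rational_oscillationPeriod {W k : ℝ → ℝ} {x₀ u₁ ρ : ℝ} (hW : Differentiable ℝ W)
    (hk : ContDiff ℝ 4 k)
    (hu : ∀ u ∈ Set.Ioo (-u₁) u₁, W (k u) = W x₀ + u ^ 2 / 2 ∧ 0 < deriv k u)
    (hρ : ρ ∈ Set.Ioo 0 u₁)
    (hper : ∀ x y, IsNewtonSolution (fun s => -deriv W s) x y →
      (∀ t, ∃ s, x t = k (Real.sin s * ρ)) →
        ∃ n : ℕ, 0 < n ∧ Function.Periodic x (2 * Real.pi * n)) :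
    ∃ q : ℚ, 0 < q ∧ oscillationPeriod k ρ = q * (2 * Real.pi) := by
  obtain ⟨x, y, ψ, hsol, hψ0, hψm, hx, hy, hΦ⟩ := exists_oscillation hW hk hu hρ
  obtain ⟨n, hn, hxn⟩ := hper x y hsol fun t => ⟨ψ t, hx t⟩
  have hyn := hsol.periodic_vel hxn
  set T : ℝ := 2 * Real.pi * n with hT
  have hT0 : 0 < T := by positivity
  have hkm : StrictMonoOn k (Set.Ioo (-u₁) u₁) :=
    strictMonoOn_of_deriv_pos (convex_Ioo _ _) hk.continuous.continuousOn fun u hu' =>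
      (hu u (interior_subset hu')).2
  have harg' : ∀ s, Real.sin s * ρ ∈ Set.Ioo (-u₁) u₁ := fun s =>
    ⟨by nlinarith [Real.neg_one_le_sin s, hρ.1, hρ.2],
      by nlinarith [Real.sin_le_one s, hρ.1, hρ.2]⟩
  have hsin : Real.sin (ψ T) = 0 := by
    have h1 := hxn 0
    rw [zero_add, hx, hx, hψ0] at h1
    have h2 := hkm.injOn (harg' _) (harg' _) h1
    rw [Real.sin_zero, zero_mul] at h2
    rcases mul_eq_zero.1 h2 with h | h
    · exact h
    · exact absurd h hρ.1.ne'
  have hcos : Real.cos (ψ T) = 1 := by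
    have h1 := hyn 0
    rw [zero_add, hy, hy, hψ0, Real.cos_zero] at h1
    exact mul_left_cancel₀ hρ.1.ne' h1
  obtain ⟨m, hm⟩ := (Real.cos_eq_one_iff _).1 hcos
  have hψT : 0 < ψ T := by rw [← hψ0]; exact hψm hT0
  have hm0 : 0 < m := by
    by_contra! hle
    have : (m : ℝ) ≤ 0 := by exact_mod_cast hle
    nlinarith [Real.pi_pos]
  have hperiodic : Function.Periodic (fun s => deriv k (Real.sin s * ρ)) (2 * Real.pi) := fun s => by
    simp only [Real.sin_add_two_pi]
  have h1 := hΦ T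
  rw [← hm, ← zsmul_eq_mul] at h1
  have h2 := hperiodic.intervalIntegral_add_zsmul_eq m 0 (fun a b =>
    Continuous.intervalIntegrable (by
      have := hk.continuous_deriv (by norm_num)
      fun_prop) a b)
  rw [zero_add, zero_add] at h2
  rw [h2, zsmul_eq_mul] at h1
  have hm0' : (0 : ℝ) < m := by exact_mod_cast hm0
  refine ⟨n / m, by have : (0 : ℚ) < m := by exact_mod_cast hm0
                    positivity, ?_⟩
  simp only [oscillationPeriod]
  push_cast
  field_simp
  rw [mul_comm]
  linarith

/-- The second derivative of the period with respect to `ρ` tends, as `ρ → 0`, to `k'''(0) ∫ sin² =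
π k'''(0)`, while the period itself tends to `2π k'(0)`. -/
theorem third_deriv_eq_zero_of_const_period {k : ℝ → ℝ} {u₁ c : ℝ} (hk : ContDiff ℝ 4 k)
    (hu₁ : 0 < u₁) (hc : ∀ ρ ∈ Set.Ioo 0 u₁, oscillationPeriod k ρ = c) :
    2 * Real.pi * deriv k 0 = c ∧ deriv (deriv (deriv k)) 0 = 0 := by
  have hk1 : ContDiff ℝ 3 (deriv k) := by
    have : ContDiff ℝ (3 + 1) k := by norm_num; exact hk
    exact (contDiff_succ_iff_deriv.1 this).2.2
  have hk2 : ContDiff ℝ 2 (deriv (deriv k)) := by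
    have : ContDiff ℝ (2 + 1) (deriv k) := by norm_num; exact hk1
    exact (contDiff_succ_iff_deriv.1 this).2.2
  have hk3 : Continuous (deriv (deriv (deriv k))) := hk2.continuous_deriv (by norm_num)
  have hT := hasDerivAt_integral_comp_mul (w := fun _ => 1) (hk1.of_le (by norm_num))
    continuous_const Real.continuous_sin 0 (2 * Real.pi)
  have hT' := hasDerivAt_integral_comp_mul (w := fun s => 1 * Real.sin s) (hk2.of_le (by norm_num))
    (by fun_prop) Real.continuous_sin 0 (2 * Real.pi)
  simp only [one_mul] at hT hT'
  set T₀ : ℝ → ℝ := fun x => ∫ s in (0 : ℝ)..(2 * Real.pi), deriv k (Real.sin s * x) with hT₀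
  set T₁ : ℝ → ℝ := fun x => ∫ s in (0 : ℝ)..(2 * Real.pi),
    Real.sin s * deriv (deriv k) (Real.sin s * x) with hT₁
  set T₂ : ℝ → ℝ := fun x => ∫ s in (0 : ℝ)..(2 * Real.pi),
    Real.sin s * Real.sin s * deriv (deriv (deriv k)) (Real.sin s * x) with hT₂
  have hz1 : ∀ ρ ∈ Set.Ioo 0 u₁, T₁ ρ = 0 := fun ρ hρ => by
    refine (hT ρ).unique ((hasDerivAt_const ρ c).congr_of_eventuallyEq ?_)
    filter_upwards [isOpen_Ioo.mem_nhds hρ] with σ hσ using hc σ hσ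
  have hz2 : ∀ ρ ∈ Set.Ioo 0 u₁, T₂ ρ = 0 := fun ρ hρ => by
    refine (hT' ρ).unique ((hasDerivAt_const ρ 0).congr_of_eventuallyEq ?_)
    filter_upwards [isOpen_Ioo.mem_nhds hρ] with σ hσ using hz1 σ hσ
  have hT₂c : Continuous T₂ := intervalIntegral.continuous_parametric_intervalIntegral_of_continuous'
    (by fun_prop) _ _
  have hT₀c : Continuous T₀ := continuous_iff_continuousAt.2 fun x => (hT x).continuousAt
  have hcl : (0 : ℝ) ∈ closure (Set.Ioo 0 u₁) := by
    rw [closure_Ioo hu₁.ne]; exact ⟨le_rfl, hu₁.le⟩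
  have h0 : T₀ 0 = c := closure_minimal (fun ρ hρ => hc ρ hρ)
    (isClosed_eq hT₀c continuous_const) hcl
  have h2 : T₂ 0 = 0 := closure_minimal (fun ρ hρ => hz2 ρ hρ)
    (isClosed_eq hT₂c continuous_const) hcl
  simp only [hT₀, mul_zero, intervalIntegral.integral_const, sub_zero, smul_eq_mul] at h0
  simp only [hT₂, mul_zero, intervalIntegral.integral_mul_const, ← sq, integral_sin_sq,
    Real.sin_zero, Real.cos_zero, Real.sin_two_pi, zero_mul, sub_zero, zero_add] at h2
  refine ⟨h0, ?_⟩
  rcases mul_eq_zero.1 h2 with h | h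
  · exact absurd h (by have := Real.pi_pos; positivity)
  · exact h

theorem eventuallyEq_of_hasDerivAt {f g f' g' : ℝ → ℝ} {x₀ : ℝ} (h : f =ᶠ[𝓝 x₀] g)
    (hf : ∀ x, HasDerivAt f (f' x) x) (hg : ∀ x, HasDerivAt g (g' x) x) : f' =ᶠ[𝓝 x₀] g' := by
  have := h.deriv
  rwa [show deriv f = f' from funext fun x => (hf x).deriv,
    show deriv g = g' from funext fun x => (hg x).deriv] at this

/-- Differentiating `W (k u) = c + u² / 2` two, three and four times at `0`, where `W' = 0` and
`k''' = 0`, gives three relations; eliminating `k''` from the last two leaves the condition on `W`.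
-/
theorem energy_coordinate_jet {W k : ℝ → ℝ} (hW : ContDiff ℝ ∞ W) (hk : ContDiff ℝ 4 k) {c : ℝ}
    (hWk : ∀ᶠ u in 𝓝 0, W (k u) = c + u ^ 2 / 2) (h1 : deriv W (k 0) = 0)
    (h3 : deriv (deriv (deriv k)) 0 = 0) (hpos : 0 < deriv k 0) :
    deriv (deriv W) (k 0) * deriv k 0 ^ 2 = 1 ∧
      5 * deriv (deriv (deriv W)) (k 0) ^ 2 =
        3 * deriv (deriv W) (k 0) * deriv (deriv (deriv (deriv W))) (k 0) := by
  have hstep : ∀ {V : ℝ → ℝ}, ContDiff ℝ ∞ V → ContDiff ℝ ∞ (deriv V) ∧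
      ∀ x, HasDerivAt V (deriv V x) x := fun hV =>
    ⟨(contDiff_infty_iff_deriv.1 hV).2, fun x =>
      (hV.differentiable (by simp)).differentiableAt.hasDerivAt⟩
  obtain ⟨hW1, hdW⟩ := hstep hW
  obtain ⟨hW2, hdW1⟩ := hstep hW1
  obtain ⟨hW3, hdW2⟩ := hstep hW2
  obtain ⟨-, hdW3⟩ := hstep hW3
  have hk1 : ContDiff ℝ 3 (deriv k) := by
    have : ContDiff ℝ (3 + 1) k := by norm_num; exact hk
    exact (contDiff_succ_iff_deriv.1 this).2.2
  have hk2 : ContDiff ℝ 2 (deriv (deriv k)) := by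
    have : ContDiff ℝ (2 + 1) (deriv k) := by norm_num; exact hk1
    exact (contDiff_succ_iff_deriv.1 this).2.2
  have hk3 : ContDiff ℝ 1 (deriv (deriv (deriv k))) := by
    have : ContDiff ℝ (1 + 1) (deriv (deriv k)) := by norm_num; exact hk2
    exact (contDiff_succ_iff_deriv.1 this).2.2
  have hdk : ∀ x, HasDerivAt k (deriv k x) x := fun x =>
    (hk.differentiable (by norm_num)).differentiableAt.hasDerivAt
  have hdk1 : ∀ x, HasDerivAt (deriv k) (deriv (deriv k) x) x := fun x =>
    (hk1.differentiable (by norm_num)).differentiableAt.hasDerivAt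
  have hdk2 : ∀ x, HasDerivAt (deriv (deriv k)) (deriv (deriv (deriv k)) x) x := fun x =>
    (hk2.differentiable (by norm_num)).differentiableAt.hasDerivAt
  have hdk3 : ∀ x, HasDerivAt (deriv (deriv (deriv k))) (deriv (deriv (deriv (deriv k))) x) x :=
    fun x => (hk3.differentiable (by norm_num)).differentiableAt.hasDerivAt
  set W1 := deriv W
  set W2 := deriv W1
  set W3 := deriv W2
  set W4 := deriv W3
  set k1 := deriv k
  set k2 := deriv k1
  set k3 := deriv k2
  set k4 := deriv k3
  have hc : ∀ {V V' : ℝ → ℝ}, (∀ x, HasDerivAt V (V' x) x) →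
      ∀ x, HasDerivAt (fun u => V (k u)) (V' (k x) * k1 x) x := fun hV x =>
    (hV (k x)).comp x (hdk x)
  have hR : ∀ x, HasDerivAt (fun u => c + u ^ 2 / 2) x x := fun x => by
    have := (((hasDerivAt_id x).pow 2).div_const 2).const_add c
    convert! this using 1
    simp
  have e1 := eventuallyEq_of_hasDerivAt hWk (hc hdW) hR
  have d2 : ∀ x, HasDerivAt (fun u => W1 (k u) * k1 u)
      (W2 (k x) * k1 x ^ 2 + W1 (k x) * k2 x) x := fun x => by
    convert! (hc hdW1 x).mul (hdk1 x) using 1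
    ring
  have d3 : ∀ x, HasDerivAt (fun u => W2 (k u) * k1 u ^ 2 + W1 (k u) * k2 u)
      (W3 (k x) * k1 x ^ 3 + 3 * (W2 (k x) * (k1 x * k2 x)) + W1 (k x) * k3 x) x := fun x => by
    convert! ((hc hdW2 x).mul ((hdk1 x).pow 2)).add ((hc hdW1 x).mul (hdk2 x)) using 1
    push_cast
    simp only [Pi.pow_apply]
    ring
  have d4 : ∀ x, HasDerivAt
      (fun u => W3 (k u) * k1 u ^ 3 + 3 * (W2 (k u) * (k1 u * k2 u)) + W1 (k u) * k3 u)
      (W4 (k x) * k1 x ^ 4 + 6 * W3 (k x) * k1 x ^ 2 * k2 x + 3 * W2 (k x) * k2 x ^ 2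
        + 4 * W2 (k x) * k1 x * k3 x + W1 (k x) * k4 x) x := fun x => by
    convert! (((hc hdW3 x).mul ((hdk1 x).pow 3)).add
      (((hc hdW2 x).mul ((hdk1 x).mul (hdk2 x))).const_mul 3)).add
      ((hc hdW1 x).mul (hdk3 x)) using 1
    push_cast
    simp only [Pi.pow_apply, Pi.mul_apply]
    ring
  have e2 := eventuallyEq_of_hasDerivAt e1 d2 hasDerivAt_id
  have e3 := eventuallyEq_of_hasDerivAt e2 d3 (fun x => hasDerivAt_const x 1)
  have e4 := eventuallyEq_of_hasDerivAt e3 d4 (fun x => hasDerivAt_const x 0)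
  have f2 := e2.self_of_nhds
  have f3 := e3.self_of_nhds
  have f4 := e4.self_of_nhds
  simp only [h1, h3, mul_zero, zero_mul, add_zero] at f2 f3 f4
  refine ⟨f2, ?_⟩
  have g3 : W3 (k 0) * k1 0 ^ 2 = -3 * W2 (k 0) * k2 0 := by
    have : k1 0 * (W3 (k 0) * k1 0 ^ 2 + 3 * W2 (k 0) * k2 0) = 0 := by linarith
    rcases mul_eq_zero.1 this with h | h
    · exact absurd h hpos.ne'
    · linarith
  have hne : k1 0 ^ 4 ≠ 0 := (pow_pos hpos 4).ne'
  refine mul_right_cancel₀ hne ?_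
  calc 5 * W3 (k 0) ^ 2 * k1 0 ^ 4 = 5 * (W3 (k 0) * k1 0 ^ 2) ^ 2 := by ring
    _ = 3 * W2 (k 0) * (W4 (k 0) * k1 0 ^ 4) := by
      have : W4 (k 0) * k1 0 ^ 4 =
          -6 * (W3 (k 0) * k1 0 ^ 2) * k2 0 - 3 * W2 (k 0) * k2 0 ^ 2 := by linarith
      rw [this, g3]; ring
    _ = 3 * W2 (k 0) * W4 (k 0) * k1 0 ^ 4 := by ring

theorem exists_energy_coordinate_Ioo {W : ℝ → ℝ} (hW : ContDiff ℝ ∞ W) {x₀ δ : ℝ}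
    (h1 : deriv W x₀ = 0) (h2 : 0 < deriv (deriv W) x₀) (hδ : 0 < δ) :
    ∃ (k : ℝ → ℝ) (u₁ : ℝ), ContDiff ℝ 4 k ∧ k 0 = x₀ ∧ 0 < u₁ ∧
      ∀ u ∈ Set.Ioo (-u₁) u₁, (W (k u) = W x₀ + u ^ 2 / 2 ∧ 0 < deriv k u) ∧ |k u - x₀| < δ := by
  obtain ⟨k, hk, hk0, hev⟩ := exists_energy_coordinate hW h1 h2
  have hnear : ∀ᶠ u in 𝓝 0, |k u - x₀| < δ := by
    have hc : Continuous fun u => |k u - x₀| := by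
      have := hk.continuous; fun_prop
    exact hc.continuousAt.eventually (gt_mem_nhds (by simpa [hk0] using hδ))
  obtain ⟨u₁, hu₁, hball⟩ := Metric.eventually_nhds_iff_ball.1 (hev.and hnear)
  refine ⟨k, u₁, hk, hk0, hu₁, fun u hu => hball u ?_⟩
  rw [Real.ball_eq_Ioo]; simpa using hu

theorem sin_mul_mem_Ioo {ρ u₁ : ℝ} (hρ : ρ ∈ Set.Ioo 0 u₁) (s : ℝ) :
    Real.sin s * ρ ∈ Set.Ioo (-u₁) u₁ :=
  ⟨by nlinarith [Real.neg_one_le_sin s, hρ.1, hρ.2], by nlinarith [Real.sin_le_one s, hρ.1, hρ.2]⟩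

/-- There are small oscillations about a nondegenerate minimum. -/
theorem exists_small_oscillation {W : ℝ → ℝ} (hW : ContDiff ℝ ∞ W) {x₀ δ : ℝ}
    (h1 : deriv W x₀ = 0) (h2 : 0 < deriv (deriv W) x₀) (hδ : 0 < δ) :
    ∃ x y : ℝ → ℝ, IsNewtonSolution (fun s => -deriv W s) x y ∧ (∀ t, |x t - x₀| < δ) ∧
      y 0 ≠ 0 := by
  obtain ⟨k, u₁, hk, -, hu₁, hball⟩ := exists_energy_coordinate_Ioo hW h1 h2 hδ
  have hρ : u₁ / 2 ∈ Set.Ioo 0 u₁ := ⟨by linarith, by linarith⟩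
  obtain ⟨x, y, ψ, hsol, hψ0, -, hx, hy, -⟩ := exists_oscillation (hW.differentiable (by simp)) hk
    (fun u hu => (hball u hu).1) hρ
  refine ⟨x, y, hsol, fun t => ?_, ?_⟩
  · rw [hx]; exact (hball _ (sin_mul_mem_Ioo hρ _)).2
  · rw [hy, hψ0, Real.cos_zero, mul_one]; exact hρ.1.ne'

/-- If all small oscillations about a nondegenerate minimum have an integer multiple of `2π` as a
period, then their frequency is rational, and the potential satisfies the first condition of
isochronicity. -/
theorem isochronicity_of_periodic {W : ℝ → ℝ} (hW : ContDiff ℝ ∞ W) {x₀ δ : ℝ}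
    (h1 : deriv W x₀ = 0) (h2 : 0 < deriv (deriv W) x₀) (hδ : 0 < δ)
    (hper : ∀ x y, IsNewtonSolution (fun s => -deriv W s) x y → (∀ t, |x t - x₀| < δ) →
      ∃ n : ℕ, 0 < n ∧ Function.Periodic x (2 * Real.pi * n)) :
    (∃ q : ℚ, 0 < q ∧ deriv (deriv W) x₀ = (q : ℝ) ^ 2) ∧
      5 * deriv (deriv (deriv W)) x₀ ^ 2 =
        3 * deriv (deriv W) x₀ * deriv (deriv (deriv (deriv W))) x₀ := by
  obtain ⟨k, u₁, hk, hk0, hu₁, hball⟩ := exists_energy_coordinate_Ioo hW h1 h2 hδ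
  have hrat : ∀ ρ ∈ Set.Ioo 0 u₁, ∃ q : ℚ, 0 < q ∧ oscillationPeriod k ρ = q * (2 * Real.pi) := by
    intro ρ hρ
    refine exists_rational_oscillationPeriod (hW.differentiable (by simp)) hk
      (fun u hu => (hball u hu).1) hρ fun x y hsol hx => hper x y hsol fun t => ?_
    obtain ⟨s, hs⟩ := hx t
    rw [hs]; exact (hball _ (sin_mul_mem_Ioo hρ _)).2
  have hcont : Continuous (oscillationPeriod k) :=
    intervalIntegral.continuous_parametric_intervalIntegral_of_continuous'
      (by have := hk.continuous_deriv (by norm_num); fun_prop) _ _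
  have hmid : u₁ / 2 ∈ Set.Ioo 0 u₁ := ⟨by linarith, by linarith⟩
  obtain ⟨q, hq, hqT⟩ := hrat _ hmid
  -- The period is continuous in the amplitude and takes values in `ℚ · 2π`.
  have hconst : ∀ ρ ∈ Set.Ioo 0 u₁, oscillationPeriod k ρ = q * (2 * Real.pi) := fun ρ hρ => by
    rw [← hqT]
    exact IsPreconnected.eq_of_rational_multiple isPreconnected_Ioo hcont.continuousOn
      (fun σ hσ => by obtain ⟨r, -, hr⟩ := hrat σ hσ; exact ⟨r, hr⟩) hρ hmid
  obtain ⟨hT, hk3⟩ := third_deriv_eq_zero_of_const_period hk hu₁ hconst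
  have hk' : deriv k 0 = q := by
    have := Real.pi_pos
    have h : 2 * Real.pi * (deriv k 0 - q) = 0 := by linarith
    rcases mul_eq_zero.1 h with h | h
    · linarith
    · linarith
  have hq' : (0 : ℝ) < q := by exact_mod_cast hq
  obtain ⟨h4, h5⟩ := energy_coordinate_jet hW hk (c := W x₀) (by
    filter_upwards [isOpen_Ioo.mem_nhds (⟨by linarith, hu₁⟩ : (0 : ℝ) ∈ Set.Ioo (-u₁) u₁)]
      with u hu using (hball u hu).1.1) (by rw [hk0, h1]) hk3 (by rw [hk']; exact hq')
  rw [hk0] at h4 h5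
  -- The limiting period is `2π k'(0)`, so `k'(0) = q`, and `W'' k'² = 1` makes the frequency `1 /
  -- q`.
  refine ⟨⟨q⁻¹, inv_pos.2 hq, ?_⟩, h5⟩
  rw [hk'] at h4
  push_cast
  rw [inv_pow]
  exact eq_inv_of_mul_eq_one_left h4

/-! ### The interval and the Clairaut coordinate -/

variable {a b : EReal} {f V y η : ℝ → ℝ}

theorem isOpen_interval (a b : EReal) : IsOpen (interval a b) :=
  (isOpen_lt continuous_const continuous_coe_real_ereal).inter
    (isOpen_lt continuous_coe_real_ereal continuous_const)

theorem ordConnected_interval (a b : EReal) : (interval a b).OrdConnected :=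
  ⟨fun _ hx _ hy _ hz => ⟨hx.1.trans_le (EReal.coe_le_coe_iff.2 hz.1),
    (EReal.coe_le_coe_iff.2 hz.2).trans_lt hy.2⟩⟩

theorem convex_interval (a b : EReal) : Convex ℝ (interval a b) :=
  convex_iff_ordConnected.2 (ordConnected_interval a b)

theorem interval_nonempty (hab : a < b) : (interval a b).Nonempty := by
  obtain ⟨q, h1, h2⟩ := EReal.exists_rat_btwn_of_lt hab
  exact ⟨q, h1, h2⟩

/-- On an open convex set a continuous function has a primitive. -/
theorem exists_primitive {U : Set ℝ} (hU : IsOpen U) (hc : Convex ℝ U) {g : ℝ → ℝ}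
    (hg : ContinuousOn g U) : ∃ A : ℝ → ℝ, ∀ s ∈ U, HasDerivAt A (g s) s := by
  rcases U.eq_empty_or_nonempty with rfl | ⟨z, hz⟩
  · exact ⟨0, fun s hs => hs.elim⟩
  refine ⟨fun s => ∫ t in z..s, g t, fun s hs => ?_⟩
  have hsub : Set.uIcc z s ⊆ U := (convex_iff_ordConnected.1 hc).uIcc_subset hz hs
  exact intervalIntegral.integral_hasDerivAt_right ((hg.mono hsub).intervalIntegrable)
    (hg.stronglyMeasurableAtFilter hU s hs) (hg.continuousAt (hU.mem_nhds hs))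

/-- A coordinate `y` on `(a, b)` with `dy = dr / f²` and inverse `η`. In this coordinate the orbits
are the motions of Newton's equation with the time `φ`. -/
structure IsClairautChart (a b : EReal) (f y η : ℝ → ℝ) : Prop where
  smooth : ContDiffOn ℝ ∞ f (interval a b)
  pos : ∀ r ∈ interval a b, 0 < f r
  hasDerivAt : ∀ r ∈ interval a b, HasDerivAt y (1 / f r ^ 2) r
  left_inv : ∀ r ∈ interval a b, η (y r) = r

theorem strictMonoOn_of_hasDerivAt_pos {y y' : ℝ → ℝ}
    (hy : ∀ r ∈ interval a b, HasDerivAt y (y' r) r) (hpos : ∀ r ∈ interval a b, 0 < y' r) :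
    StrictMonoOn y (interval a b) :=
  strictMonoOn_of_deriv_pos (convex_interval a b)
    (fun r hr => (hy r hr).continuousAt.continuousWithinAt) fun r hr => by
      have hr' := interior_subset hr
      rw [(hy r hr').deriv]; exact hpos r hr'

theorem exists_isClairautChart_of_hasDerivAt (hf : ContDiffOn ℝ ∞ f (interval a b))
    (hpos : ∀ r ∈ interval a b, 0 < f r)
    (hy : ∀ r ∈ interval a b, HasDerivAt y (1 / f r ^ 2) r) :
    ∃ η, IsClairautChart a b f y η :=
  -- Outside the image of `y` the inverse takes arbitrary values; it is used only on `y '' interval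
  -- a b`.
  ⟨Function.invFunOn y (interval a b), hf, hpos, hy,
    (strictMonoOn_of_hasDerivAt_pos hy fun r hr => by have := hpos r hr; positivity).injOn
      |>.leftInvOn_invFunOn⟩

theorem exists_isClairautChart (hf : ContDiffOn ℝ ∞ f (interval a b))
    (hpos : ∀ r ∈ interval a b, 0 < f r) : ∃ y η, IsClairautChart a b f y η := by
  obtain ⟨y, hy⟩ := exists_primitive (isOpen_interval a b) (convex_interval a b)
    (g := fun r => 1 / f r ^ 2)
    (continuousOn_const.div (hf.continuousOn.pow 2) fun r hr => (pow_pos (hpos r hr) 2).ne')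
  exact ⟨y, exists_isClairautChart_of_hasDerivAt hf hpos hy⟩

theorem hasDerivAt_deriv_of_contDiffOn {g : ℝ → ℝ} {U : Set ℝ} (hg : ContDiffOn ℝ ∞ g U)
    (hU : IsOpen U) {r : ℝ} (hr : r ∈ U) : HasDerivAt g (deriv g r) r :=
  ((hg.contDiffAt (hU.mem_nhds hr)).differentiableAt (by simp)).hasDerivAt

theorem contDiffOn_deriv {g : ℝ → ℝ} {U : Set ℝ} (hg : ContDiffOn ℝ ∞ g U) (hU : IsOpen U) :
    ContDiffOn ℝ ∞ (deriv g) U :=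
  hg.deriv_of_isOpen hU (by simp)

namespace IsClairautChart

theorem f_hasDerivAt (h : IsClairautChart a b f y η) {r : ℝ} (hr : r ∈ interval a b) :
    HasDerivAt f (deriv f r) r :=
  hasDerivAt_deriv_of_contDiffOn h.smooth (isOpen_interval a b) hr

theorem strictMonoOn (h : IsClairautChart a b f y η) : StrictMonoOn y (interval a b) :=
  strictMonoOn_of_hasDerivAt_pos h.hasDerivAt fun r hr => by have := h.pos r hr; positivity

theorem mem (h : IsClairautChart a b f y η) {s : ℝ} (hs : s ∈ y '' interval a b) :
    η s ∈ interval a b := by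
  obtain ⟨r, hr, rfl⟩ := hs
  rwa [h.left_inv r hr]

theorem right_inv (h : IsClairautChart a b f y η) {s : ℝ} (hs : s ∈ y '' interval a b) :
    y (η s) = s := by
  obtain ⟨r, hr, rfl⟩ := hs
  rw [h.left_inv r hr]

theorem hasStrictDerivAt (h : IsClairautChart a b f y η) {r : ℝ} (hr : r ∈ interval a b) :
    HasStrictDerivAt y (1 / f r ^ 2) r :=
  hasStrictDerivAt_of_hasDerivAt_of_continuousAt
    (by filter_upwards [(isOpen_interval a b).mem_nhds hr] with s hs using h.hasDerivAt s hs)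
    (continuousAt_const.div ((h.f_hasDerivAt hr).continuousAt.pow 2) (pow_pos (h.pos r hr) 2).ne')

theorem isOpen_image (h : IsClairautChart a b f y η) : IsOpen (y '' interval a b) := by
  rw [isOpen_iff_mem_nhds]
  rintro _ ⟨r, hr, rfl⟩
  have h1 := (h.hasStrictDerivAt hr).map_nhds_eq (by have := h.pos r hr; positivity)
  rw [← h1]
  exact Filter.image_mem_map ((isOpen_interval a b).mem_nhds hr)

theorem convex_image (h : IsClairautChart a b f y η) : Convex ℝ (y '' interval a b) :=
  Real.convex_iff_isPreconnected.2 ((convex_interval a b).isPreconnected.image y fun r hr =>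
    (h.hasDerivAt r hr).continuousAt.continuousWithinAt)

theorem inv_hasDerivAt (h : IsClairautChart a b f y η) {s : ℝ} (hs : s ∈ y '' interval a b) :
    HasDerivAt η (f (η s) ^ 2) s := by
  obtain ⟨r, hr, rfl⟩ := hs
  have := (h.hasStrictDerivAt hr).to_local_left_inverse (g := η)
    (by have := h.pos r hr; positivity)
    (by filter_upwards [(isOpen_interval a b).mem_nhds hr] with s hs using h.left_inv s hs)
  rw [h.left_inv r hr]
  simpa using this.hasDerivAt

/-- A bootstrap on the equation `η' = f(η)²`: each order of smoothness of `η` gives the next. -/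
theorem inv_contDiffOn (h : IsClairautChart a b f y η) : ContDiffOn ℝ ∞ η (y '' interval a b) := by
  refine contDiffOn_infty.2 fun n => ?_
  induction n with
  | zero =>
    exact contDiffOn_zero.2 fun s hs => (h.inv_hasDerivAt hs).continuousAt.continuousWithinAt
  | succ n ih =>
    rw [show ((n + 1 : ℕ) : WithTop ℕ∞) = (n : WithTop ℕ∞) + 1 by norm_cast,
      contDiffOn_succ_iff_deriv_of_isOpen h.isOpen_image]
    refine ⟨fun s hs => (h.inv_hasDerivAt hs).differentiableAt.differentiableWithinAt, by simp, ?_⟩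
    have h1 : ContDiffOn ℝ n (fun s => f (η s) ^ 2) (y '' interval a b) :=
      ((h.smooth.of_le (by norm_cast; exact le_top)).comp ih fun s hs => h.mem hs).pow 2
    exact h1.congr fun s hs => (h.inv_hasDerivAt hs).deriv

end IsClairautChart

/-! ### Orbits as Newton motions with the angle as time -/

/-- The potential of Newton's equation for the orbits with angular momentum `K` in the
coordinate with inverse `η`. -/
noncomputable def reducedPotential (f V η : ℝ → ℝ) (K s : ℝ) : ℝ :=
  effectivePotential f V K (η s) / K ^ 2

theorem effectivePotential_contDiffOn (hf : ContDiffOn ℝ ∞ f (interval a b))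
    (hpos : ∀ r ∈ interval a b, 0 < f r) (hV : ContDiffOn ℝ ∞ V (interval a b)) (K : ℝ) :
    ContDiffOn ℝ ∞ (effectivePotential f V K) (interval a b) :=
  hV.add (contDiffOn_const.div (contDiffOn_const.mul (hf.pow 2)) fun r hr => by
    have := hpos r hr; positivity)

theorem effectivePotential_hasDerivAt {r f' V' : ℝ} (hf : HasDerivAt f f' r)
    (hV : HasDerivAt V V' r) (hpos : 0 < f r) (K : ℝ) :
    HasDerivAt (effectivePotential f V K) (V' - K ^ 2 * f' / f r ^ 3) r := by
  have h1 := hV.add ((hasDerivAt_const r (K ^ 2)).div ((hf.pow 2).const_mul 2)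
    (by simp only [Pi.pow_apply]; positivity))
  convert! h1 using 1
  simp only [Pi.pow_apply]
  push_cast
  field_simp
  ring

namespace IsClairautChart

theorem reducedPotential_contDiffOn (h : IsClairautChart a b f y η)
    (hV : ContDiffOn ℝ ∞ V (interval a b)) (K : ℝ) :
    ContDiffOn ℝ ∞ (reducedPotential f V η K) (y '' interval a b) :=
  ((effectivePotential_contDiffOn h.smooth h.pos hV K).comp h.inv_contDiffOn
    fun _ hs => h.mem hs).div_const _

theorem reducedPotential_hasDerivAt (h : IsClairautChart a b f y η)
    (hV : ContDiffOn ℝ ∞ V (interval a b)) (K : ℝ) {s : ℝ} (hs : s ∈ y '' interval a b) :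
    HasDerivAt (reducedPotential f V η K)
      (deriv (effectivePotential f V K) (η s) * f (η s) ^ 2 / K ^ 2) s :=
  ((hasDerivAt_deriv_of_contDiffOn (effectivePotential_contDiffOn h.smooth h.pos hV K)
    (isOpen_interval a b) (h.mem hs)).comp s (h.inv_hasDerivAt hs)).div_const _

end IsClairautChart

theorem HasMomentum.hasDerivAt_phi {J : Set ℝ} {r φ : ℝ → ℝ} {K : ℝ}
    (hpos : ∀ r ∈ interval a b, 0 < f r) (htr : IsTrajectoryOn a b f V J r φ)
    (hK : HasMomentum f J r φ K) {t : ℝ} (ht : t ∈ J) : HasDerivAt φ (K / f (r t) ^ 2) t := by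
  have h1 := (htr.differentiable_phi t ht).hasDerivAt
  have h2 := pow_pos (hpos _ (htr.mem t ht)) 2
  rwa [show deriv φ t = K / f (r t) ^ 2 by rw [eq_div_iff h2.ne', ← hK t ht]; ring] at h1

theorem HasMomentum.hasDerivAt_deriv_r {J : Set ℝ} {r φ : ℝ → ℝ} {K : ℝ}
    (hf : ContDiffOn ℝ ∞ f (interval a b)) (hpos : ∀ r ∈ interval a b, 0 < f r)
    (hV : ContDiffOn ℝ ∞ V (interval a b)) (htr : IsTrajectoryOn a b f V J r φ)
    (hK : HasMomentum f J r φ K) {t : ℝ} (ht : t ∈ J) :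
    HasDerivAt (deriv r) (-deriv (effectivePotential f V K) (r t)) t := by
  have hr := htr.mem t ht
  have hfr := hpos _ hr
  have h1 := htr.radial t ht
  rw [(hK.hasDerivAt_phi hpos htr ht).deriv] at h1
  rw [(effectivePotential_hasDerivAt (hasDerivAt_deriv_of_contDiffOn hf (isOpen_interval a b) hr)
    (hasDerivAt_deriv_of_contDiffOn hV (isOpen_interval a b) hr) hfr K).deriv]
  convert! h1 using 1
  field_simp
  ring

/-- A motion in the effective potential, together with the angle, is a trajectory. -/
theorem isTrajectoryOn_of_radial {J : Set ℝ} {r φ v : ℝ → ℝ} {K : ℝ} (hJ : IsOpen J)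
    (hJc : J.OrdConnected)
    (hf : ContDiffOn ℝ ∞ f (interval a b)) (hpos : ∀ r ∈ interval a b, 0 < f r)
    (hV : ContDiffOn ℝ ∞ V (interval a b)) (hr : ∀ t ∈ J, r t ∈ interval a b)
    (hrd : ∀ t ∈ J, HasDerivAt r (v t) t)
    (hvd : ∀ t ∈ J, HasDerivAt v (-deriv (effectivePotential f V K) (r t)) t)
    (hφ : ∀ t ∈ J, HasDerivAt φ (K / f (r t) ^ 2) t) :
    IsTrajectoryOn a b f V J r φ ∧ HasMomentum f J r φ K := by
  have hmom : ∀ t ∈ J, f (r t) ^ 2 * deriv φ t = K := fun t ht => by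
    have := hpos _ (hr t ht)
    rw [(hφ t ht).deriv]; field_simp
  refine ⟨⟨hJ, hJc, hr, fun t ht => (hrd t ht).differentiableAt,
    fun t ht => (hφ t ht).differentiableAt, fun t ht => ?_, fun t ht => ?_⟩, hmom⟩
  · have hI := hr t ht
    have hfr := hpos _ hI
    have h1 : HasDerivAt (deriv r) (-deriv (effectivePotential f V K) (r t)) t := by
      refine (hvd t ht).congr_of_eventuallyEq ?_
      filter_upwards [hJ.mem_nhds ht] with s hs using (hrd s hs).deriv
    rw [(effectivePotential_hasDerivAt (hasDerivAt_deriv_of_contDiffOn hf (isOpen_interval a b) hI)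
      (hasDerivAt_deriv_of_contDiffOn hV (isOpen_interval a b) hI) hfr K).deriv] at h1
    rw [(hφ t ht).deriv]
    convert! h1 using 1
    field_simp
    ring
  · refine (hasDerivAt_const t K).congr_of_eventuallyEq ?_
    filter_upwards [hJ.mem_nhds ht] with s hs using hmom s hs

theorem exists_bounds_on_Icc (hf : ContinuousOn f (interval a b))
    (hpos : ∀ r ∈ interval a b, 0 < f r) {r₁ r₂ : ℝ} (hI : Set.Icc r₁ r₂ ⊆ interval a b) :
    ∃ m M : ℝ, 0 < m ∧ 0 < M ∧ ∀ r ∈ Set.Icc r₁ r₂, m ≤ f r ^ 2 ∧ f r ^ 2 ≤ M := by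
  rcases (Set.Icc r₁ r₂).eq_empty_or_nonempty with he | hne
  · exact ⟨1, 1, one_pos, one_pos, fun r hr => by rw [he] at hr; exact hr.elim⟩
  have hc : ContinuousOn (fun r => f r ^ 2) (Set.Icc r₁ r₂) := (hf.mono hI).pow 2
  obtain ⟨z, hz, hzm⟩ := isCompact_Icc.exists_isMinOn hne hc
  obtain ⟨w, hw, hwm⟩ := isCompact_Icc.exists_isMaxOn hne hc
  exact ⟨f z ^ 2, f w ^ 2, pow_pos (hpos z (hI hz)) 2, pow_pos (hpos w (hI hw)) 2,
    fun r hr => ⟨hzm hr, hwm hr⟩⟩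

/-- The angle is a global parameter on a nonsingular bounded trajectory. -/
theorem IsNonsingularBounded.exists_time (hf : ContDiffOn ℝ ∞ f (interval a b))
    (hpos : ∀ r ∈ interval a b, 0 < f r) {r φ : ℝ → ℝ} {K : ℝ}
    (hb : IsNonsingularBounded a b f V r φ K) :
    ∃ τ : ℝ → ℝ, (∀ t, τ (φ t) = t) ∧ (∀ s, φ (τ s) = s) ∧
      ∀ s, HasDerivAt τ (f (r (τ s)) ^ 2 / K) s := by
  obtain ⟨⟨htr, r₁, r₂, hI, hr⟩, hmom, hK⟩ := hb
  obtain ⟨m, M, hm, hM, hmM⟩ := exists_bounds_on_Icc hf.continuousOn hpos hI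
  have hφ : ∀ t, HasDerivAt φ (K / f (r t) ^ 2) t := fun t =>
    hmom.hasDerivAt_phi hpos htr (Set.mem_univ t)
  have hc : 0 < |K| / M := div_pos (abs_pos.2 hK) hM
  obtain ⟨τ, h1, h2, h3⟩ := exists_inverse_of_deriv_bound hc hφ (by
    rcases hK.lt_or_gt with h | h
    · right
      intro t
      rw [abs_of_neg h, neg_div, neg_neg, div_le_div_iff₀ (by linarith [(hmM _ (hr t)).1]) hM]
      exact mul_le_mul_of_nonpos_left (hmM _ (hr t)).2 h.le
    · left
      intro t
      rw [abs_of_pos h]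
      exact div_le_div_of_nonneg_left h.le (by linarith [(hmM _ (hr t)).1]) (hmM _ (hr t)).2)
  exact ⟨τ, h1, h2, fun s => by simpa using h3 s⟩

/-- Since `dφ = K dt / f²` and `dy = dr / f²`, one has `dy / dφ = ṙ / K`, and differentiating once
more turns the radial equation `r̈ = -U'` into `-U' f² / K²`, which is minus the derivative of the
reduced potential. -/
theorem IsNonsingularBounded.isNewtonSolution (h : IsClairautChart a b f y η)
    (hV : ContDiffOn ℝ ∞ V (interval a b)) {r φ τ : ℝ → ℝ} {K : ℝ}
    (hb : IsNonsingularBounded a b f V r φ K)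
    (hτ : ∀ s, HasDerivAt τ (f (r (τ s)) ^ 2 / K) s) :
    IsNewtonSolution (fun s => -deriv (reducedPotential f V η K) s) (fun s => y (r (τ s)))
      (fun s => deriv r (τ s) / K) := by
  obtain ⟨⟨htr, -⟩, hmom, hK⟩ := hb
  have hr : ∀ t, r t ∈ interval a b := fun t => htr.mem t trivial
  refine ⟨fun s => ?_, fun s => ?_⟩
  · have hfr := h.pos _ (hr (τ s))
    have h1 := (h.hasDerivAt _ (hr (τ s))).comp s
      ((htr.differentiable_r (τ s) trivial).hasDerivAt.comp s (hτ s))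
    convert! h1 using 1
    field_simp
  · have hfr := h.pos _ (hr (τ s))
    have h1 := ((hmom.hasDerivAt_deriv_r h.smooth h.pos hV htr (Set.mem_univ (τ s))).comp s
      (hτ s)).div_const K
    convert! h1 using 1
    rw [(h.reducedPotential_hasDerivAt hV K ⟨_, hr (τ s), rfl⟩).deriv, h.left_inv _ (hr (τ s))]
    field_simp

/-- The converse passage: time is recovered from `dt = f² dφ / K`. In a compact annulus the density
is bounded away from zero, so the angle becomes a function of time on the whole line. -/
theorem IsClairautChart.exists_trajectory (h : IsClairautChart a b f y η)
    (hV : ContDiffOn ℝ ∞ V (interval a b)) {K : ℝ} (hK : K ≠ 0) {x v : ℝ → ℝ}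
    (hx : IsNewtonSolution (fun s => -deriv (reducedPotential f V η K) s) x v) {r₁ r₂ : ℝ}
    (hI : Set.Icc r₁ r₂ ⊆ interval a b) (hmem : ∀ s, x s ∈ y '' Set.Icc r₁ r₂) :
    ∃ r φ τ : ℝ → ℝ, IsNonsingularBounded a b f V r φ K ∧ (∀ t, τ (φ t) = t) ∧
      (∀ s, φ (τ s) = s) ∧ (∀ s, y (r (τ s)) = x s) ∧ ∀ t, r t ∈ Set.Icc r₁ r₂ := by
  have hxI : ∀ s, x s ∈ y '' interval a b := fun s => Set.image_mono hI (hmem s)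
  have hηI : ∀ s, η (x s) ∈ Set.Icc r₁ r₂ := fun s => by
    obtain ⟨r, hr, hrs⟩ := hmem s
    rwa [← hrs, h.left_inv r (hI hr)]
  obtain ⟨m, M, hm, hM, hmM⟩ := exists_bounds_on_Icc h.smooth.continuousOn h.pos hI
  have hηx : ∀ s, HasDerivAt (fun s => η (x s)) (f (η (x s)) ^ 2 * v s) s := fun s =>
    (h.inv_hasDerivAt (hxI s)).comp s (hx.hasDerivAt_pos s)
  set q : ℝ → ℝ := fun s => f (η (x s)) ^ 2 / K with hq
  have hqc : Continuous q := by
    refine continuous_iff_continuousAt.2 fun s => ContinuousAt.div_const (ContinuousAt.pow ?_ 2) K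
    exact ((h.f_hasDerivAt (h.mem (hxI s))).comp s (hηx s)).continuousAt
  have hΦ : ∀ s, HasDerivAt (fun s => ∫ σ in (0 : ℝ)..s, q σ) (q s) s := fun s =>
    intervalIntegral.integral_hasDerivAt_right (hqc.intervalIntegrable _ _)
      (hqc.stronglyMeasurableAtFilter _ _) hqc.continuousAt
  obtain ⟨φ, h1, h2, h3⟩ := exists_inverse_of_deriv_bound (div_pos hm (abs_pos.2 hK)) hΦ (by
    rcases hK.lt_or_gt with hneg | hp
    · right
      intro s
      rw [abs_of_neg hneg, div_neg, neg_neg]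
      exact div_le_div_of_nonpos_of_le hneg.le (hmM _ (hηI s)).1
    · left
      intro s
      rw [abs_of_pos hp]
      exact div_le_div_of_nonneg_right (hmM _ (hηI s)).1 hp.le)
  have hφ : ∀ t, HasDerivAt φ (K / f (η (x (φ t))) ^ 2) t := fun t => by
    simpa [hq] using h3 t
  obtain ⟨htr, hmom⟩ := isTrajectoryOn_of_radial (a := a) (b := b) (f := f) (V := V)
    (r := fun t => η (x (φ t))) (φ := φ)
    (v := fun t => K * v (φ t)) (K := K) isOpen_univ Set.ordConnected_univ h.smooth h.pos hV
    (fun t _ => hI (hηI _))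
    (fun t _ => by
      have hp := h.pos _ (hI (hηI (φ t)))
      have := (hηx (φ t)).comp t (hφ t)
      convert! this using 1
      field_simp)
    (fun t _ => by
      have hp := h.pos _ (hI (hηI (φ t)))
      have := ((hx.hasDerivAt_vel (φ t)).comp t (hφ t)).const_mul K
      convert! this using 1
      rw [(h.reducedPotential_hasDerivAt hV K (hxI (φ t))).deriv]
      field_simp)
    (fun t _ => hφ t)
  exact ⟨fun t => η (x (φ t)), φ, fun s => ∫ σ in (0 : ℝ)..s, q σ,
    ⟨⟨htr, r₁, r₂, hI, fun t => hηI _⟩, hmom, hK⟩, h2, h1, fun s => by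
      simp only [h1]; exact h.right_inv (hxI s), fun t => hηI _⟩

/-- As `φ̇ = K / f(r)²` depends only on `r`, a period of `r` in time advances the angle by a
constant, and a period in the angle advances time by a constant. Closedness requires the advance of
the angle to be a multiple of `2π`, nonzero because `φ` is injective; absolute values make the
periods positive. -/
theorem IsNonsingularBounded.isClosedOrbit_iff (hpos : ∀ r ∈ interval a b, 0 < f r)
    {r φ τ : ℝ → ℝ} {K : ℝ} (hb : IsNonsingularBounded a b f V r φ K) (hτφ : ∀ t, τ (φ t) = t)
    (hφτ : ∀ s, φ (τ s) = s) (hτ : ∀ s, HasDerivAt τ (f (r (τ s)) ^ 2 / K) s) :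
    IsClosedOrbit r φ ↔
      ∃ n : ℕ, 0 < n ∧ Function.Periodic (fun s => r (τ s)) (2 * Real.pi * n) := by
  obtain ⟨⟨htr, -⟩, hmom, hK⟩ := hb
  have hφ : ∀ t, HasDerivAt φ (K / f (r t) ^ 2) t := fun t =>
    hmom.hasDerivAt_phi hpos htr (Set.mem_univ t)
  constructor
  · rintro ⟨T, hT, hper⟩
    have hconst : ∀ t, φ (t + T) - φ t = φ (0 + T) - φ 0 := fun t => by
      have hd : ∀ t, HasDerivAt (fun t => φ (t + T) - φ t) 0 t := fun t => by
        have := ((hφ (t + T)).comp_add_const t T).sub (hφ t)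
        rwa [(hper t).1, sub_self] at this
      exact is_const_of_deriv_eq_zero (fun t => (hd t).differentiableAt) (fun t => (hd t).deriv) t 0
    obtain ⟨m, hm⟩ := Real.Angle.angle_eq_iff_two_pi_dvd_sub.1 (hper 0).2
    have hm0 : m ≠ 0 := by
      rintro rfl
      have h1 : φ (0 + T) = φ 0 := by simpa [sub_eq_zero] using hm
      have h2 := congrArg τ h1
      rw [hτφ, hτφ] at h2
      linarith
    have hp : Function.Periodic (fun s => r (τ s)) (2 * Real.pi * m) := fun s => by
      have h1 := hconst (τ s)
      rw [hm, hφτ] at h1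
      have h2 : s + 2 * Real.pi * m = φ (τ s + T) := by linarith
      simp only [h2, hτφ, (hper (τ s)).1]
    refine ⟨m.natAbs, Int.natAbs_pos.2 hm0, ?_⟩
    rw [Nat.cast_natAbs]
    rcases le_total 0 m with hle | hle
    · rw [abs_of_nonneg hle]; exact hp
    · rw [abs_of_nonpos hle]; push_cast
      rw [mul_neg]; exact hp.neg
  · rintro ⟨n, hn, hper⟩
    set C := τ (0 + 2 * Real.pi * n) - τ 0 with hC
    have hconst : ∀ s, τ (s + 2 * Real.pi * n) - τ s = C := fun s => by
      have hd : ∀ s, HasDerivAt (fun s => τ (s + 2 * Real.pi * n) - τ s) 0 s := fun s => by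
        have := ((hτ (s + 2 * Real.pi * n)).comp_add_const s (2 * Real.pi * n)).sub (hτ s)
        have h1 := hper s
        simp only at h1
        rwa [h1, sub_self] at this
      exact is_const_of_deriv_eq_zero (fun t => (hd t).differentiableAt) (fun t => (hd t).deriv) s 0
    have hpi : 0 < 2 * Real.pi * n := by positivity
    have hC0 : C ≠ 0 := fun h0 => by
      have h1 : τ (0 + 2 * Real.pi * n) = τ 0 := by linarith
      have h2 := congrArg φ h1
      rw [hφτ, hφτ] at h2
      linarith
    have hshift : ∀ t, r (t + C) = r t ∧ φ (t + C) = φ t + 2 * Real.pi * n := fun t => by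
      have h1 := hconst (φ t)
      rw [hτφ] at h1
      have h2 : t + C = τ (φ t + 2 * Real.pi * n) := by linarith
      have h3 := hper (φ t)
      simp only [hτφ] at h3
      exact ⟨by rw [h2]; exact h3, by rw [h2, hφτ]⟩
    refine ⟨|C|, abs_pos.2 hC0, fun t => ?_⟩
    rcases le_total 0 C with hle | hle
    · rw [abs_of_nonneg hle]
      refine ⟨(hshift t).1, Real.Angle.angle_eq_iff_two_pi_dvd_sub.2 ⟨n, ?_⟩⟩
      rw [(hshift t).2]; push_cast; ring
    · rw [abs_of_nonpos hle]
      have h1 := hshift (t + -C)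
      rw [neg_add_cancel_right] at h1
      refine ⟨h1.1.symm, Real.Angle.angle_eq_iff_two_pi_dvd_sub.2 ⟨-n, ?_⟩⟩
      rw [h1.2]; push_cast; ring

theorem IsClairautChart.exists_period (h : IsClairautChart a b f y η)
    (hV : ContDiffOn ℝ ∞ V (interval a b)) {K : ℝ} (hK : K ≠ 0) {r₁ r₂ : ℝ}
    (hI : Set.Icc r₁ r₂ ⊆ interval a b)
    (hclosed : ∀ r φ : ℝ → ℝ, IsNonsingularBounded a b f V r φ K → (∀ t, r t ∈ Set.Icc r₁ r₂) →
      IsClosedOrbit r φ) {x v : ℝ → ℝ}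
    (hx : IsNewtonSolution (fun s => -deriv (reducedPotential f V η K) s) x v)
    (hmem : ∀ s, x s ∈ y '' Set.Icc r₁ r₂) :
    ∃ n : ℕ, 0 < n ∧ Function.Periodic x (2 * Real.pi * n) := by
  obtain ⟨r, φ, τ, hb, hτφ, hφτ, hrx, hr⟩ := h.exists_trajectory hV hK hx hI hmem
  obtain ⟨τ', hτφ', hφτ', hτ'⟩ := hb.exists_time h.smooth h.pos
  -- Both functions invert `φ`, so the derivative known for `τ'` becomes available for the `τ` of
  -- the constructed trajectory.
  obtain rfl : τ = τ' := funext fun s => by rw [← hφτ' s, hτφ, hφτ']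
  obtain ⟨n, hn, hper⟩ := (hb.isClosedOrbit_iff h.pos hτφ hφτ hτ').1 (hclosed r φ hb hr)
  refine ⟨n, hn, fun s => ?_⟩
  rw [← hrx, ← hrx]
  exact congrArg y (hper s)

theorem IsClairautChart.mem_image_Icc (h : IsClairautChart a b f y η) {r₁ r₂ : ℝ}
    (hI : Set.Icc r₁ r₂ ⊆ interval a b) (hle : r₁ ≤ r₂) {s : ℝ} (hs : s ∈ Set.Icc (y r₁) (y r₂)) :
    s ∈ y '' Set.Icc r₁ r₂ :=
  intermediate_value_Icc hle
    (fun r hr => (h.hasDerivAt r (hI hr)).continuousAt.continuousWithinAt) hs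

/-! ### Circular orbits, strong stability and local isochronicity -/

theorem eq_of_orbit_eq_circle {r φ : ℝ → ℝ} {r₀ : ℝ} (h : orbit r φ = {r₀} ×ˢ Set.univ) (t : ℝ) :
    r t = r₀ := by
  have : (r t, (φ t : Real.Angle)) ∈ orbit r φ := ⟨t, rfl⟩
  rw [h] at this
  exact this.1

theorem isCircularOrbit_iff (hf : ContDiffOn ℝ ∞ f (interval a b))
    (hpos : ∀ r ∈ interval a b, 0 < f r) (hV : ContDiffOn ℝ ∞ V (interval a b)) {r₀ K : ℝ} :
    IsCircularOrbit a b f V r₀ K ↔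
      r₀ ∈ interval a b ∧ K ≠ 0 ∧ deriv (effectivePotential f V K) r₀ = 0 := by
  constructor
  · rintro ⟨r, φ, htr, hK, horb⟩
    have hr := eq_of_orbit_eq_circle horb
    have hr₀ : r₀ ∈ interval a b := by have := htr.mem 0 trivial; rwa [hr] at this
    refine ⟨hr₀, ?_, ?_⟩
    -- For `K = 0` the angle is constant, and the orbit misses the antipodal point of the circle.
    · rintro rfl
      have hφ : ∀ t, HasDerivAt φ 0 t := fun t => by
        have := hK.hasDerivAt_phi hpos htr (Set.mem_univ t)
        rwa [zero_div] at this
      have hφc : ∀ t, φ t = φ 0 := fun t =>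
        is_const_of_deriv_eq_zero (fun t => (hφ t).differentiableAt) (fun t => (hφ t).deriv) t 0
      have hmem : (r₀, ((φ 0 + Real.pi : ℝ) : Real.Angle)) ∈ orbit r φ := by rw [horb]; simp
      obtain ⟨t, ht⟩ := hmem
      have h1 := congrArg Prod.snd ht
      simp only [hφc t] at h1
      obtain ⟨m, hm⟩ := Real.Angle.angle_eq_iff_two_pi_dvd_sub.1 h1
      have h2 : Real.pi * (2 * m + 1) = 0 := by linarith
      rcases mul_eq_zero.1 h2 with h | h
      · exact Real.pi_ne_zero h
      · have : (2 * m + 1 : ℤ) = 0 := by exact_mod_cast h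
        omega
    · have h1 := hK.hasDerivAt_deriv_r hf hpos hV htr (Set.mem_univ 0)
      have h2 : r = fun _ => r₀ := funext hr
      rw [h2] at h1
      simp only [deriv_const'] at h1
      have := h1.unique (hasDerivAt_const 0 0)
      linarith
  · rintro ⟨hr₀, hK, hU⟩
    have hfr := hpos r₀ hr₀
    obtain ⟨htr, hmom⟩ := isTrajectoryOn_of_radial (a := a) (b := b) (f := f) (V := V)
      (r := fun _ => r₀) (φ := fun t => K / f r₀ ^ 2 * t) (v := fun _ => 0) (K := K) isOpen_univ
      Set.ordConnected_univ hf hpos hV (fun _ _ => hr₀) (fun t _ => hasDerivAt_const t r₀)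
      (fun t _ => by rw [hU, neg_zero]; exact hasDerivAt_const t 0)
      (fun t _ => by simpa using (hasDerivAt_id t).const_mul (K / f r₀ ^ 2))
    refine ⟨_, _, htr, hmom, Set.Subset.antisymm ?_ ?_⟩
    · rintro _ ⟨t, rfl⟩; simp
    · rintro ⟨r, α⟩ ⟨hr, -⟩
      induction α using Real.Angle.induction_on with
      | h x =>
        refine ⟨x * f r₀ ^ 2 / K, ?_⟩
        have hr' : r = r₀ := hr
        simp only [hr', Prod.mk.injEq, true_and]
        congr 1
        field_simp

theorem isLocalMin_and_deriv_deriv_ne_zero_iff {U : ℝ → ℝ} {r₀ : ℝ}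
    (hU : ContDiffAt ℝ ∞ U r₀) :
    IsLocalMin U r₀ ∧ deriv (deriv U) r₀ ≠ 0 ↔ deriv U r₀ = 0 ∧ 0 < deriv (deriv U) r₀ := by
  constructor
  · rintro ⟨hmin, hne⟩
    refine ⟨hmin.deriv_eq_zero, lt_of_le_of_ne ?_ hne.symm⟩
    -- A negative second derivative would make `r₀` a local maximum as well, so `U` would be locally
    -- constant and its second derivative zero.
    by_contra! hneg
    have hmax := isLocalMax_of_deriv_deriv_neg hneg hmin.deriv_eq_zero hU.continuousAt
    have hc : U =ᶠ[𝓝 r₀] fun _ => U r₀ := by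
      filter_upwards [hmin, hmax] with r h1 h2 using le_antisymm h2 h1
    have := hc.deriv.deriv_eq
    simp at this
    exact hne this
  · rintro ⟨h1, h2⟩
    exact ⟨isLocalMin_of_deriv_deriv_pos h2 h1 hU.continuousAt, h2.ne'⟩

theorem isStronglyStable_iff (hf : ContDiffOn ℝ ∞ f (interval a b))
    (hpos : ∀ r ∈ interval a b, 0 < f r) (hV : ContDiffOn ℝ ∞ V (interval a b)) {r₀ K : ℝ} :
    IsStronglyStable a b f V r₀ K ↔ r₀ ∈ interval a b ∧ K ≠ 0 ∧
      deriv (effectivePotential f V K) r₀ = 0 ∧ 0 < deriv (deriv (effectivePotential f V K)) r₀ := by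
  have hU : r₀ ∈ interval a b → ContDiffAt ℝ ∞ (effectivePotential f V K) r₀ := fun hr =>
    (effectivePotential_contDiffOn hf hpos hV K).contDiffAt ((isOpen_interval a b).mem_nhds hr)
  constructor
  · rintro ⟨hc, hK, hm⟩
    have hr := ((isCircularOrbit_iff hf hpos hV).1 hc).1
    exact ⟨hr, hK, (isLocalMin_and_deriv_deriv_ne_zero_iff (hU hr)).1 hm⟩
  · rintro ⟨hr, hK, hm⟩
    exact ⟨(isCircularOrbit_iff hf hpos hV).2 ⟨hr, hK, hm.1⟩, hK,
      (isLocalMin_and_deriv_deriv_ne_zero_iff (hU hr)).2 hm⟩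

namespace IsClairautChart

theorem deriv_reducedPotential_eq_zero_iff (h : IsClairautChart a b f y η)
    (hV : ContDiffOn ℝ ∞ V (interval a b)) {K r₀ : ℝ} (hK : K ≠ 0) (hr₀ : r₀ ∈ interval a b) :
    deriv (reducedPotential f V η K) (y r₀) = 0 ↔ deriv (effectivePotential f V K) r₀ = 0 := by
  have hfr := h.pos r₀ hr₀
  rw [(h.reducedPotential_hasDerivAt hV K ⟨r₀, hr₀, rfl⟩).deriv, h.left_inv r₀ hr₀,
    div_eq_zero_iff, mul_eq_zero]
  simp [hK, hfr.ne']

/-- At a critical point the second derivative transforms as a quadratic form, whence the factor `η'²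
= f⁴`. -/
theorem deriv_deriv_reducedPotential (h : IsClairautChart a b f y η)
    (hV : ContDiffOn ℝ ∞ V (interval a b)) {K r₀ : ℝ} (hr₀ : r₀ ∈ interval a b)
    (hU : deriv (effectivePotential f V K) r₀ = 0) :
    deriv (deriv (reducedPotential f V η K)) (y r₀) =
      deriv (deriv (effectivePotential f V K)) r₀ * f r₀ ^ 4 / K ^ 2 := by
  have hs : y r₀ ∈ y '' interval a b := ⟨r₀, hr₀, rfl⟩
  have heq : deriv (reducedPotential f V η K) =ᶠ[𝓝 (y r₀)]
      fun s => deriv (effectivePotential f V K) (η s) * f (η s) ^ 2 / K ^ 2 := by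
    filter_upwards [h.isOpen_image.mem_nhds hs] with s hs using
      (h.reducedPotential_hasDerivAt hV K hs).deriv
  have hη := h.inv_hasDerivAt hs
  have h1 : HasDerivAt (deriv (effectivePotential f V K))
      (deriv (deriv (effectivePotential f V K)) (η (y r₀))) (η (y r₀)) :=
    hasDerivAt_deriv_of_contDiffOn (contDiffOn_deriv
      (effectivePotential_contDiffOn h.smooth h.pos hV K) (isOpen_interval a b))
      (isOpen_interval a b) (h.mem hs)
  have h2 := (((h1.comp _ hη).mul (((h.f_hasDerivAt (h.mem hs)).comp _ hη).pow 2)).div_const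
    (K ^ 2))
  rw [heq.deriv_eq]
  refine h2.deriv.trans ?_
  simp only [Function.comp_apply, Pi.pow_apply, h.left_inv r₀ hr₀, hU]
  ring

theorem isStronglyStable_iff_reduced (h : IsClairautChart a b f y η)
    (hV : ContDiffOn ℝ ∞ V (interval a b)) {K r₀ : ℝ} (hr₀ : r₀ ∈ interval a b) (hK : K ≠ 0) :
    IsStronglyStable a b f V r₀ K ↔ deriv (reducedPotential f V η K) (y r₀) = 0 ∧
      0 < deriv (deriv (reducedPotential f V η K)) (y r₀) := by
  have hfr := h.pos r₀ hr₀
  rw [isStronglyStable_iff h.smooth h.pos hV, h.deriv_reducedPotential_eq_zero_iff hV hK hr₀]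
  constructor
  · rintro ⟨-, -, h1, h2⟩
    refine ⟨h1, ?_⟩
    rw [h.deriv_deriv_reducedPotential hV hr₀ h1]
    positivity
  · rintro ⟨h1, h2⟩
    refine ⟨hr₀, hK, h1, ?_⟩
    rw [h.deriv_deriv_reducedPotential hV hr₀ h1] at h2
    by_contra! hle
    have : deriv (deriv (effectivePotential f V K)) r₀ * f r₀ ^ 4 / K ^ 2 ≤ 0 :=
      div_nonpos_of_nonpos_of_nonneg (mul_nonpos_of_nonpos_of_nonneg hle (by positivity))
        (by positivity)
    linarith

/-- The reduced potential near a point, replaced by a smooth function on the line. -/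
theorem exists_local_model (h : IsClairautChart a b f y η)
    (hV : ContDiffOn ℝ ∞ V (interval a b)) (K : ℝ) {r₀ ε : ℝ} (hr₀ : r₀ ∈ interval a b)
    (hε : 0 < ε) :
    ∃ (W : ℝ → ℝ) (δ r₁ r₂ : ℝ), ContDiff ℝ ∞ W ∧ W =ᶠ[𝓝 (y r₀)] reducedPotential f V η K ∧
      0 < δ ∧ Set.Icc r₁ r₂ ⊆ interval a b ∧ Set.Icc r₁ r₂ ⊆ Set.Icc (r₀ - ε) (r₀ + ε) ∧
      ∀ x v : ℝ → ℝ, IsNewtonSolution (fun s => -deriv W s) x v → (∀ t, |x t - y r₀| < δ) →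
        IsNewtonSolution (fun s => -deriv (reducedPotential f V η K) s) x v ∧
          ∀ t, x t ∈ y '' Set.Icc r₁ r₂ := by
  have hs : y r₀ ∈ y '' interval a b := ⟨r₀, hr₀, rfl⟩
  obtain ⟨W, hW, hWeq⟩ := exists_contDiff_eventuallyEq (n := ∞) le_rfl (h.isOpen_image.mem_nhds hs)
    (h.reducedPotential_contDiffOn hV K)
  obtain ⟨ε', hε', hball⟩ := Metric.isOpen_iff.1 (isOpen_interval a b) r₀ hr₀
  set e := min (ε' / 2) ε with he
  have he0 : 0 < e := lt_min (by linarith) hε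
  have hI : Set.Icc (r₀ - e) (r₀ + e) ⊆ interval a b := fun r hr => hball (by
    rw [Metric.mem_ball, Real.dist_eq, abs_lt]
    have := min_le_left (ε' / 2) ε
    constructor <;> linarith [hr.1, hr.2])
  have hmem : ∀ z, |z - r₀| ≤ e → z ∈ Set.Icc (r₀ - e) (r₀ + e) := fun z hz => by
    rw [abs_le] at hz; constructor <;> linarith
  have hy1 : y (r₀ - e) < y r₀ := h.strictMonoOn (hI ⟨le_rfl, by linarith⟩) hr₀ (by linarith)
  have hy2 : y r₀ < y (r₀ + e) := h.strictMonoOn hr₀ (hI ⟨by linarith, le_rfl⟩) (by linarith)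
  obtain ⟨δ, hδ, hδball⟩ := Metric.eventually_nhds_iff_ball.1
    (hWeq.deriv.and (Icc_mem_nhds hy1 hy2))
  refine ⟨W, δ, r₀ - e, r₀ + e, hW, hWeq, hδ, hI, fun r hr => ?_, fun x v hx hxδ => ?_⟩
  · have := min_le_right (ε' / 2) ε
    constructor <;> linarith [hr.1, hr.2]
  · have hxb : ∀ t, x t ∈ Metric.ball (y r₀) δ := fun t => by
      rw [Metric.mem_ball, Real.dist_eq]; exact hxδ t
    refine ⟨⟨hx.hasDerivAt_pos, fun t => ?_⟩, fun t =>
      h.mem_image_Icc hI (by linarith) (hδball _ (hxb t)).2⟩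
    have := hx.hasDerivAt_vel t
    rwa [(hδball _ (hxb t)).1] at this

/-- Small motions in the local model stay in the annulus where orbits are assumed closed. The model
has the same germ as the reduced potential, so the conditions on its first four derivatives carry
over. -/
theorem isochronicity_of_closesNear (h : IsClairautChart a b f y η)
    (hV : ContDiffOn ℝ ∞ V (interval a b)) {K r₀ : ℝ} (hst : IsStronglyStable a b f V r₀ K)
    (hcl : ClosesNear a b f V r₀ K) :
    (∃ q : ℚ, 0 < q ∧ deriv (deriv (reducedPotential f V η K)) (y r₀) = (q : ℝ) ^ 2) ∧
      5 * deriv (deriv (deriv (reducedPotential f V η K))) (y r₀) ^ 2 =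
        3 * deriv (deriv (reducedPotential f V η K)) (y r₀) *
          deriv (deriv (deriv (deriv (reducedPotential f V η K)))) (y r₀) := by
  obtain ⟨hr₀, hK, -⟩ := (isStronglyStable_iff h.smooth h.pos hV).1 hst
  obtain ⟨h1, h2⟩ := (h.isStronglyStable_iff_reduced hV hr₀ hK).1 hst
  obtain ⟨ε, hε, hclosed⟩ := hcl
  obtain ⟨W, δ, r₁, r₂, hW, hWeq, hδ, hI, hIε, hsol⟩ := h.exists_local_model hV K hr₀ hε
  have e1 := hWeq.deriv
  have e2 := e1.deriv
  have e3 := e2.deriv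
  have e4 := e3.deriv
  have := isochronicity_of_periodic hW (x₀ := y r₀) (δ := δ) (by rw [e1.self_of_nhds, h1])
    (by rw [e2.self_of_nhds]; exact h2) hδ fun x v hx hxδ => by
      obtain ⟨hx', hmem⟩ := hsol x v hx hxδ
      refine h.exists_period hV hK hI (fun r φ hb hr => ?_) hx' hmem
      exact hclosed r φ K hb (fun t => hIε (hr t)) ⟨by linarith, by linarith⟩
  rwa [e2.self_of_nhds, e3.self_of_nhds, e4.self_of_nhds] at this

end IsClairautChart

/-! ### Oscillating orbits and orbital stability -/

/-- There are noncircular bounded orbits near a strongly stable circular orbit. -/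
theorem IsStronglyStable.exists_isOscillating (hf : ContDiffOn ℝ ∞ f (interval a b))
    (hpos : ∀ r ∈ interval a b, 0 < f r) (hV : ContDiffOn ℝ ∞ V (interval a b)) {r₀ K : ℝ}
    (hst : IsStronglyStable a b f V r₀ K) :
    ∃ r φ : ℝ → ℝ, IsOscillating a b f V r φ K := by
  obtain ⟨y, η, h⟩ := exists_isClairautChart hf hpos
  obtain ⟨hr₀, hK, -⟩ := (isStronglyStable_iff h.smooth h.pos hV).1 hst
  obtain ⟨h1, h2⟩ := (h.isStronglyStable_iff_reduced hV hr₀ hK).1 hst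
  obtain ⟨W, δ, r₁, r₂, hW, hWeq, hδ, hI, -, hsol⟩ := h.exists_local_model hV K hr₀ one_pos
  obtain ⟨x, v, hx, hxδ, hv0⟩ := exists_small_oscillation hW (x₀ := y r₀) (δ := δ)
    (by rw [hWeq.deriv.self_of_nhds, h1]) (by rw [hWeq.deriv.deriv.self_of_nhds]; exact h2) hδ
  obtain ⟨hx', hmem⟩ := hsol x v hx hxδ
  obtain ⟨r, φ, τ, hb, hτφ, hφτ, hrx, hr⟩ := h.exists_trajectory hV hK hx' hI hmem
  refine ⟨r, φ, hb, ?_⟩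
  rintro ⟨c, hc⟩
  have hxc : x = fun _ => y c := funext fun s => by rw [← hrx s, eq_of_orbit_eq_circle hc]
  have h3 := hx.hasDerivAt_pos 0
  rw [hxc] at h3
  exact hv0 (h3.unique (hasDerivAt_const 0 (y c)))

theorem exists_lipschitzOnWith_Icc {g : ℝ → ℝ} {U : Set ℝ} {α β : ℝ}
    (hg : ContDiffOn ℝ ∞ g U) (hsub : Set.Icc α β ⊆ U) :
    ∃ L, LipschitzOnWith L g (Set.Icc α β) :=
  (hg.mono hsub).exists_lipschitzOnWith (by simp) (convex_Icc α β) isCompact_Icc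

/-- A semilocally closing potential has a strongly stable circular orbit. -/
theorem IsOscillating.exists_isStronglyStable (hf : ContDiffOn ℝ ∞ f (interval a b))
    (hpos : ∀ r ∈ interval a b, 0 < f r) (hV : ContDiffOn ℝ ∞ V (interval a b)) {r φ : ℝ → ℝ}
    {K : ℝ} (ho : IsOscillating a b f V r φ K)
    (hclosed : ∀ r' φ' : ℝ → ℝ, IsNonsingularBounded a b f V r' φ' K →
      (∀ t, r' t ∈ Set.Icc (sInf (Set.range r)) (sSup (Set.range r))) → IsClosedOrbit r' φ') :
    ∃ r₀, IsStronglyStable a b f V r₀ K := by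
  obtain ⟨y, η, h⟩ := exists_isClairautChart hf hpos
  obtain ⟨hb, hnc⟩ := ho
  have hK := hb.2.2
  obtain ⟨⟨htr, r₁, r₂, hI, hr⟩, -⟩ := id hb
  obtain ⟨τ, hτφ, hφτ, hτ⟩ := hb.exists_time hf hpos
  have hx := hb.isNewtonSolution h hV hτ
  have hbelow : BddBelow (Set.range r) := ⟨r₁, by rintro _ ⟨t, rfl⟩; exact (hr t).1⟩
  have habove : BddAbove (Set.range r) := ⟨r₂, by rintro _ ⟨t, rfl⟩; exact (hr t).2⟩
  -- The given orbit lies between its own bounds, so it is itself closed. Thus `x` is periodic and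
  -- attains its extreme values, the turning points.
  obtain ⟨n, hn, hper⟩ := (hb.isClosedOrbit_iff hpos hτφ hφτ hτ).1
    (hclosed r φ hb fun t => ⟨csInf_le hbelow ⟨t, rfl⟩, le_csSup habove ⟨t, rfl⟩⟩)
  set x : ℝ → ℝ := fun s => y (r (τ s)) with hxdef
  set v : ℝ → ℝ := fun s => deriv r (τ s) / K
  set W := reducedPotential f V η K with hW
  have hrI : ∀ t, r t ∈ interval a b := fun t => hI (hr t)
  have hWd : ∀ s ∈ y '' interval a b, HasDerivAt W (deriv W s) s := fun s hs =>
    hasDerivAt_deriv_of_contDiffOn (h.reducedPotential_contDiffOn hV K) h.isOpen_image hs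
  have hxper : Function.Periodic x (2 * Real.pi * n) := fun s => congrArg y (hper s)
  have hcpt : IsCompact (Set.range x) :=
    hxper.compact_of_continuous (by positivity) hx.continuous
  obtain ⟨_, ⟨s₁, rfl⟩, hmin⟩ := hcpt.exists_isLeast (Set.range_nonempty x)
  obtain ⟨_, ⟨s₂, rfl⟩, hmax⟩ := hcpt.exists_isGreatest (Set.range_nonempty x)
  have hmin' : ∀ s, x s₁ ≤ x s := fun s => hmin ⟨s, rfl⟩
  have hmax' : ∀ s, x s ≤ x s₂ := fun s => hmax ⟨s, rfl⟩
  have hnconst : ∀ c, ¬ ∀ s, x s = c := by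
    intro c hc
    refine hnc ⟨r (τ 0), Set.Subset.antisymm ?_ ?_⟩
    · rintro _ ⟨t, rfl⟩
      have h1 : y (r (τ (φ t))) = y (r (τ 0)) := (hc _).trans (hc 0).symm
      rw [hτφ] at h1
      exact ⟨h.strictMonoOn.injOn (hrI t) (hrI _) h1, trivial⟩
    · rintro ⟨ρ, α⟩ ⟨hρ, -⟩
      induction α using Real.Angle.induction_on with
      | h z =>
        refine ⟨τ z, ?_⟩
        have h1 : y (r (τ z)) = y (r (τ 0)) := (hc _).trans (hc 0).symm
        have h2 : ρ = r (τ 0) := hρ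
        simp only [hφτ, h2, h.strictMonoOn.injOn (hrI _) (hrI _) h1]
  have hlt : x s₁ < x s₂ := by
    by_contra! hle
    exact hnconst (x s₁) fun s => le_antisymm ((hmax' s).trans hle) (hmin' s)
  have hv₁ : v s₁ = 0 :=
    (IsLocalMin.hasDerivAt_eq_zero (Filter.Eventually.of_forall hmin') (hx.hasDerivAt_pos s₁))
  have hv₂ : v s₂ = 0 :=
    (IsLocalMax.hasDerivAt_eq_zero (Filter.Eventually.of_forall hmax') (hx.hasDerivAt_pos s₂))
  have henergy : ∀ s, v s ^ 2 / 2 + W (x s) = W (x s₁) := fun s => by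
    have := hx.energy_eq (W := W) (fun t => hWd _ ⟨_, hrI _, rfl⟩) s s₁
    rw [hv₁] at this
    linarith
  have hE : W (x s₂) = W (x s₁) := by
    have := henergy s₂; rw [hv₂] at this; linarith
  have hrange : Set.Icc (x s₁) (x s₂) ⊆ Set.range x := fun z hz =>
    mem_range_of_exists_le_of_exists_ge hx.continuous ⟨s₁, hz.1⟩ ⟨s₂, hz.2⟩
  have hsubI : Set.Icc (x s₁) (x s₂) ⊆ y '' interval a b := fun z hz => by
    obtain ⟨s, rfl⟩ := hrange hz; exact ⟨_, hrI _, rfl⟩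
  have hWle : ∀ z ∈ Set.Icc (x s₁) (x s₂), W z ≤ W (x s₁) := fun z hz => by
    obtain ⟨s, rfl⟩ := hrange hz
    nlinarith [henergy s, sq_nonneg (v s)]
  -- The bottom of the well between the turning points. It lies strictly below the energy: otherwise
  -- the velocity would vanish identically and the orbit would be circular.
  obtain ⟨θ, hθ, hθmin⟩ := isCompact_Icc.exists_isMinOn (Set.nonempty_Icc.2 hlt.le)
    (fun z hz => (hWd z (hsubI hz)).continuousAt.continuousWithinAt)
  have hθE : W θ < W (x s₁) := by
    refine lt_of_le_of_ne (hWle θ hθ) fun heq => ?_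
    have hv0 : ∀ s, v s = 0 := fun s => by
      have h1 := henergy s
      have h2 : W θ ≤ W (x s) := hθmin ⟨hmin' s, hmax' s⟩
      have h3 : v s ^ 2 = 0 := le_antisymm (by linarith) (sq_nonneg _)
      exact pow_eq_zero_iff (two_ne_zero) |>.1 h3
    refine hnconst (x 0) fun s => ?_
    exact is_const_of_deriv_eq_zero (fun t => (hx.hasDerivAt_pos t).differentiableAt)
      (fun t => by rw [(hx.hasDerivAt_pos t).deriv, hv0]) s 0
  have hαθ : x s₁ < θ := lt_of_le_of_ne hθ.1 (by rintro heq; rw [← heq] at hθE; exact hθE.false)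
  have hθβ : θ < x s₂ := lt_of_le_of_ne hθ.2 (by rintro rfl; rw [hE] at hθE; exact hθE.false)
  have hW0 : deriv W θ = 0 := by
    refine IsLocalMin.deriv_eq_zero ?_
    filter_upwards [Icc_mem_nhds hαθ hθβ] with z hz using hθmin hz
  have hW' := contDiffOn_deriv (h.reducedPotential_contDiffOn hV K) h.isOpen_image
  obtain ⟨L, hL⟩ := exists_lipschitzOnWith_Icc hW' hsubI
  have hrr : Set.Icc (r (τ s₁)) (r (τ s₂)) ⊆ interval a b := fun z hz =>
    hI ⟨(hr _).1.trans hz.1, hz.2.trans (hr _).2⟩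
  have hrle : r (τ s₁) ≤ r (τ s₂) :=
    (h.strictMonoOn.le_iff_le (hrI _) (hrI _)).1 hlt.le
  have hpos2 := second_deriv_pos_of_periodic hαθ hθβ (fun z hz => hWd z (hsubI hz)) hL hθE
    (by rw [hE]; exact hθE) hW0
    (hasDerivAt_deriv_of_contDiffOn hW' h.isOpen_image (hsubI hθ)) fun x' v' hx' hmem =>
      h.exists_period hV hK hrr (fun r' φ' hb' hr' => hclosed r' φ' hb' fun t =>
        ⟨(csInf_le hbelow ⟨_, rfl⟩).trans (hr' t).1, (hr' t).2.trans (le_csSup habove ⟨_, rfl⟩)⟩)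
        hx' fun s => h.mem_image_Icc hrr hrle (Set.Ioo_subset_Icc_self (hmem s))
  obtain ⟨r₀, hr₀, rfl⟩ := hsubI hθ
  exact ⟨r₀, (h.isStronglyStable_iff_reduced hV hr₀ hK).2 ⟨hW0, hpos2⟩⟩

/-- The sign conditions make `r₀` a weak local maximum of the effective potential, where a radial
push of size `δ' / 2` is never slowed down. The distance `δ / 2` is reached by time `δ / δ'`. The
motion is restricted to the times `J` at which it stays in the annulus, as it need not be defined
for longer. -/
theorem not_isOrbitallyStable (hf : ContDiffOn ℝ ∞ f (interval a b))
    (hpos : ∀ r ∈ interval a b, 0 < f r) (hV : ContDiffOn ℝ ∞ V (interval a b)) {r₀ K δ : ℝ}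
    (hδ : 0 < δ) (hI : Set.Icc (r₀ - δ) (r₀ + δ) ⊆ interval a b)
    (hr : ∀ s ∈ Set.Icc r₀ (r₀ + δ), deriv (effectivePotential f V K) s ≤ 0)
    (hl : ∀ s ∈ Set.Icc (r₀ - δ) r₀, 0 ≤ deriv (effectivePotential f V K) s) :
    ¬ IsOrbitallyStable a b f V r₀ K := by
  rintro ⟨-, hst⟩
  obtain ⟨δ', hδ', hstay⟩ := hst (δ / 2) (by positivity)
  have hU := effectivePotential_contDiffOn hf hpos hV K
  obtain ⟨L, hL⟩ := exists_lipschitzOnWith_Icc (contDiffOn_deriv hU (isOpen_interval a b)) hI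
  obtain ⟨x, v, hx, hv, hx0, hv0, hle⟩ := exists_escaping_solution hδ
    (fun s hs => hasDerivAt_deriv_of_contDiffOn hU (isOpen_interval a b) (hI hs)) hL hr hl
    (half_pos hδ')
  have hmono : StrictMono x := strictMono_of_deriv_pos fun t => by
    rw [(hx t).deriv]; linarith [hle t]
  have hcont : Continuous x := continuous_iff_continuousAt.2 fun t => (hx t).continuousAt
  set J := x ⁻¹' Set.Ioo (r₀ - δ) (r₀ + δ) with hJ
  have hJo : IsOpen J := isOpen_Ioo.preimage hcont
  have hJc : J.OrdConnected := Set.ordConnected_Ioo.preimage_mono hmono.monotone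
  have hJI : ∀ t ∈ J, x t ∈ interval a b := fun t ht => hI (Set.Ioo_subset_Icc_self ht)
  obtain ⟨φ, hφ⟩ := exists_primitive hJo (convex_iff_ordConnected.2 hJc)
    (g := fun t => K / f (x t) ^ 2)
    (continuousOn_const.div ((hf.continuousOn.comp hcont.continuousOn hJI).pow 2) fun t ht =>
      (pow_pos (hpos _ (hJI t ht)) 2).ne')
  obtain ⟨htr, hmom⟩ := isTrajectoryOn_of_radial hJo hJc hf hpos hV hJI (fun t _ => hx t)
    (fun t ht => hv t (Set.Ioo_subset_Icc_self ht)) hφ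
  have h0J : (0 : ℝ) ∈ J := by
    show x 0 ∈ Set.Ioo _ _
    rw [hx0]; constructor <;> linarith
  have hstay' := hstay J x φ htr hmom h0J (by rw [hx0, sub_self, abs_zero]; exact hδ')
    (by rw [(hx 0).deriv, hv0, abs_of_pos (by positivity)]; linarith)
  have hfar : r₀ + δ / 2 ≤ x (δ / δ') := by
    have h1 := (convex_univ (𝕜 := ℝ) (E := ℝ)).mul_sub_le_image_sub_of_le_deriv (C := δ' / 2) (f := x)
      hcont.continuousOn (fun t _ => (hx t).differentiableAt.differentiableWithinAt)
      (fun t _ => by rw [(hx t).deriv]; exact hle t) 0 trivial (δ / δ') trivial (by positivity)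
    have h2 : δ' / 2 * (δ / δ' - 0) = δ / 2 := by field_simp; ring
    rw [h2, hx0] at h1
    linarith
  obtain ⟨t, ht, hxt⟩ := intermediate_value_Icc (by positivity : (0 : ℝ) ≤ δ / δ')
    hcont.continuousOn (⟨by rw [hx0]; linarith, hfar⟩ : r₀ + δ / 2 ∈ Set.Icc (x 0) (x (δ / δ')))
  have htJ : t ∈ J := by
    show x t ∈ Set.Ioo _ _
    rw [hxt]; constructor <;> linarith
  have := (hstay' t htJ ht.1).1
  rw [hxt, add_sub_cancel_left, abs_of_pos (by positivity)] at this
  exact this.false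

/-- If all circles are orbitally stable orbits, some circle is a strongly stable orbit. -/
theorem exists_isStronglyStable_of_forall_isOrbitallyStable (hab : a < b)
    (hf : ContDiffOn ℝ ∞ f (interval a b)) (hpos : ∀ r ∈ interval a b, 0 < f r)
    (hcrit : ∀ r ∈ interval a b, deriv f r ≠ 0) (hV : ContDiffOn ℝ ∞ V (interval a b))
    (hst : ∀ r₀ ∈ interval a b, ∃ K₀ : ℝ, IsOrbitallyStable a b f V r₀ K₀) :
    ∃ r₀ K₀ : ℝ, IsStronglyStable a b f V r₀ K₀ := by
  by_contra! hcon
  choose! k hk using hst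
  have hIo := isOpen_interval a b
  have hV' := contDiffOn_deriv hV hIo
  set g : ℝ → ℝ := fun r => deriv f r / f r ^ 3 with hg
  have hgC : ContDiffOn ℝ ∞ g (interval a b) := (contDiffOn_deriv hf hIo).div (hf.pow 3)
    fun r hr => (pow_pos (hpos r hr) 3).ne'
  have hg0 : ∀ r ∈ interval a b, g r ≠ 0 := fun r hr =>
    div_ne_zero (hcrit r hr) (pow_pos (hpos r hr) 3).ne'
  have hU' : ∀ (K : ℝ), ∀ r ∈ interval a b,
      deriv (effectivePotential f V K) r = deriv V r - K ^ 2 * g r := fun K r hr => by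
    rw [(effectivePotential_hasDerivAt (hasDerivAt_deriv_of_contDiffOn hf hIo hr)
      (hasDerivAt_deriv_of_contDiffOn hV hIo hr) (hpos r hr) K).deriv, hg]
    ring
  have hU'' : ∀ (K : ℝ), ∀ r ∈ interval a b, HasDerivAt (deriv (effectivePotential f V K))
      (deriv (deriv V) r - K ^ 2 * deriv g r) r := fun K r hr => by
    refine ((hasDerivAt_deriv_of_contDiffOn hV' hIo hr).sub
      ((hasDerivAt_deriv_of_contDiffOn hgC hIo hr).const_mul (K ^ 2))).congr_of_eventuallyEq ?_
    filter_upwards [hIo.mem_nhds hr] with s hs using hU' K s hs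
  have hcrit0 : ∀ r ∈ interval a b, k r ≠ 0 ∧ deriv (effectivePotential f V (k r)) r = 0 :=
    fun r hr => ((isCircularOrbit_iff hf hpos hV).1 (hk r hr).1).2
  have hVg : ∀ r ∈ interval a b, deriv V r = k r ^ 2 * g r := fun r hr => by
    have := (hcrit0 r hr).2
    rw [hU' _ r hr] at this
    linarith
  -- A negative value would make the circle a potential hill, hence unstable; a positive one would
  -- make it strongly stable, which is excluded by assumption.
  have hflat : ∀ r ∈ interval a b, deriv (deriv V) r - k r ^ 2 * deriv g r = 0 := by
    intro r hr
    rcases lt_trichotomy (deriv (deriv V) r - k r ^ 2 * deriv g r) 0 with hneg | h0 | hp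
    · exfalso
      have hd := hU'' (k r) r hr
      have h0 := (hcrit0 r hr).2
      have hsign := eventually_nhdsWithin_sign_eq_of_deriv_neg
        (f := deriv (effectivePotential f V (k r))) (by rw [hd.deriv]; exact hneg) h0
      obtain ⟨ε, hε, hball⟩ := Metric.eventually_nhds_iff_ball.1
        (hsign.and (hIo.mem_nhds hr))
      have hb : ∀ s ∈ Set.Icc (r - ε / 2) (r + ε / 2), s ∈ Metric.ball r ε := fun s hs => by
        rw [Metric.mem_ball, Real.dist_eq, abs_lt]
        constructor <;> linarith [hs.1, hs.2]
      refine not_isOrbitallyStable hf hpos hV (half_pos hε) (fun s hs => (hball s (hb s hs)).2)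
        (fun s hs => ?_) (fun s hs => ?_) (hk r hr)
      · rw [← sign_nonpos_iff, (hball s (hb s ⟨by linarith [hs.1], hs.2⟩)).1, sign_nonpos_iff]
        linarith [hs.1]
      · rw [← sign_nonneg_iff, (hball s (hb s ⟨hs.1, by linarith [hs.2]⟩)).1, sign_nonneg_iff]
        linarith [hs.2]
    · exact h0
    · exact absurd ((isStronglyStable_iff hf hpos hV).2 ⟨hr, (hcrit0 r hr).1, (hcrit0 r hr).2, by
        rw [(hU'' (k r) r hr).deriv]; exact hp⟩) (hcon r (k r))
  obtain ⟨r₀, hr₀⟩ := interval_nonempty hab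
  -- `V' = k² g` and `V'' = k² g'` give `(V' / g)' = 0`. So one momentum serves all circles, its
  -- effective potential is constant, and the resulting free radial drift contradicts stability.
  have hconst : ∀ r ∈ interval a b, deriv V r / g r = deriv V r₀ / g r₀ := by
    intro r hr
    have hd : ∀ s ∈ interval a b, HasDerivAt (fun s => deriv V s / g s) 0 s := fun s hs => by
      have := (hasDerivAt_deriv_of_contDiffOn hV' hIo hs).div
        (hasDerivAt_deriv_of_contDiffOn hgC hIo hs) (hg0 s hs)
      convert! this using 1
      have h1 := hflat s hs
      have h2 : deriv (deriv V) s = k s ^ 2 * deriv g s := by linarith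
      rw [h2, hVg s hs]
      ring
    exact hIo.is_const_of_deriv_eq_zero (convex_interval a b).isPreconnected
      (fun s hs => (hd s hs).differentiableAt.differentiableWithinAt)
      (fun s hs => (hd s hs).deriv) hr hr₀
  have hU0 : ∀ r ∈ interval a b, deriv (effectivePotential f V (k r₀)) r = 0 := fun r hr => by
    have h1 := hconst r hr
    rw [hVg r₀ hr₀, mul_div_cancel_right₀ _ (hg0 r₀ hr₀), div_eq_iff (hg0 r hr)] at h1
    rw [hU' _ r hr, h1, sub_self]
  obtain ⟨ε, hε, hball⟩ := Metric.isOpen_iff.1 hIo r₀ hr₀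
  have hI : Set.Icc (r₀ - ε / 2) (r₀ + ε / 2) ⊆ interval a b := fun s hs => hball (by
    rw [Metric.mem_ball, Real.dist_eq, abs_lt]
    constructor <;> linarith [hs.1, hs.2])
  exact not_isOrbitallyStable hf hpos hV (half_pos hε) hI
    (fun s hs => (hU0 s (hI ⟨by linarith [hs.1], hs.2⟩)).le)
    (fun s hs => (hU0 s (hI ⟨hs.1, by linarith [hs.2]⟩)).ge) (hk r₀ hr₀)

theorem HasMomentum.energy_eq {J : Set ℝ} {r φ : ℝ → ℝ} {K : ℝ}
    (hf : ContDiffOn ℝ ∞ f (interval a b)) (hpos : ∀ r ∈ interval a b, 0 < f r)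
    (hV : ContDiffOn ℝ ∞ V (interval a b)) (htr : IsTrajectoryOn a b f V J r φ)
    (hK : HasMomentum f J r φ K) {s t : ℝ} (hs : s ∈ J) (ht : t ∈ J) :
    deriv r s ^ 2 / 2 + effectivePotential f V K (r s) =
      deriv r t ^ 2 / 2 + effectivePotential f V K (r t) := by
  have hd : ∀ t ∈ J, HasDerivAt (fun t => deriv r t ^ 2 / 2 + effectivePotential f V K (r t)) 0 t :=
    fun t ht => by
      have h1 := ((hK.hasDerivAt_deriv_r hf hpos hV htr ht).pow 2).div_const 2
      have h2 := (hasDerivAt_deriv_of_contDiffOn (effectivePotential_contDiffOn hf hpos hV K)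
        (isOpen_interval a b) (htr.mem t ht)).comp t (htr.differentiable_r t ht).hasDerivAt
      convert! h1.add h2 using 1
      push_cast; ring
  exact htr.isOpen.is_const_of_deriv_eq_zero
    (convex_iff_ordConnected.2 htr.ordConnected).isPreconnected
    (fun s hs => (hd s hs).differentiableAt.differentiableWithinAt) (fun s hs => (hd s hs).deriv)
    hs ht

theorem IsStronglyStable.isOrbitallyStable (hf : ContDiffOn ℝ ∞ f (interval a b))
    (hpos : ∀ r ∈ interval a b, 0 < f r) (hV : ContDiffOn ℝ ∞ V (interval a b)) {r₀ K : ℝ}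
    (hst : IsStronglyStable a b f V r₀ K) : IsOrbitallyStable a b f V r₀ K := by
  refine ⟨hst.1, fun ε hε => ?_⟩
  obtain ⟨hr₀, -, hU0, hU2⟩ := (isStronglyStable_iff hf hpos hV).1 hst
  have hU := effectivePotential_contDiffOn hf hpos hV K
  set U := effectivePotential f V K with hUdef
  have hIo := isOpen_interval a b
  have hd : ∀ r ∈ interval a b, HasDerivAt U (deriv U r) r := fun r hr =>
    hasDerivAt_deriv_of_contDiffOn hU hIo hr
  obtain ⟨ε', hε', hball⟩ := Metric.eventually_nhds_iff_ball.1
    ((eventually_nhdsWithin_sign_eq_of_deriv_pos hU2 hU0).and (hIo.mem_nhds hr₀))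
  set e := min ε (ε' / 2) with he
  have he0 : 0 < e := lt_min hε (by linarith)
  have heε : e ≤ ε := min_le_left _ _
  have hb : ∀ s ∈ Set.Icc (r₀ - e) (r₀ + e), s ∈ Metric.ball r₀ ε' := fun s hs => by
    have : e ≤ ε' / 2 := min_le_right _ _
    rw [Metric.mem_ball, Real.dist_eq, abs_lt]
    constructor <;> linarith [hs.1, hs.2]
  have hI : Set.Icc (r₀ - e) (r₀ + e) ⊆ interval a b := fun s hs => (hball s (hb s hs)).2
  have hright : StrictMonoOn U (Set.Icc r₀ (r₀ + e)) :=
    strictMonoOn_of_deriv_pos (convex_Icc _ _)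
      (fun s hs => (hd s (hI ⟨by linarith [hs.1], hs.2⟩)).continuousAt.continuousWithinAt)
      fun s hs => by
        rw [interior_Icc] at hs
        rw [← sign_eq_one_iff, (hball s (hb s ⟨by linarith [hs.1], hs.2.le⟩)).1, sign_eq_one_iff]
        linarith [hs.1]
  have hleft : StrictAntiOn U (Set.Icc (r₀ - e) r₀) :=
    strictAntiOn_of_deriv_neg (convex_Icc _ _)
      (fun s hs => (hd s (hI ⟨hs.1, by linarith [hs.2]⟩)).continuousAt.continuousWithinAt)
      fun s hs => by
        rw [interior_Icc] at hs
        rw [← sign_eq_neg_one_iff, (hball s (hb s ⟨hs.1.le, by linarith [hs.2]⟩)).1,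
          sign_eq_neg_one_iff]
        linarith [hs.2]
  have hUr : U r₀ < U (r₀ + e) := hright ⟨le_rfl, by linarith⟩ ⟨by linarith, le_rfl⟩ (by linarith)
  have hUl : U r₀ < U (r₀ - e) := hleft ⟨le_rfl, by linarith⟩ ⟨by linarith, le_rfl⟩ (by linarith)
  have hmin : ∀ s ∈ Set.Icc (r₀ - e) (r₀ + e), U r₀ ≤ U s := fun s hs => by
    rcases le_total r₀ s with h | h
    · exact hright.monotoneOn ⟨le_rfl, by linarith⟩ ⟨h, hs.2⟩ h
    · exact hleft.antitoneOn ⟨hs.1, h⟩ ⟨by linarith, le_rfl⟩ h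
  -- The energy excess `m` is below the barrier at both ends of the annulus, which confines `r`, and
  -- below `e² / 2`, which bounds the radial velocity by `e`.
  set m := min (min (U (r₀ + e)) (U (r₀ - e)) - U r₀) (e ^ 2 / 2) with hm
  have hm0 : 0 < m := lt_min (sub_pos.2 (lt_min hUr hUl)) (by positivity)
  obtain ⟨δ₁, hδ₁, hnear⟩ := Metric.continuousAt_iff.1 (hd r₀ hr₀).continuousAt (m / 2)
    (by linarith)
  refine ⟨min (min δ₁ e) (√m), lt_min (lt_min hδ₁ he0) (Real.sqrt_pos.2 hm0),
    fun J r φ htr hmom h0 hr0 hv0 t ht ht0 => ?_⟩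
  have hrδ : |r 0 - r₀| < δ₁ := hr0.trans_le ((min_le_left _ _).trans (min_le_left _ _))
  have hre : |r 0 - r₀| < e := hr0.trans_le ((min_le_left _ _).trans (min_le_right _ _))
  have hvm : deriv r 0 ^ 2 < m := by
    have h1 : |deriv r 0| < √m := hv0.trans_le (min_le_right _ _)
    have h2 := (Real.lt_sqrt (abs_nonneg _)).1 h1
    rwa [sq_abs] at h2
  have hUm : U (r 0) < U r₀ + m / 2 := by
    have h1 := hnear (x := r 0) (by rw [Real.dist_eq]; exact hrδ)
    rw [Real.dist_eq] at h1
    linarith [(abs_lt.1 h1).2]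
  have hE : ∀ s ∈ J, deriv r s ^ 2 / 2 + U (r s) < U r₀ + m := fun s hs => by
    have := hmom.energy_eq hf hpos hV htr hs h0
    rw [← hUdef] at this
    linarith
  have hJt : Set.Icc 0 t ⊆ J := htr.ordConnected.out h0 ht
  have hrc : ContinuousOn r (Set.Icc 0 t) := fun s hs =>
    (htr.differentiable_r s (hJt hs)).continuousAt.continuousWithinAt
  have hbarrier : ∀ s ∈ Set.Icc 0 t, r s ≠ r₀ + e ∧ r s ≠ r₀ - e := fun s hs => by
    have h1 := hE s (hJt hs)
    have h2 : m ≤ min (U (r₀ + e)) (U (r₀ - e)) - U r₀ := min_le_left _ _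
    constructor
    · intro h; rw [h] at h1
      have := min_le_left (U (r₀ + e)) (U (r₀ - e))
      nlinarith [sq_nonneg (deriv r s)]
    · intro h; rw [h] at h1
      have := min_le_right (U (r₀ + e)) (U (r₀ - e))
      nlinarith [sq_nonneg (deriv r s)]
  rw [abs_lt] at hre
  have hlt : r t < r₀ + e := by
    by_contra! hle
    obtain ⟨s, hs, hrs⟩ := intermediate_value_Icc ht0 hrc
      (⟨by linarith, hle⟩ : r₀ + e ∈ Set.Icc (r 0) (r t))
    exact (hbarrier s hs).1 hrs
  have hgt : r₀ - e < r t := by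
    by_contra! hle
    obtain ⟨s, hs, hrs⟩ := intermediate_value_Icc' ht0 hrc
      (⟨hle, by linarith⟩ : r₀ - e ∈ Set.Icc (r t) (r 0))
    exact (hbarrier s hs).2 hrs
  refine ⟨abs_lt.2 ⟨by linarith, by linarith⟩, ?_⟩
  have h1 := hE t ht
  have h2 := hmin (r t) ⟨hgt.le, hlt.le⟩
  have h3 : m ≤ e ^ 2 / 2 := min_le_right _ _
  have h4 : deriv r t ^ 2 < e ^ 2 := by linarith
  exact (abs_lt_of_sq_lt_sq h4 he0.le).trans_le heε

/-! ### Comparison of the five senses of closing -/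

/-- Each of the five conditions implies that the potential is locally closing. -/
theorem ClosingCondition.locally (hab : a < b)
    (hf : ContDiffOn ℝ ∞ f (interval a b)) (hpos : ∀ r ∈ interval a b, 0 < f r)
    (hcrit : ∀ r ∈ interval a b, deriv f r ≠ 0) (hV : ContDiffOn ℝ ∞ V (interval a b)) {s : Sense}
    (h : ClosingCondition a b f V s) : ClosingCondition a b f V .locally := by
  cases s with
  | closing =>
    obtain ⟨⟨r, φ, K, ho⟩, hall⟩ := h
    obtain ⟨r₀, hst⟩ := ho.exists_isStronglyStable hf hpos hV fun r' φ' hb _ => hall r' φ' K hb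
    exact ⟨⟨r₀, K, hst⟩, fun _ _ _ => ⟨1, one_pos, fun r φ K hb _ _ => hall r φ K hb⟩⟩
  | locally => exact h
  | semilocally =>
    obtain ⟨⟨r, φ, K, ho, hcl⟩, hloc⟩ := h
    obtain ⟨r₀, hst⟩ := ho.exists_isStronglyStable hf hpos hV hcl
    exact ⟨⟨r₀, K, hst⟩, hloc⟩
  | strongly =>
    obtain ⟨hall, hloc⟩ := h
    obtain ⟨r₀, hr₀⟩ := interval_nonempty hab
    exact ⟨⟨r₀, hall r₀ hr₀⟩, hloc⟩
  | weakly =>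
    obtain ⟨hall, hloc⟩ := h
    exact ⟨exists_isStronglyStable_of_forall_isOrbitallyStable hab hf hpos hcrit hV hall,
      fun r₀ K₀ hst => hloc r₀ K₀ (hst.isOrbitallyStable hf hpos hV)⟩

/-- A potential for which all circles are strongly stable and all nonsingular bounded orbits are
closed is closing in each of the five senses. -/
theorem closingCondition_of_forall (hab : a < b)
    (hf : ContDiffOn ℝ ∞ f (interval a b)) (hpos : ∀ r ∈ interval a b, 0 < f r)
    (hV : ContDiffOn ℝ ∞ V (interval a b))
    (hst : ∀ r₀ ∈ interval a b, ∃ K₀ : ℝ, IsStronglyStable a b f V r₀ K₀)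
    (hcl : ∀ (r φ : ℝ → ℝ) (K : ℝ), IsNonsingularBounded a b f V r φ K → IsClosedOrbit r φ)
    (s : Sense) : ClosingCondition a b f V s := by
  obtain ⟨r₀, hr₀⟩ := interval_nonempty hab
  obtain ⟨K₀, hK₀⟩ := hst r₀ hr₀
  obtain ⟨r, φ, ho⟩ := hK₀.exists_isOscillating hf hpos hV
  have hnear : ∀ r₀ K₀, ClosesNear a b f V r₀ K₀ := fun _ _ =>
    ⟨1, one_pos, fun r φ K hb _ _ => hcl r φ K hb⟩
  cases s with
  | closing => exact ⟨⟨r, φ, K₀, ho⟩, hcl⟩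
  | locally => exact ⟨⟨r₀, K₀, hK₀⟩, fun _ _ _ => hnear _ _⟩
  | semilocally => exact ⟨⟨r, φ, K₀, ho, fun r' φ' hb _ => hcl r' φ' K₀ hb⟩, fun _ _ _ => hnear _ _⟩
  | strongly => exact ⟨hst, fun _ _ _ => hnear _ _⟩
  | weakly =>
    refine ⟨fun r hr => ?_, fun _ _ _ => hnear _ _⟩
    obtain ⟨K, hK⟩ := hst r hr
    exact ⟨K, hK.isOrbitallyStable hf hpos hV⟩

/-! ### Rigidity of the frequency and the resulting differential equations -/

theorem eq_of_hasDerivAt_zero {I : Set ℝ} (hI : Convex ℝ I) {g : ℝ → ℝ}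
    (h : ∀ s ∈ I, HasDerivAt g 0 s) {s t : ℝ} (hs : s ∈ I) (ht : t ∈ I) : g s = g t := by
  have := hI.norm_image_sub_le_of_norm_hasDerivWithin_le (C := 0)
    (fun x hx => (h x hx).hasDerivWithinAt) (fun x _ => by simp) ht hs
  rw [zero_mul] at this
  exact sub_eq_zero.1 (norm_le_zero_iff.1 this)

theorem exists_eq_add_const {I : Set ℝ} (hI : Convex ℝ I) {g h g' : ℝ → ℝ}
    (hg : ∀ s ∈ I, HasDerivAt g (g' s) s) (hh : ∀ s ∈ I, HasDerivAt h (g' s) s) :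
    ∃ C, ∀ s ∈ I, g s = h s + C := by
  rcases I.eq_empty_or_nonempty with rfl | ⟨z, hz⟩
  · exact ⟨0, fun s hs => hs.elim⟩
  refine ⟨g z - h z, fun s hs => ?_⟩
  have := eq_of_hasDerivAt_zero hI (g := fun s => g s - h s)
    (fun s hs => by convert! (hg s hs).sub (hh s hs) using 1; ring) hs hz
  linarith

/-- If every strongly stable equilibrium of the potentials `G + k P`, `k > 0`, has the rational
frequency and the isochronicity property, then the same frequency occurs everywhere. -/
theorem frequency_rigid {I : Set ℝ} (hI : IsOpen I) (hIc : Convex ℝ I) {G P : ℝ → ℝ}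
    (hG : ContDiffOn ℝ ∞ G I) (hP : ContDiffOn ℝ ∞ P I) (hG' : ∀ s ∈ I, deriv G s ≠ 0)
    (hrat : ∀ s ∈ I, ∀ k : ℝ, 0 < k → deriv G s + k * deriv P s = 0 →
      0 < deriv (deriv G) s + k * deriv (deriv P) s →
        ∃ q : ℚ, 0 < q ∧ deriv (deriv G) s + k * deriv (deriv P) s = (q : ℝ) ^ 2)
    {s₀ k₀ : ℝ} (hs₀ : s₀ ∈ I) (hk₀ : 0 < k₀) (h1 : deriv G s₀ + k₀ * deriv P s₀ = 0)
    (h2 : 0 < deriv (deriv G) s₀ + k₀ * deriv (deriv P) s₀) :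
    ∃ ν : ℚ, 0 < ν ∧ ∀ s ∈ I, deriv G s * deriv P s < 0 ∧
      deriv (deriv G) s * deriv P s - deriv G s * deriv (deriv P) s = ν ^ 2 * deriv P s := by
  obtain ⟨ν, hν, hνeq⟩ := hrat s₀ hs₀ k₀ hk₀ h1 h2
  have hG1 := contDiffOn_deriv hG hI
  have hG2 := contDiffOn_deriv hG1 hI
  have hP1 := contDiffOn_deriv hP hI
  have hP2 := contDiffOn_deriv hP1 hI
  have dG1 := fun s hs => hasDerivAt_deriv_of_contDiffOn hG1 hI (r := s) hs
  have dP1 := fun s hs => hasDerivAt_deriv_of_contDiffOn hP1 hI (r := s) hs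
  have dG2 := fun s hs => hasDerivAt_deriv_of_contDiffOn hG2 hI (r := s) hs
  have dP2 := fun s hs => hasDerivAt_deriv_of_contDiffOn hP2 hI (r := s) hs
  -- The function `q = (P' / G') exp A` is constant wherever the frequency identity holds. Keeping
  -- its negative value fixed prevents `P'` from tending to zero at a limit point of the good set.
  obtain ⟨A, hA⟩ := exists_primitive hI hIc (g := fun s => (ν : ℝ) ^ 2 / deriv G s)
    (continuousOn_const.div hG1.continuousOn hG')
  set q : ℝ → ℝ := fun s => deriv P s / deriv G s * Real.exp (A s) with hq
  have dq : ∀ s ∈ I, HasDerivAt q (((deriv (deriv P) s * deriv G s -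
      deriv P s * deriv (deriv G) s) / deriv G s ^ 2 + deriv P s / deriv G s *
        (ν ^ 2 / deriv G s)) * Real.exp (A s)) s := fun s hs => by
    have := ((dP1 s hs).div (dG1 s hs) (hG' s hs)).mul (hA s hs).exp
    convert! this using 1
    simp only [Pi.div_apply]
    ring
  have hneg : ∀ s ∈ I, q s < 0 → deriv G s * deriv P s < 0 := fun s hs h => by
    have h3 : deriv P s / deriv G s < 0 := by
      by_contra! h4
      exact absurd h (not_lt.2 (mul_nonneg h4 (Real.exp_pos _).le))
    have h4 := hG' s hs
    have h5 : deriv G s * deriv P s = deriv P s / deriv G s * deriv G s ^ 2 := by field_simp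
    rw [h5]
    exact mul_neg_of_neg_of_pos h3 (by positivity)
  have hP10 : deriv P s₀ = -deriv G s₀ / k₀ := by field_simp; linarith
  have hq0 : q s₀ < 0 := by
    have h4 := hG' s₀ hs₀
    have : q s₀ = -(1 / k₀ * Real.exp (A s₀)) := by simp only [hq, hP10]; field_simp
    rw [this]
    have := Real.exp_pos (A s₀)
    have : 0 < 1 / k₀ * Real.exp (A s₀) := by positivity
    linarith
  set S : Set ℝ := {s | s ∈ I ∧ deriv (deriv G) s * deriv P s - deriv G s * deriv (deriv P) s =
    ν ^ 2 * deriv P s ∧ q s = q s₀} with hS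
  have hνR : (0 : ℝ) < ν := by exact_mod_cast hν
  have hSopen : IsOpen S := by
    rw [isOpen_iff_mem_nhds]
    rintro s ⟨hs, hΩ, hqs⟩
    have hGP := hneg s hs (by rw [hqs]; exact hq0)
    -- `Ω t` is the second derivative at `t` of `G + k P` for the `k = -G' / P'` that makes `t` an
    -- equilibrium. It stays positive near `s`, where `√Ω` is continuous with rational values, hence
    -- equal to `ν`.
    set Ω : ℝ → ℝ := fun t => deriv (deriv G) t - deriv G t * deriv (deriv P) t / deriv P t with hΩd
    have hPne : deriv P s ≠ 0 := right_ne_zero_of_mul hGP.ne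
    have hΩs : Ω s = ν ^ 2 := by simp only [hΩd]; field_simp; linarith
    have hΩc : ContinuousAt Ω s := ((dG2 s hs).continuousAt).sub
      ((((dG1 s hs).continuousAt).mul (dP2 s hs).continuousAt).div (dP1 s hs).continuousAt hPne)
    have hev : ∀ᶠ t in 𝓝 s, t ∈ I ∧ deriv G t * deriv P t < 0 ∧ 0 < Ω t := by
      have h3 : ∀ᶠ t in 𝓝 s, 0 < Ω t := hΩc.eventually_const_lt (by rw [hΩs]; positivity)
      filter_upwards [hI.mem_nhds hs, ((dG1 s hs).continuousAt.mul
        (dP1 s hs).continuousAt).eventually_lt_const hGP, h3] with t h4 h5 h6 using ⟨h4, h5, h6⟩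
    obtain ⟨ε, hε, hball⟩ := Metric.eventually_nhds_iff_ball.1 hev
    have hΩb : ∀ t ∈ Metric.ball s ε, Ω t = ν ^ 2 := by
      have hc : ContinuousOn (fun t => √(Ω t)) (Metric.ball s ε) := by
        refine ContinuousOn.sqrt (fun t ht => ContinuousAt.continuousWithinAt ?_)
        obtain ⟨h3, h4, -⟩ := hball t ht
        exact ((dG2 t h3).continuousAt).sub ((((dG1 t h3).continuousAt).mul
          (dP2 t h3).continuousAt).div (dP1 t h3).continuousAt (right_ne_zero_of_mul h4.ne))
      intro t ht
      have h5 := IsPreconnected.eq_of_rational_multiple (convex_ball s ε).isPreconnected (c := 1) hc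
        (fun t ht => by
          obtain ⟨h3, h4, h5⟩ := hball t ht
          have hPt : deriv P t ≠ 0 := right_ne_zero_of_mul h4.ne
          have e : deriv (deriv G) t + -(deriv G t / deriv P t) * deriv (deriv P) t = Ω t := by
            simp only [hΩd]; field_simp; ring
          obtain ⟨p, hp, hpe⟩ := hrat t h3 (-(deriv G t / deriv P t)) (by
            have : deriv G t / deriv P t < 0 := by
              rw [div_eq_mul_inv]
              rcases mul_neg_iff.1 h4 with ⟨h6, h7⟩ | ⟨h6, h7⟩
              · exact mul_neg_of_pos_of_neg h6 (inv_lt_zero.2 h7)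
              · exact mul_neg_of_neg_of_pos h6 (inv_pos.2 h7)
            linarith) (by field_simp; ring) (by rw [e]; exact h5)
          refine ⟨p, ?_⟩
          rw [mul_one, ← e, hpe, Real.sqrt_sq (by exact_mod_cast hp.le)]) ht
        (Metric.mem_ball_self hε)
      simp only [hΩs] at h5
      rw [Real.sqrt_sq hνR.le] at h5
      rw [← h5, Real.sq_sqrt (hball t ht).2.2.le]
    have hΩb' : ∀ t ∈ Metric.ball s ε, deriv (deriv G) t * deriv P t -
        deriv G t * deriv (deriv P) t = ν ^ 2 * deriv P t := fun t ht => by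
      have hPt : deriv P t ≠ 0 := right_ne_zero_of_mul (hball t ht).2.1.ne
      rw [← hΩb t ht]; simp only [hΩd]; field_simp
    refine Filter.mem_of_superset (Metric.ball_mem_nhds s hε) fun t ht =>
      ⟨(hball t ht).1, hΩb' t ht, ?_⟩
    rw [← hqs]
    refine eq_of_hasDerivAt_zero (convex_ball s ε) (fun t ht => ?_) ht (Metric.mem_ball_self hε)
    have h3 := dq t (hball t ht).1
    convert! h3 using 1
    have h4 := hG' t (hball t ht).1
    have h5 := hΩb' t ht
    field_simp
    linear_combination Real.exp (A t) * h5
  -- The set `S` is open and nonempty. It is relatively closed because its conditions are equations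
  -- between continuous functions; the frequency identity was multiplied by `P'` for this purpose.
  have hSI : I ⊆ S := by
    refine hIc.isPreconnected.subset_of_closure_inter_subset hSopen
      ⟨s₀, hs₀, hs₀, ?_, rfl⟩ ?_
    · rw [hP10, ← hνeq]; field_simp; ring
    · rintro s ⟨hcl, hs⟩
      have hmem := mem_closure_iff_clusterPt.1 hcl
      rw [ClusterPt] at hmem
      have hne : (𝓝 s ⊓ Filter.principal S).NeBot := hmem
      have hSe : ∀ᶠ t in 𝓝 s ⊓ Filter.principal S, t ∈ S :=
        Filter.mem_inf_of_right (Filter.mem_principal_self S)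
      have c1 : ContinuousAt (fun t => deriv (deriv G) t * deriv P t -
          deriv G t * deriv (deriv P) t) s :=
        ((dG2 s hs).continuousAt.mul (dP1 s hs).continuousAt).sub
          ((dG1 s hs).continuousAt.mul (dP2 s hs).continuousAt)
      have c2 : ContinuousAt (fun t => (ν : ℝ) ^ 2 * deriv P t) s :=
        continuousAt_const.mul (dP1 s hs).continuousAt
      refine ⟨hs, ?_, ?_⟩
      · exact tendsto_nhds_unique_of_eventuallyEq (c1.mono_left inf_le_left)
          (c2.mono_left inf_le_left) (hSe.mono fun t ht => ht.2.1)
      · exact tendsto_nhds_unique_of_eventuallyEq ((dq s hs).continuousAt.mono_left inf_le_left)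
          tendsto_const_nhds (hSe.mono fun t ht => ht.2.2)
  exact ⟨ν, hν, fun s hs => ⟨hneg s hs (by rw [(hSI hs).2.2]; exact hq0), (hSI hs).2.1⟩⟩

/-- With one frequency `ν`, the identity `G'' P' - G' P'' = ν² P'` and its derivatives express the
jet of `G + k P` through `P` alone. Isochronicity then becomes `4 P''² = 3 P' P'''`, which says that
`(P')^(-1/3)` is affine. The solutions are explicit, and the frequency identity is a linear equation
for `G'`. -/
theorem exists_oscillator_of_isochronicity {I : Set ℝ} (hI : IsOpen I) (hIc : Convex ℝ I)
    {G P : ℝ → ℝ} (hG : ContDiffOn ℝ ∞ G I) (hP : ContDiffOn ℝ ∞ P I)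
    (hG' : ∀ s ∈ I, deriv G s ≠ 0)
    (hiso : ∀ s ∈ I, ∀ k : ℝ, 0 < k → deriv G s + k * deriv P s = 0 →
      0 < deriv (deriv G) s + k * deriv (deriv P) s →
        (∃ q : ℚ, 0 < q ∧ deriv (deriv G) s + k * deriv (deriv P) s = (q : ℝ) ^ 2) ∧
        5 * (deriv (deriv (deriv G)) s + k * deriv (deriv (deriv P)) s) ^ 2 =
          3 * (deriv (deriv G) s + k * deriv (deriv P) s) *
            (deriv (deriv (deriv (deriv G))) s + k * deriv (deriv (deriv (deriv P))) s))
    {s₀ k₀ : ℝ} (hs₀ : s₀ ∈ I) (hk₀ : 0 < k₀) (h1 : deriv G s₀ + k₀ * deriv P s₀ = 0)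
    (h2 : 0 < deriv (deriv G) s₀ + k₀ * deriv (deriv P) s₀)
    (htype : ∀ q : ℚ, 0 < q → ¬ ∀ s ∈ I, deriv (deriv G) s = (q : ℝ) ^ 2) :
    ∃ (ν : ℚ) (m C D A B : ℝ), 0 < ν ∧ D ≠ 0 ∧ ∀ s ∈ I, s - m ≠ 0 ∧
      G s = ν ^ 2 * (s - m) ^ 2 / 8 + C - D / (2 * (s - m) ^ 2) ∧
      P s = A / (2 * (s - m) ^ 2) + B ∧ 0 < A * (ν ^ 2 * (s - m) ^ 4 / 4 + D) := by
  obtain ⟨ν, hν, hrig⟩ := frequency_rigid hI hIc hG hP hG'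
    (fun s hs k hk h3 h4 => (hiso s hs k hk h3 h4).1) hs₀ hk₀ h1 h2
  have hνR : (0 : ℝ) < ν := by exact_mod_cast hν
  have hG1 := contDiffOn_deriv hG hI
  have hG2 := contDiffOn_deriv hG1 hI
  have hG3 := contDiffOn_deriv hG2 hI
  have hP1 := contDiffOn_deriv hP hI
  have hP2 := contDiffOn_deriv hP1 hI
  have hP3 := contDiffOn_deriv hP2 hI
  have dG := fun s hs => hasDerivAt_deriv_of_contDiffOn hG hI (r := s) hs
  have dG1 := fun s hs => hasDerivAt_deriv_of_contDiffOn hG1 hI (r := s) hs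
  have dG2 := fun s hs => hasDerivAt_deriv_of_contDiffOn hG2 hI (r := s) hs
  have dG3 := fun s hs => hasDerivAt_deriv_of_contDiffOn hG3 hI (r := s) hs
  have dP := fun s hs => hasDerivAt_deriv_of_contDiffOn hP hI (r := s) hs
  have dP1 := fun s hs => hasDerivAt_deriv_of_contDiffOn hP1 hI (r := s) hs
  have dP2 := fun s hs => hasDerivAt_deriv_of_contDiffOn hP2 hI (r := s) hs
  have dP3 := fun s hs => hasDerivAt_deriv_of_contDiffOn hP3 hI (r := s) hs
  set G₁ := deriv G
  set G₂ := deriv G₁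
  set G₃ := deriv G₂
  set G₄ := deriv G₃
  set P₁ := deriv P
  set P₂ := deriv P₁
  set P₃ := deriv P₂
  set P₄ := deriv P₃
  have hPne : ∀ s ∈ I, P₁ s ≠ 0 := fun s hs => right_ne_zero_of_mul (hrig s hs).1.ne
  have hzero : ∀ {g : ℝ → ℝ} {g' s : ℝ}, s ∈ I → (∀ t ∈ I, g t = 0) → HasDerivAt g g' s → g' = 0 :=
    fun {g g' s} hs h0 hd => by
      refine hd.unique ((hasDerivAt_const s (0 : ℝ)).congr_of_eventuallyEq ?_)
      filter_upwards [hI.mem_nhds hs] with t ht using h0 t ht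
  have E0 : ∀ s ∈ I, G₂ s * P₁ s - G₁ s * P₂ s - ν ^ 2 * P₁ s = 0 := fun s hs => by
    linarith [(hrig s hs).2]
  have E1 : ∀ s ∈ I, G₃ s * P₁ s - G₁ s * P₃ s - ν ^ 2 * P₂ s = 0 := fun s hs => by
    have := hzero hs E0 ((((dG2 s hs).mul (dP1 s hs)).sub ((dG1 s hs).mul (dP2 s hs))).sub
      ((dP1 s hs).const_mul _))
    linarith
  have E2 : ∀ s ∈ I, G₄ s * P₁ s + G₃ s * P₂ s - G₂ s * P₃ s - G₁ s * P₄ s - ν ^ 2 * P₃ s = 0 :=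
    fun s hs => by
      have := hzero hs E1 ((((dG3 s hs).mul (dP1 s hs)).sub ((dG1 s hs).mul (dP3 s hs))).sub
        ((dP2 s hs).const_mul _))
      linarith
  -- Here `k = -G' / P'`; the relations `E0`, `E1`, `E2` remove `G` from the isochronicity
  -- condition.
  have E3 : ∀ s ∈ I, 4 * P₂ s ^ 2 = 3 * (P₁ s * P₃ s) := fun s hs => by
    have hp := hPne s hs
    have hk : 0 < -(G₁ s / P₁ s) := by
      have : -(G₁ s / P₁ s) = -(G₁ s * P₁ s) / P₁ s ^ 2 := by field_simp
      rw [this]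
      have := (hrig s hs).1
      exact div_pos (by linarith) (by positivity)
    have w2 : G₂ s + -(G₁ s / P₁ s) * P₂ s = ν ^ 2 := by
      field_simp; linarith [E0 s hs]
    have w3 : G₃ s + -(G₁ s / P₁ s) * P₃ s = ν ^ 2 * P₂ s / P₁ s := by
      field_simp; linarith [E1 s hs]
    have w4 : G₄ s + -(G₁ s / P₁ s) * P₄ s =
        ν ^ 2 * (2 * P₁ s * P₃ s - P₂ s ^ 2) / P₁ s ^ 2 := by
      field_simp
      linear_combination P₁ s * E2 s hs + P₃ s * E0 s hs - P₂ s * E1 s hs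
    have h3 := (hiso s hs _ hk (by field_simp; ring) (by rw [w2]; positivity)).2
    rw [w2, w3, w4] at h3
    field_simp at h3
    linarith
  -- A first integral of `E3`: it shows that `P''` vanishes everywhere or nowhere.
  obtain ⟨c₀, hc₀⟩ : ∃ c₀, ∀ s ∈ I, P₂ s ^ 3 / P₁ s ^ 4 = c₀ := by
    refine ⟨P₂ s₀ ^ 3 / P₁ s₀ ^ 4, fun s hs => eq_of_hasDerivAt_zero hIc
      (g := fun s => P₂ s ^ 3 / P₁ s ^ 4) (fun s hs => ?_) hs hs₀⟩
    have hp := hPne s hs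
    have := ((dP2 s hs).pow 3).div ((dP1 s hs).pow 4) (pow_ne_zero 4 hp)
    convert! this using 1
    simp only [Pi.pow_apply]
    push_cast
    field_simp
    linear_combination P₂ s ^ 2 * E3 s hs
  -- If `P''` vanishes identically, the frequency identity reads `G'' = ν²`, which is excluded.
  have hP2ne : ∀ s ∈ I, P₂ s ≠ 0 := by
    intro s hs h0
    refine htype ν hν fun t ht => ?_
    have h3 := hc₀ t ht
    rw [← hc₀ s hs, h0] at h3
    have hp := hPne t ht
    have h4 : P₂ t = 0 := by
      rw [zero_pow three_ne_zero, zero_div, div_eq_zero_iff] at h3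
      exact pow_eq_zero_iff three_ne_zero |>.1 (h3.resolve_right (pow_ne_zero 4 hp))
    have h5 := E0 t ht
    rw [h4] at h5
    exact mul_right_cancel₀ hp (by linarith)
  obtain ⟨m, hm⟩ : ∃ m, ∀ s ∈ I, -3 * P₁ s / P₂ s = s + m := by
    refine exists_eq_add_const hIc (g' := fun _ => 1) (fun s hs => ?_) fun s _ => hasDerivAt_id s
    have hp := hP2ne s hs
    have := ((dP1 s hs).const_mul (-3)).div (dP2 s hs) hp
    convert! this using 1
    field_simp
    linear_combination E3 s hs
  have hP12 : ∀ s ∈ I, P₂ s * (s + m) = -3 * P₁ s := fun s hs => by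
    have := hP2ne s hs
    rw [← hm s hs]; field_simp
  have hY : ∀ s ∈ I, s + m ≠ 0 := fun s hs h0 => by
    have := hP12 s hs
    rw [h0, mul_zero] at this
    exact hPne s hs (by linarith)
  have dY : ∀ s : ℝ, HasDerivAt (fun s => s + m) 1 s := fun s => (hasDerivAt_id s).add_const m
  obtain ⟨A, hA⟩ : ∃ A, ∀ s ∈ I, P₁ s * (s + m) ^ 3 = -A := by
    refine ⟨-(P₁ s₀ * (s₀ + m) ^ 3), fun s hs => ?_⟩
    rw [neg_neg]
    refine eq_of_hasDerivAt_zero hIc (g := fun s => P₁ s * (s + m) ^ 3) (fun s hs => ?_) hs hs₀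
    have := (dP1 s hs).mul ((dY s).pow 3)
    convert! this using 1
    simp only [Pi.pow_apply]
    push_cast
    linear_combination -(s + m) ^ 2 * hP12 s hs
  obtain ⟨D, hD⟩ : ∃ D, ∀ s ∈ I, G₁ s * (s + m) ^ 3 - ν ^ 2 * (s + m) ^ 4 / 4 = D := by
    refine ⟨G₁ s₀ * (s₀ + m) ^ 3 - ν ^ 2 * (s₀ + m) ^ 4 / 4, fun s hs => eq_of_hasDerivAt_zero hIc
      (g := fun s => G₁ s * (s + m) ^ 3 - ν ^ 2 * (s + m) ^ 4 / 4) (fun s hs => ?_) hs hs₀⟩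
    have := ((dG1 s hs).mul ((dY s).pow 3)).sub ((((dY s).pow 4).const_mul ((ν : ℝ) ^ 2)).div_const 4)
    convert! this using 1
    simp only [Pi.pow_apply]
    push_cast
    refine mul_right_cancel₀ (hPne s hs) ?_
    linear_combination (-(s + m) ^ 3) * E0 s hs - G₁ s * (s + m) ^ 2 * hP12 s hs
  have hG1eq : ∀ s ∈ I, G₁ s = ν ^ 2 * (s + m) / 4 + D / (s + m) ^ 3 := fun s hs => by
    have := hY s hs
    rw [← hD s hs]; field_simp; ring
  have hP1eq : ∀ s ∈ I, P₁ s = -A / (s + m) ^ 3 := fun s hs => by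
    have := hY s hs
    rw [← hA s hs]; field_simp
  -- For `D = 0` one has `G'' = ν² / 4 = (ν / 2)²`, again excluded.
  have hDne : D ≠ 0 := by
    rintro rfl
    refine htype (ν / 2) (by positivity) fun s hs => ?_
    have := hzero hs (g := fun s => G₁ s - ν ^ 2 * (s + m) / 4)
      (fun t ht => by rw [hG1eq t ht]; ring)
      ((dG1 s hs).sub (((dY s).const_mul ((ν : ℝ) ^ 2)).div_const 4))
    push_cast
    linarith
  have dI : ∀ s ∈ I, HasDerivAt (fun s => 1 / (2 * (s + m) ^ 2)) (-1 / (s + m) ^ 3) s :=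
    fun s hs => by
      have h3 := hY s hs
      have := (hasDerivAt_const s (1 : ℝ)).div (((dY s).pow 2).const_mul 2)
        (mul_ne_zero two_ne_zero (pow_ne_zero 2 h3))
      convert! this using 1
      simp only [Pi.pow_apply]
      push_cast
      field_simp
      ring
  obtain ⟨C, hC⟩ := exists_eq_add_const hIc (g := G)
    (h := fun s => ν ^ 2 * (s + m) ^ 2 / 8 - D * (1 / (2 * (s + m) ^ 2))) dG (fun s hs => by
      have := ((((dY s).pow 2).const_mul ((ν : ℝ) ^ 2)).div_const 8).sub ((dI s hs).const_mul D)
      convert! this using 1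
      rw [hG1eq s hs]
      push_cast
      ring)
  obtain ⟨B, hB⟩ := exists_eq_add_const hIc (g := P)
    (h := fun s => A * (1 / (2 * (s + m) ^ 2))) dP (fun s hs => by
      convert! (dI s hs).const_mul A using 1
      rw [hP1eq s hs]
      ring)
  refine ⟨ν, -m, C, D, A, B, hν, hDne, fun s hs => ?_⟩
  rw [sub_neg_eq_add]
  have h3 := hY s hs
  refine ⟨h3, by rw [hC s hs]; ring, by rw [hB s hs]; ring, ?_⟩
  have h4 := (hrig s hs).1
  rw [hG1eq s hs, hP1eq s hs] at h4
  have h5 : A * (ν ^ 2 * (s + m) ^ 4 / 4 + D) = -((ν ^ 2 * (s + m) / 4 + D / (s + m) ^ 3) *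
      (-A / (s + m) ^ 3)) * (s + m) ^ 6 := by field_simp
  rw [h5]
  exact mul_pos (by linarith) (by positivity)

theorem deriv_eqOn_add_mul {I : Set ℝ} (hI : IsOpen I) {F G P : ℝ → ℝ} {k : ℝ}
    (hG : ContDiffOn ℝ ∞ G I) (hP : ContDiffOn ℝ ∞ P I)
    (h : Set.EqOn F (fun s => G s + k * P s) I) :
    Set.EqOn (deriv F) (fun s => deriv G s + k * deriv P s) I := fun s hs => by
  have h1 := (hasDerivAt_deriv_of_contDiffOn hG hI hs).add
    ((hasDerivAt_deriv_of_contDiffOn hP hI hs).const_mul k)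
  refine (h1.congr_of_eventuallyEq ?_).deriv
  filter_upwards [hI.mem_nhds hs] with t ht using h ht

/-! ### From the chart back to the surface: the normal form -/

namespace IsClairautChart

theorem contDiffOn (h : IsClairautChart a b f y η) : ContDiffOn ℝ ∞ y (interval a b) := by
  refine (contDiffOn_infty_iff_deriv_of_isOpen (isOpen_interval a b)).2 ⟨fun r hr =>
    (h.hasDerivAt r hr).differentiableAt.differentiableWithinAt, ?_⟩
  refine ContDiffOn.congr (f := fun r => 1 / f r ^ 2) ?_ fun r hr => (h.hasDerivAt r hr).deriv
  exact contDiffOn_const.div (h.smooth.pow 2) fun r hr => (pow_pos (h.pos r hr) 2).ne'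

theorem centrifugal_contDiffOn (h : IsClairautChart a b f y η) :
    ContDiffOn ℝ ∞ (fun s => 1 / (2 * f (η s) ^ 2)) (y '' interval a b) :=
  contDiffOn_const.div (contDiffOn_const.mul ((h.smooth.comp h.inv_contDiffOn
    fun _ hs => h.mem hs).pow 2)) fun s hs => by have := h.pos _ (h.mem hs); positivity

theorem centrifugal_hasDerivAt (h : IsClairautChart a b f y η) {s : ℝ}
    (hs : s ∈ y '' interval a b) :
    HasDerivAt (fun s => 1 / (2 * f (η s) ^ 2)) (-(deriv f (η s) / f (η s))) s := by
  have hp := h.pos _ (h.mem hs)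
  have h1 := (hasDerivAt_const s (1 : ℝ)).div ((((h.f_hasDerivAt (h.mem hs)).comp s
    (h.inv_hasDerivAt hs)).pow 2).const_mul 2)
    (by simp only [Pi.pow_apply, Function.comp_apply]; positivity)
  convert! h1 using 1
  simp only [Pi.pow_apply, Function.comp_apply]
  push_cast
  field_simp
  ring

/-- This translates the excluded identity: `f'' f - f'² = -ξ²` on the surface means that the
centrifugal term has constant second derivative `ξ²` in the chart. -/
theorem deriv_deriv_centrifugal (h : IsClairautChart a b f y η) {s : ℝ}
    (hs : s ∈ y '' interval a b) :
    deriv (deriv fun s => 1 / (2 * f (η s) ^ 2)) s =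
      -(deriv (deriv f) (η s) * f (η s) - deriv f (η s) ^ 2) := by
  have hp := h.pos _ (h.mem hs)
  have hη := h.inv_hasDerivAt hs
  have h1 := ((hasDerivAt_deriv_of_contDiffOn (contDiffOn_deriv h.smooth (isOpen_interval a b))
    (isOpen_interval a b) (h.mem hs)).comp s hη).div ((h.f_hasDerivAt (h.mem hs)).comp s hη)
    (by simp only [Function.comp_apply]; exact hp.ne')
  have h2 := h1.neg.congr_of_eventuallyEq (f₁ := deriv fun s => 1 / (2 * f (η s) ^ 2)) (by
    filter_upwards [h.isOpen_image.mem_nhds hs] with t ht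
    exact (h.centrifugal_hasDerivAt ht).deriv)
  rw [h2.deriv]
  simp only [Function.comp_apply]
  field_simp

/-- A locally closing potential is an oscillator potential in the chart. -/
theorem exists_oscillator (h : IsClairautChart a b f y η)
    (hcrit : ∀ r ∈ interval a b, deriv f r ≠ 0)
    (htype : ∀ ξ : ℚ, 0 < ξ → ¬ ∀ r ∈ interval a b,
      deriv (deriv f) r * f r - deriv f r ^ 2 = -(ξ : ℝ) ^ 2)
    (hV : ContDiffOn ℝ ∞ V (interval a b)) (hcl : ClosingCondition a b f V .locally) :
    ∃ (ν : ℚ) (m C D A B : ℝ), 0 < ν ∧ D ≠ 0 ∧ ∀ r ∈ interval a b, y r - m ≠ 0 ∧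
      1 / (2 * f r ^ 2) = ν ^ 2 * (y r - m) ^ 2 / 8 + C - D / (2 * (y r - m) ^ 2) ∧
      V r = A / (2 * (y r - m) ^ 2) + B ∧ 0 < A * (ν ^ 2 * (y r - m) ^ 4 / 4 + D) := by
  obtain ⟨⟨r₀, K₀, hst⟩, hloc⟩ := hcl
  have hI := h.isOpen_image
  have hG := h.centrifugal_contDiffOn
  have hP : ContDiffOn ℝ ∞ (fun s => V (η s)) (y '' interval a b) :=
    hV.comp h.inv_contDiffOn fun _ hs => h.mem hs
  set G : ℝ → ℝ := fun s => 1 / (2 * f (η s) ^ 2) with hGd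
  set P : ℝ → ℝ := fun s => V (η s) with hPd
  have key : ∀ K : ℝ, K ≠ 0 →
      Set.EqOn (reducedPotential f V η K) (fun s => G s + 1 / K ^ 2 * P s) (y '' interval a b) :=
    fun K hK s hs => by
      have := h.pos _ (h.mem hs)
      simp only [reducedPotential, effectivePotential, hGd, hPd]
      field_simp
      ring
  have hG1 := contDiffOn_deriv hG hI
  have hP1 := contDiffOn_deriv hP hI
  have hG2 := contDiffOn_deriv hG1 hI
  have hP2 := contDiffOn_deriv hP1 hI
  have hG3 := contDiffOn_deriv hG2 hI
  have hP3 := contDiffOn_deriv hP2 hI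
  have k1 := fun K hK => deriv_eqOn_add_mul hI hG hP (key K hK)
  have k2 := fun K hK => deriv_eqOn_add_mul hI hG1 hP1 (k1 K hK)
  have k3 := fun K hK => deriv_eqOn_add_mul hI hG2 hP2 (k2 K hK)
  have k4 := fun K hK => deriv_eqOn_add_mul hI hG3 hP3 (k3 K hK)
  obtain ⟨hr₀, hK₀, -⟩ := (isStronglyStable_iff h.smooth h.pos hV).1 hst
  have hs₀ : y r₀ ∈ y '' interval a b := ⟨r₀, hr₀, rfl⟩
  have hst' := (h.isStronglyStable_iff_reduced hV hr₀ hK₀).1 hst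
  rw [k1 K₀ hK₀ hs₀, k2 K₀ hK₀ hs₀] at hst'
  have hG' : ∀ s ∈ y '' interval a b, deriv G s ≠ 0 := fun s hs => by
    rw [(h.centrifugal_hasDerivAt hs).deriv]
    exact neg_ne_zero.2 (div_ne_zero (hcrit _ (h.mem hs)) (h.pos _ (h.mem hs)).ne')
  have htype' : ∀ q : ℚ, 0 < q → ¬ ∀ s ∈ y '' interval a b, deriv (deriv G) s = (q : ℝ) ^ 2 :=
    fun q hq hall => htype q hq fun r hr => by
      have h1 := hall (y r) ⟨r, hr, rfl⟩
      rw [h.deriv_deriv_centrifugal ⟨r, hr, rfl⟩, h.left_inv r hr] at h1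
      linarith
  obtain ⟨ν, m, C, D, A, B, hν, hD, hall⟩ := exists_oscillator_of_isochronicity hI h.convex_image
    hG hP hG' (by
      rintro _ ⟨r, hr, rfl⟩ k hk h1 h2
      have hs : y r ∈ y '' interval a b := ⟨r, hr, rfl⟩
      -- The coefficient `k` in `G + k P` is `1 / K²`, so every positive `k` comes from an angular
      -- momentum.
      set K := √(1 / k) with hKd
      have hK2 : K ^ 2 = 1 / k := Real.sq_sqrt (by positivity)
      have hK : K ≠ 0 := fun h0 => by
        rw [h0, zero_pow two_ne_zero] at hK2
        have : 0 < 1 / k := by positivity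
        linarith
      have hkK : k = 1 / K ^ 2 := by rw [hK2, one_div_one_div]
      rw [hkK] at h1 h2 ⊢
      have h3 := (h.isStronglyStable_iff_reduced hV hr hK).2
        ⟨by rw [k1 K hK hs]; exact h1, by rw [k2 K hK hs]; exact h2⟩
      have h4 := h.isochronicity_of_closesNear hV h3 (hloc r K h3)
      rwa [k2 K hK hs, k3 K hK hs, k4 K hK hs] at h4)
    hs₀ (k₀ := 1 / K₀ ^ 2) (by positivity) hst'.1 hst'.2 htype'
  refine ⟨ν, m, C, D, A, B, hν, hD, fun r hr => ?_⟩
  have := hall (y r) ⟨r, hr, rfl⟩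
  simpa only [hGd, hPd, h.left_inv r hr] using this

end IsClairautChart

/-- A locally closing potential exists only on surfaces with the normal form, and it is an
oscillator potential. -/
theorem exists_hasNormalForm (hf : ContDiffOn ℝ ∞ f (interval a b))
    (hpos : ∀ r ∈ interval a b, 0 < f r) (hcrit : ∀ r ∈ interval a b, deriv f r ≠ 0)
    (htype : ∀ ξ : ℚ, 0 < ξ → ¬ ∀ r ∈ interval a b,
      deriv (deriv f) r * f r - deriv f r ^ 2 = -(ξ : ℝ) ^ 2)
    (hV : ContDiffOn ℝ ∞ V (interval a b)) (hcl : ClosingCondition a b f V .locally) :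
    ∃ (θ : ℝ → ℝ) (μ : ℚ) (c d A B : ℝ), HasNormalForm a b f θ μ c d ∧
      (∀ r ∈ interval a b, 0 < A * (θ r ^ 4 + d)) ∧
      ∀ r ∈ interval a b, V r = A / (2 * θ r ^ 2) + B := by
  obtain ⟨y, η, h⟩ := exists_isClairautChart hf hpos
  obtain ⟨ν, m, C, D, A, B, hν, hD, hall⟩ := h.exists_oscillator hcrit htype hV hcl
  have hνR : (0 : ℝ) < ν := by exact_mod_cast hν
  have hdθ : ∀ r ∈ interval a b, HasDerivAt (fun r => (ν : ℝ) ^ 2 / 4 * (y r - m))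
      (ν ^ 2 / 4 * (1 / f r ^ 2)) r := fun r hr => ((h.hasDerivAt r hr).sub_const m).const_mul _
  have hQ : ∀ r ∈ interval a b, Q (ν ^ 2 / 2 * C) (ν ^ 6 / 64 * D) (ν ^ 2 / 4 * (y r - m)) =
      ν ^ 2 / 4 * (1 / f r ^ 2) := fun r hr => by
    obtain ⟨hY, hG, -, -⟩ := hall r hr
    have := hpos r hr
    have h1 : 1 / f r ^ 2 = 2 * (1 / (2 * f r ^ 2)) := by field_simp
    rw [h1, hG, Q]
    field_simp
    ring
  -- For `θ = λ (y - m)` one needs `θ' = λ / f² = Q(θ)`; the leading coefficient `1` of `Q` forces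
  -- `λ = ν² / 4`, and `f² = 1 / (μ² Q)` forces `μ² = 1 / λ`.
  refine ⟨fun r => ν ^ 2 / 4 * (y r - m), 2 / ν, ν ^ 2 / 2 * C, ν ^ 6 / 64 * D, ν ^ 4 / 16 * A, B,
    ⟨by positivity, by positivity, contDiffOn_const.mul (h.contDiffOn.sub contDiffOn_const),
      fun r hr => mul_ne_zero (by positivity) (hall r hr).1, fun r hr => ?_, fun r hr u v => ?_⟩,
    fun r hr => ?_, fun r hr => ?_⟩
  · have := hpos r hr
    rw [(hdθ r hr).deriv]; positivity
  · have := hpos r hr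
    rw [(hdθ r hr).deriv, normalFormMetric, hQ r hr, revolutionMetric]
    push_cast
    field_simp
    ring
  · have := (hall r hr).2.2.2
    have h1 : ν ^ 4 / 16 * A * ((ν ^ 2 / 4 * (y r - m)) ^ 4 + ν ^ 6 / 64 * D) =
        ν ^ 10 / 1024 * (A * (ν ^ 2 * (y r - m) ^ 4 / 4 + D)) := by ring
    rw [h1]; positivity
  · have hY := (hall r hr).1
    rw [(hall r hr).2.2.1]
    field_simp
    ring

/-! ### Oscillator potentials on a surface in normal form -/

theorem mul_pos_of_ne_zero {I : Set ℝ} (hI : IsPreconnected I) {g : ℝ → ℝ}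
    (hg : ContinuousOn g I) (h0 : ∀ s ∈ I, g s ≠ 0) {s t : ℝ} (hs : s ∈ I) (ht : t ∈ I) :
    0 < g s * g t := by
  by_contra! hle
  have hst : (0 : ℝ) ∈ Set.uIcc (g s) (g t) := by
    rcases mul_nonpos_iff.1 hle with ⟨h1, h2⟩ | ⟨h1, h2⟩
    · exact Set.mem_uIcc.2 (Or.inr ⟨h2, h1⟩)
    · exact Set.mem_uIcc.2 (Or.inl ⟨h1, h2⟩)
  obtain ⟨z, hz, hz0⟩ := (hI.image g hg).ordConnected.uIcc_subset ⟨s, hs, rfl⟩ ⟨t, ht, rfl⟩ hst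
  exact h0 z hz hz0

/-- Solutions of the equation of the harmonic oscillator. -/
theorem eq_cos_add_sin {κ : ℝ} (hκ : κ ≠ 0) {w z : ℝ → ℝ} (hw : ∀ s, HasDerivAt w (z s) s)
    (hz : ∀ s, HasDerivAt z (-(κ ^ 2 * w s)) s) (s : ℝ) :
    w s = w 0 * Real.cos (κ * s) + z 0 / κ * Real.sin (κ * s) := by
  have hd : ∀ s, HasDerivAt (fun s => κ * s) κ s := fun s => by
    simpa using (hasDerivAt_id s).const_mul κ
  have h1 := eq_of_hasDerivAt_zero convex_univ
    (g := fun s => w s * Real.cos (κ * s) - z s / κ * Real.sin (κ * s)) (fun s _ => by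
      have := ((hw s).mul (hd s).cos).sub (((hz s).div_const κ).mul (hd s).sin)
      convert! this using 1
      field_simp
      ring) (Set.mem_univ s) (Set.mem_univ 0)
  have h2 := eq_of_hasDerivAt_zero convex_univ
    (g := fun s => w s * Real.sin (κ * s) + z s / κ * Real.cos (κ * s)) (fun s _ => by
      have := ((hw s).mul (hd s).sin).add (((hz s).div_const κ).mul (hd s).cos)
      convert! this using 1
      field_simp
      ring) (Set.mem_univ s) (Set.mem_univ 0)
  simp only [mul_zero, Real.cos_zero, Real.sin_zero, mul_one, sub_zero, zero_add] at h1 h2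
  linear_combination Real.cos (κ * s) * h1 + Real.sin (κ * s) * h2 -
    w s * Real.sin_sq_add_cos_sq (κ * s)

/-- A period of a nontrivial harmonic oscillation is a multiple of the basic one. -/
theorem two_pi_div_le_of_periodic {κ p q T : ℝ} (hκ : 0 < κ) (hT : 0 < T)
    (hpq : p ≠ 0 ∨ q ≠ 0)
    (h : ∀ s, p * Real.cos (κ * (s + T)) + q * Real.sin (κ * (s + T)) =
      p * Real.cos (κ * s) + q * Real.sin (κ * s)) : 2 * Real.pi / κ ≤ T := by
  have h1 := h 0
  -- Two phases a quarter turn apart give two linear relations, which combine to `(p² + q²) (1 - cos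
  -- (κ T)) = 0`.
  have h2 := h (Real.pi / 2 / κ)
  rw [mul_add, show κ * (Real.pi / 2 / κ) = Real.pi / 2 by field_simp, add_comm (Real.pi / 2),
    Real.cos_add_pi_div_two, Real.sin_add_pi_div_two, Real.cos_pi_div_two,
    Real.sin_pi_div_two] at h2
  simp only [zero_add, mul_zero, Real.cos_zero, Real.sin_zero, mul_one] at h1 h2
  have h3 : (p ^ 2 + q ^ 2) * (1 - Real.cos (κ * T)) = 0 := by
    linear_combination (-p) * h1 - q * h2
  have h4 : p ^ 2 + q ^ 2 ≠ 0 := by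
    rcases hpq with h | h
    · positivity
    · positivity
  have h5 : Real.cos (κ * T) = 1 := by linarith [(mul_eq_zero.1 h3).resolve_left h4]
  obtain ⟨k, hk⟩ := (Real.cos_eq_one_iff _).1 h5
  have hκT : 0 < κ * T := by positivity
  have hk0 : 0 < (k : ℝ) := by
    rw [← hk] at hκT
    exact pos_of_mul_pos_left hκT (by positivity)
  have hk1 : (1 : ℝ) ≤ k := by exact_mod_cast hk0
  rw [div_le_iff₀ hκ, mul_comm T, ← hk]
  nlinarith [Real.pi_pos]

namespace HasNormalForm

variable {θ : ℝ → ℝ} {μ : ℚ} {c d A B : ℝ}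

/-- Evaluating the metric on `∂_φ` gives `Q`, and on `∂_r` gives `θ'² = Q²`; both are positive, so
`θ' = Q`. A zero of `Q` is impossible because division by zero would give `1 = 0`. In consequence
`μ² θ` is a Clairaut coordinate. -/
theorem Q_eq (h : HasNormalForm a b f θ μ c d) (hpos : ∀ r ∈ interval a b, 0 < f r) {r : ℝ}
    (hr : r ∈ interval a b) :
    Q c d (θ r) = 1 / (μ ^ 2 * f r ^ 2) ∧ HasDerivAt θ (1 / (μ ^ 2 * f r ^ 2)) r := by
  have hf := hpos r hr
  have hθ := h.deriv_pos r hr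
  have hμ : (0 : ℝ) < μ := by exact_mod_cast h.mu_pos
  have h1 := h.metric_eq r hr 1 0
  have h2 := h.metric_eq r hr 0 1
  simp only [revolutionMetric, normalFormMetric, one_pow, mul_one, mul_zero, add_zero, ne_eq,
    OfNat.ofNat_ne_zero, not_false_eq_true, zero_pow, zero_div, zero_add] at h1 h2
  have hQne : Q c d (θ r) ≠ 0 := fun h0 => by
    rw [h0] at h1; norm_num at h1
  have hQ : Q c d (θ r) = 1 / (μ ^ 2 * f r ^ 2) := by rw [h2]; field_simp
  refine ⟨hQ, ?_⟩
  have hQpos : 0 < Q c d (θ r) := by rw [hQ]; positivity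
  have h3 : deriv θ r = Q c d (θ r) := by
    rw [eq_div_iff (pow_ne_zero 2 hQne), one_mul] at h1
    exact ((pow_left_inj₀ hQpos.le hθ.le two_ne_zero).1 h1).symm
  rw [← hQ, ← h3]
  exact hasDerivAt_deriv_of_contDiffOn h.smooth (isOpen_interval a b) hr

theorem strictMonoOn (h : HasNormalForm a b f θ μ c d) : StrictMonoOn θ (interval a b) :=
  strictMonoOn_of_hasDerivAt_pos (fun _ hr =>
    hasDerivAt_deriv_of_contDiffOn h.smooth (isOpen_interval a b) hr) h.deriv_pos

theorem theta_mul_pos (h : HasNormalForm a b f θ μ c d) {r s : ℝ} (hr : r ∈ interval a b)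
    (hs : s ∈ interval a b) : 0 < θ r * θ s :=
  mul_pos_of_ne_zero (convex_interval a b).isPreconnected h.smooth.continuousOn h.ne_zero hr hs

theorem eq_of_sq_eq (h : HasNormalForm a b f θ μ c d) {r s : ℝ} (hr : r ∈ interval a b)
    (hs : s ∈ interval a b) (heq : θ r ^ 2 = θ s ^ 2) : r = s := by
  refine h.strictMonoOn.injOn hr hs ?_
  have h1 := h.theta_mul_pos hr hs
  rcases sq_eq_sq_iff_eq_or_eq_neg.1 heq with h2 | h2
  · exact h2
  · rw [h2] at h1
    nlinarith [sq_nonneg (θ s)]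

theorem exists_isClairautChart (h : HasNormalForm a b f θ μ c d)
    (hf : ContDiffOn ℝ ∞ f (interval a b)) (hpos : ∀ r ∈ interval a b, 0 < f r) :
    ∃ η, IsClairautChart a b f (fun r => μ ^ 2 * θ r) η :=
  exists_isClairautChart_of_hasDerivAt hf hpos fun r hr => by
    have hμ : (0 : ℝ) < μ := by exact_mod_cast h.mu_pos
    have := hpos r hr
    convert! (h.Q_eq hpos hr).2.const_mul ((μ : ℝ) ^ 2) using 1
    field_simp

/-- Obtained by differentiating `Q(θ) = 1 / (μ² f²)`. The critical points of `f` are therefore the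
zeros of `θ⁴ + d`. -/
theorem deriv_f (h : HasNormalForm a b f θ μ c d) (hf : ContDiffOn ℝ ∞ f (interval a b))
    (hpos : ∀ r ∈ interval a b, 0 < f r) {r : ℝ} (hr : r ∈ interval a b) :
    deriv f r = -(f r * (θ r ^ 4 + d) / θ r ^ 3) := by
  have hμ : (0 : ℝ) < μ := by exact_mod_cast h.mu_pos
  have hfr := hpos r hr
  have hθ := h.ne_zero r hr
  obtain ⟨hQ, hdθ⟩ := h.Q_eq hpos hr
  have hdf := hasDerivAt_deriv_of_contDiffOn hf (isOpen_interval a b) hr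
  have h1 := (((hdθ.pow 2).add_const c).sub ((hasDerivAt_const r d).div (hdθ.pow 2)
    (pow_ne_zero 2 hθ)))
  have h2 := (hasDerivAt_const r (1 : ℝ)).div ((hdf.pow 2).const_mul ((μ : ℝ) ^ 2))
    (by simp only [Pi.pow_apply]; positivity)
  have h3 := h1.unique (h2.congr_of_eventuallyEq (by
    filter_upwards [(isOpen_interval a b).mem_nhds hr] with s hs
    exact (h.Q_eq hpos hs).1))
  simp only [Pi.pow_apply] at h3
  push_cast at h3
  field_simp at h3
  field_simp
  linarith

theorem theta_pow_ne (h : HasNormalForm a b f θ μ c d) (hf : ContDiffOn ℝ ∞ f (interval a b))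
    (hpos : ∀ r ∈ interval a b, 0 < f r) (hcrit : ∀ r ∈ interval a b, deriv f r ≠ 0) {r : ℝ}
    (hr : r ∈ interval a b) : θ r ^ 4 + d ≠ 0 := fun h0 => hcrit r hr (by
  rw [h.deriv_f hf hpos hr, h0]; simp)

/-- As `f` has no critical points, `θ⁴ + d` keeps its sign, and its value at any one point serves as
`A`. -/
theorem exists_sign (h : HasNormalForm a b f θ μ c d) (hf : ContDiffOn ℝ ∞ f (interval a b))
    (hpos : ∀ r ∈ interval a b, 0 < f r) (hcrit : ∀ r ∈ interval a b, deriv f r ≠ 0)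
    (hab : a < b) : ∃ A : ℝ, ∀ r ∈ interval a b, 0 < A * (θ r ^ 4 + d) := by
  obtain ⟨r₀, hr₀⟩ := interval_nonempty hab
  exact ⟨θ r₀ ^ 4 + d, fun r hr => mul_pos_of_ne_zero (convex_interval a b).isPreconnected
    (g := fun r => θ r ^ 4 + d) ((h.smooth.continuousOn.pow 4).add continuousOn_const)
    (fun s hs => h.theta_pow_ne hf hpos hcrit hs) hr₀ hr⟩

theorem oscillator_contDiffOn (h : HasNormalForm a b f θ μ c d)
    (hVeq : ∀ r ∈ interval a b, V r = A / (2 * θ r ^ 2) + B) :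
    ContDiffOn ℝ ∞ V (interval a b) := by
  refine ContDiffOn.congr ?_ hVeq
  exact (contDiffOn_const.div (contDiffOn_const.mul (h.smooth.pow 2)) fun r hr =>
    mul_ne_zero two_ne_zero (pow_ne_zero 2 (h.ne_zero r hr))).add contDiffOn_const

theorem oscillator_hasDerivAt (h : HasNormalForm a b f θ μ c d)
    (hpos : ∀ r ∈ interval a b, 0 < f r)
    (hVeq : ∀ r ∈ interval a b, V r = A / (2 * θ r ^ 2) + B) {r : ℝ} (hr : r ∈ interval a b) :
    HasDerivAt V (-(A / (μ ^ 2 * f r ^ 2 * θ r ^ 3))) r := by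
  have hμ : (0 : ℝ) < μ := by exact_mod_cast h.mu_pos
  have hfr := hpos r hr
  have hθ := h.ne_zero r hr
  have h1 := ((hasDerivAt_const r A).div (((h.Q_eq hpos hr).2.pow 2).const_mul 2)
    (mul_ne_zero two_ne_zero (pow_ne_zero 2 hθ))).add_const B
  have h2 := h1.congr_of_eventuallyEq (f₁ := V) (by
    filter_upwards [(isOpen_interval a b).mem_nhds hr] with s hs using hVeq s hs)
  convert! h2 using 1
  simp only [Pi.pow_apply]
  push_cast
  field_simp
  ring

/-- Centrifugal and central force share the factor `1 / (f² θ³)`, so the equilibrium condition is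
linear in `K²`. -/
theorem effectivePotential_hasDerivAt (h : HasNormalForm a b f θ μ c d)
    (hf : ContDiffOn ℝ ∞ f (interval a b)) (hpos : ∀ r ∈ interval a b, 0 < f r)
    (hVeq : ∀ r ∈ interval a b, V r = A / (2 * θ r ^ 2) + B) (K : ℝ) {r : ℝ}
    (hr : r ∈ interval a b) :
    HasDerivAt (effectivePotential f V K)
      ((K ^ 2 * (θ r ^ 4 + d) - A / μ ^ 2) / (f r ^ 2 * θ r ^ 3)) r := by
  have hμ : (0 : ℝ) < μ := by exact_mod_cast h.mu_pos
  have hfr := hpos r hr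
  have hθ := h.ne_zero r hr
  have h1 := Bertrand.effectivePotential_hasDerivAt
    (hasDerivAt_deriv_of_contDiffOn hf (isOpen_interval a b) hr)
    (h.oscillator_hasDerivAt hpos hVeq hr) hfr K
  convert! h1 using 1
  rw [h.deriv_f hf hpos hr]
  field_simp
  ring

theorem isCircularOrbit_iff (h : HasNormalForm a b f θ μ c d)
    (hf : ContDiffOn ℝ ∞ f (interval a b)) (hpos : ∀ r ∈ interval a b, 0 < f r)
    (hA : ∀ r ∈ interval a b, 0 < A * (θ r ^ 4 + d))
    (hVeq : ∀ r ∈ interval a b, V r = A / (2 * θ r ^ 2) + B) {r : ℝ} (hr : r ∈ interval a b)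
    (K : ℝ) : IsCircularOrbit a b f V r K ↔ K ^ 2 * (θ r ^ 4 + d) = A / μ ^ 2 := by
  have hμ : (0 : ℝ) < μ := by exact_mod_cast h.mu_pos
  have hfr := hpos r hr
  have hθ := h.ne_zero r hr
  rw [Bertrand.isCircularOrbit_iff hf hpos (h.oscillator_contDiffOn hVeq),
    (h.effectivePotential_hasDerivAt hf hpos hVeq K hr).deriv]
  constructor
  · rintro ⟨-, -, h1⟩
    rcases div_eq_zero_iff.1 h1 with h2 | h2
    · linarith
    · exact absurd h2 (by positivity)
  · intro h1
    refine ⟨hr, ?_, by rw [h1, sub_self, zero_div]⟩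
    rintro rfl
    have h2 : A = 0 := by
      field_simp at h1
      linarith
    have := hA r hr
    rw [h2, zero_mul] at this
    exact this.false

theorem isCircularOrbit_iff_eq_or (h : HasNormalForm a b f θ μ c d)
    (hf : ContDiffOn ℝ ∞ f (interval a b)) (hpos : ∀ r ∈ interval a b, 0 < f r)
    (hA : ∀ r ∈ interval a b, 0 < A * (θ r ^ 4 + d))
    (hVeq : ∀ r ∈ interval a b, V r = A / (2 * θ r ^ 2) + B) {r : ℝ} (hr : r ∈ interval a b)
    (K : ℝ) : IsCircularOrbit a b f V r K ↔
      K = 1 / μ * √(A / (θ r ^ 4 + d)) ∨ K = -(1 / μ * √(A / (θ r ^ 4 + d))) := by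
  have hμ : (0 : ℝ) < μ := by exact_mod_cast h.mu_pos
  have h1 := hA r hr
  have hne : θ r ^ 4 + d ≠ 0 := right_ne_zero_of_mul h1.ne'
  have h2 : 0 ≤ A / (θ r ^ 4 + d) := by
    have : A / (θ r ^ 4 + d) = A * (θ r ^ 4 + d) / (θ r ^ 4 + d) ^ 2 := by field_simp
    rw [this]; positivity
  rw [h.isCircularOrbit_iff hf hpos hA hVeq hr, ← sq_eq_sq_iff_eq_or_eq_neg, mul_pow,
    Real.sq_sqrt h2]
  constructor
  · intro h3
    field_simp at h3 ⊢
    linarith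
  · intro h3
    rw [h3]
    field_simp

theorem exists_isStronglyStable (h : HasNormalForm a b f θ μ c d)
    (hf : ContDiffOn ℝ ∞ f (interval a b)) (hpos : ∀ r ∈ interval a b, 0 < f r)
    (hA : ∀ r ∈ interval a b, 0 < A * (θ r ^ 4 + d))
    (hVeq : ∀ r ∈ interval a b, V r = A / (2 * θ r ^ 2) + B) {r : ℝ} (hr : r ∈ interval a b) :
    ∃ K : ℝ, IsStronglyStable a b f V r K := by
  have hμ : (0 : ℝ) < μ := by exact_mod_cast h.mu_pos
  have hfr := hpos r hr
  have hθ := h.ne_zero r hr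
  have hV := h.oscillator_contDiffOn hVeq
  refine ⟨1 / μ * √(A / (θ r ^ 4 + d)), ?_⟩
  set K := 1 / μ * √(A / (θ r ^ 4 + d))
  have hc := (h.isCircularOrbit_iff_eq_or hf hpos hA hVeq hr K).2 (Or.inl rfl)
  obtain ⟨-, hK, h1⟩ := (Bertrand.isCircularOrbit_iff hf hpos hV).1 hc
  have h2 := (h.isCircularOrbit_iff hf hpos hA hVeq hr K).1 hc
  refine (isStronglyStable_iff hf hpos hV).2 ⟨hr, hK, h1, ?_⟩
  have hdθ := (h.Q_eq hpos hr).2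
  have hdf := hasDerivAt_deriv_of_contDiffOn hf (isOpen_interval a b) hr
  have h3 := ((((hdθ.pow 4).add_const d).const_mul (K ^ 2)).sub_const (A / (μ : ℝ) ^ 2)).div
    ((hdf.pow 2).mul (hdθ.pow 3)) (mul_ne_zero (pow_ne_zero 2 hfr.ne') (pow_ne_zero 3 hθ))
  have h4 := h3.congr_of_eventuallyEq (f₁ := deriv (effectivePotential f V K)) (by
    filter_upwards [(isOpen_interval a b).mem_nhds hr] with s hs
    exact (h.effectivePotential_hasDerivAt hf hpos hVeq K hs).deriv)
  rw [h4.deriv]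
  simp only [Pi.pow_apply, Pi.mul_apply, h2]
  -- At the equilibrium the numerator of the first derivative is `X - X = 0`, so only one term of
  -- the quotient rule survives. The value `4 K² / (μ² f⁴)` corresponds to the frequency `2 / μ` in
  -- the angle.
  have h5 : ∀ X Y : ℝ, (K ^ 2 * (((4 : ℕ) : ℝ) * θ r ^ (4 - 1) * (1 / (μ ^ 2 * f r ^ 2))) *
      (f r ^ 2 * θ r ^ 3) - (X - X) * Y) / (f r ^ 2 * θ r ^ 3) ^ 2 =
        4 * K ^ 2 / (μ ^ 2 * f r ^ 4) := fun X Y => by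
    push_cast; field_simp; ring
  rw [h5]
  positivity

/-- In the coordinate `θ` the nonsingular bounded orbits are `θ² = E + p cos (2φ/μ) + q sin (2φ/μ)`.
-/
theorem exists_theta_sq_eq (h : HasNormalForm a b f θ μ c d)
    (hf : ContDiffOn ℝ ∞ f (interval a b)) (hpos : ∀ r ∈ interval a b, 0 < f r)
    (hVeq : ∀ r ∈ interval a b, V r = A / (2 * θ r ^ 2) + B) {r φ τ : ℝ → ℝ} {K : ℝ}
    (hb : IsNonsingularBounded a b f V r φ K)
    (hτ : ∀ s, HasDerivAt τ (f (r (τ s)) ^ 2 / K) s) :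
    ∃ E p q : ℝ, ∀ s, θ (r (τ s)) ^ 2 =
      E + (p * Real.cos (2 / μ * s) + q * Real.sin (2 / μ * s)) := by
  have hμ : (0 : ℝ) < μ := by exact_mod_cast h.mu_pos
  have hV := h.oscillator_contDiffOn hVeq
  obtain ⟨η, hch⟩ := h.exists_isClairautChart hf hpos
  have hN := hb.isNewtonSolution hch hV hτ
  obtain ⟨⟨htr, -⟩, -, hK⟩ := hb
  have hr : ∀ t, r t ∈ interval a b := fun t => htr.mem t trivial
  have hθ : ∀ s, θ (r (τ s)) ≠ 0 := fun s => h.ne_zero _ (hr _)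
  set v : ℝ → ℝ := fun s => deriv r (τ s) / K
  -- The potential only shifts the constant `d` of the inverse-square term, so all momenta lead to
  -- the same type of equation.
  set e : ℝ := d - A / (μ ^ 2 * K ^ 2) with he
  have hdθ : ∀ s, HasDerivAt (fun s => θ (r (τ s))) (v s / μ ^ 2) s := fun s => by
    convert! (hN.hasDerivAt_pos s).div_const ((μ : ℝ) ^ 2) using 1
    funext s
    field_simp
  have hdv : ∀ s, HasDerivAt v (-(θ (r (τ s)) + e / θ (r (τ s)) ^ 3)) s := fun s => by
    convert! hN.hasDerivAt_vel s using 1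
    have hfr := hpos _ (hr (τ s))
    have := hθ s
    rw [(hch.reducedPotential_hasDerivAt hV K ⟨_, hr (τ s), rfl⟩).deriv,
      hch.left_inv _ (hr (τ s)), (h.effectivePotential_hasDerivAt hf hpos hVeq K (hr _)).deriv, he]
    field_simp
    ring
  have hE : ∀ s, v s ^ 2 / 2 + μ ^ 2 * (θ (r (τ s)) ^ 2 / 2 - e / (2 * θ (r (τ s)) ^ 2)) =
      v 0 ^ 2 / 2 + μ ^ 2 * (θ (r (τ 0)) ^ 2 / 2 - e / (2 * θ (r (τ 0)) ^ 2)) := fun s => by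
    refine eq_of_hasDerivAt_zero convex_univ (g := fun s => v s ^ 2 / 2 +
      μ ^ 2 * (θ (r (τ s)) ^ 2 / 2 - e / (2 * θ (r (τ s)) ^ 2))) (fun s _ => ?_)
      (Set.mem_univ s) (Set.mem_univ 0)
    have h0 := hθ s
    have := (((hdv s).pow 2).div_const 2).add (((((hdθ s).pow 2).div_const 2).sub
      ((hasDerivAt_const s e).div (((hdθ s).pow 2).const_mul 2)
        (mul_ne_zero two_ne_zero (pow_ne_zero 2 h0)))).const_mul ((μ : ℝ) ^ 2))
    convert! this using 1
    simp only [Pi.pow_apply]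
    push_cast
    field_simp
    ring
  -- With this energy, `θ² - E / μ²` satisfies the harmonic equation with frequency `2 / μ`: the
  -- inverse-square terms cancel in its second derivative.
  set E := v 0 ^ 2 / 2 + μ ^ 2 * (θ (r (τ 0)) ^ 2 / 2 - e / (2 * θ (r (τ 0)) ^ 2))
  have hw : ∀ s, HasDerivAt (fun s => θ (r (τ s)) ^ 2 - E / μ ^ 2)
      (2 * θ (r (τ s)) * v s / μ ^ 2) s := fun s => by
    convert! ((hdθ s).pow 2).sub_const (E / (μ : ℝ) ^ 2) using 1
    push_cast
    ring
  have hz : ∀ s, HasDerivAt (fun s => 2 * θ (r (τ s)) * v s / μ ^ 2)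
      (-((2 / μ : ℝ) ^ 2 * (θ (r (τ s)) ^ 2 - E / μ ^ 2))) s := fun s => by
    have h0 := hθ s
    convert! ((((hdθ s).const_mul 2).mul (hdv s)).div_const ((μ : ℝ) ^ 2)) using 1
    rw [← hE s]
    field_simp
    ring
  refine ⟨E / μ ^ 2, θ (r (τ 0)) ^ 2 - E / μ ^ 2, 2 * θ (r (τ 0)) * v 0 / μ ^ 2 / (2 / μ),
    fun s => ?_⟩
  rw [← eq_cos_add_sin (κ := 2 / μ) (by positivity) hw hz s]
  ring

theorem periodic_of_theta_sq (h : HasNormalForm a b f θ μ c d) {R : ℝ → ℝ}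
    (hR : ∀ s, R s ∈ interval a b) {E p q : ℝ} (hs : ∀ s, θ (R s) ^ 2 =
      E + (p * Real.cos (2 / μ * s) + q * Real.sin (2 / μ * s))) :
    Function.Periodic R (Real.pi * μ) := fun s => by
  have hμ : (0 : ℝ) < μ := by exact_mod_cast h.mu_pos
  refine h.eq_of_sq_eq (hR _) (hR _) ?_
  rw [hs, hs, show 2 / (μ : ℝ) * (s + Real.pi * μ) = 2 / μ * s + 2 * Real.pi by field_simp,
    Real.cos_add_two_pi, Real.sin_add_two_pi]

theorem isClosedOrbit (h : HasNormalForm a b f θ μ c d)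
    (hf : ContDiffOn ℝ ∞ f (interval a b)) (hpos : ∀ r ∈ interval a b, 0 < f r)
    (hVeq : ∀ r ∈ interval a b, V r = A / (2 * θ r ^ 2) + B) {r φ : ℝ → ℝ} {K : ℝ}
    (hb : IsNonsingularBounded a b f V r φ K) : IsClosedOrbit r φ := by
  obtain ⟨τ, hτφ, hφτ, hτ⟩ := hb.exists_time hf hpos
  obtain ⟨E, p, q, hs⟩ := h.exists_theta_sq_eq hf hpos hVeq hb hτ
  have hper := h.periodic_of_theta_sq (R := fun s => r (τ s)) (fun s => hb.1.1.mem _ trivial) hs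
  -- With `n` the numerator of `μ`, `2πn` is `2 · den` times the period `πμ`.
  refine (hb.isClosedOrbit_iff hpos hτφ hφτ hτ).2 ⟨μ.num.natAbs, Int.natAbs_pos.2
    (Rat.num_pos.2 h.mu_pos).ne', ?_⟩
  have h1 := hper.nat_mul (2 * μ.den)
  have h2 : ((μ.num.natAbs : ℕ) : ℝ) = μ * μ.den := by
    rw [Nat.cast_natAbs, abs_of_pos (Rat.num_pos.2 h.mu_pos)]
    exact_mod_cast (Rat.mul_den_eq_num μ).symm
  rw [h2]
  push_cast at h1
  rwa [show 2 * Real.pi * (μ * μ.den : ℝ) = 2 * μ.den * (Real.pi * μ) by ring]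

theorem isGraphOfPeriod (h : HasNormalForm a b f θ μ c d)
    (hf : ContDiffOn ℝ ∞ f (interval a b)) (hpos : ∀ r ∈ interval a b, 0 < f r)
    (hVeq : ∀ r ∈ interval a b, V r = A / (2 * θ r ^ 2) + B) {r φ : ℝ → ℝ} {K : ℝ}
    (ho : IsOscillating a b f V r φ K) : IsGraphOfPeriod r φ (Real.pi * μ) := by
  have hμ : (0 : ℝ) < μ := by exact_mod_cast h.mu_pos
  obtain ⟨hb, hnc⟩ := ho
  obtain ⟨τ, hτφ, hφτ, hτ⟩ := hb.exists_time hf hpos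
  obtain ⟨E, p, q, hs⟩ := h.exists_theta_sq_eq hf hpos hVeq hb hτ
  have hmem : ∀ s, r (τ s) ∈ interval a b := fun s => hb.1.1.mem _ trivial
  refine ⟨fun s => r (τ s), ?_, ⟨by positivity, h.periodic_of_theta_sq hmem hs⟩, ?_⟩
  · ext z
    constructor
    · rintro ⟨t, rfl⟩
      exact ⟨φ t, by simp [hτφ]⟩
    · rintro ⟨s, rfl⟩
      exact ⟨τ s, by simp [hφτ]⟩
  · rintro T ⟨hT, hper⟩
    -- A period of `R` is one of the harmonic part of `θ²`, and this part is nontrivial because a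
    -- constant `θ²` would make the orbit circular.
    have := two_pi_div_le_of_periodic (κ := 2 / μ) (p := p) (q := q) (by positivity) hT ?_
      fun s => ?_
    · rwa [show 2 * Real.pi / (2 / (μ : ℝ)) = Real.pi * μ by field_simp] at this
    · by_contra! h0
      refine hnc ⟨r (τ 0), ?_⟩
      have hconst : ∀ t, r t = r (τ 0) := fun t => by
        have h1 := hs (φ t)
        have h2 := hs 0
        rw [h0.1, h0.2] at h1 h2
        rw [← hτφ t]
        refine h.eq_of_sq_eq (hmem _) (hmem _) ?_
        linarith
      ext ⟨x, α⟩
      constructor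
      · rintro ⟨t, ht⟩
        simp only [Prod.mk.injEq] at ht
        simp [← ht.1, hconst t]
      · rintro ⟨hx, -⟩
        induction α using Real.Angle.induction_on with
        | _ s =>
          refine ⟨τ s, ?_⟩
          simp only [Set.mem_singleton_iff] at hx
          simp [hφτ, hx, hconst (τ s)]
    · have h1 := hs (s + T)
      have h2 := hs s
      have h3 : r (τ (s + T)) = r (τ s) := hper s
      rw [h3] at h1
      linarith

end HasNormalForm

/-! ### Uniqueness of the normal form -/

theorem eq_zero_of_quartic {S : Set ℝ} (hS : S.Infinite) {p q r : ℝ}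
    (h : ∀ x ∈ S, p * x ^ 4 + q * x ^ 2 + r = 0) : p = 0 ∧ q = 0 ∧ r = 0 := by
  have h0 : (Polynomial.C p * Polynomial.X ^ 4 + Polynomial.C q * Polynomial.X ^ 2 +
      Polynomial.C r) = 0 :=
    Polynomial.eq_zero_of_infinite_isRoot _ (hS.mono fun x hx => by
      simpa [Polynomial.IsRoot] using h x hx)
  have h1 := congrArg (Polynomial.eval 0) h0
  have h2 := congrArg (Polynomial.eval 1) h0
  have h3 := congrArg (Polynomial.eval 2) h0
  simp only [Polynomial.eval_add, Polynomial.eval_mul, Polynomial.eval_C, Polynomial.eval_pow,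
    Polynomial.eval_X, Polynomial.eval_zero] at h1 h2 h3
  norm_num at h1 h2 h3
  subst h1
  refine ⟨by linarith, by linarith, rfl⟩

/-- An identity at infinitely many points is one of polynomials, and its value at `x = 0` is `d' s²
= 0`: the double pole of `Q` fixes the origin. -/
theorem shift_eq_zero {S : Set ℝ} (hS : S.Infinite) {m m' c c' d d' s : ℝ} (hd : d' ≠ 0)
    (h : ∀ x ∈ S, (m * (x + s) ^ 4 + c * (x + s) ^ 2 - d) * x ^ 2 =
      (m' * x ^ 4 + c' * x ^ 2 - d') * (x + s) ^ 2) : s = 0 := by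
  have h0 : (Polynomial.C m * (Polynomial.X + Polynomial.C s) ^ 4 +
      Polynomial.C c * (Polynomial.X + Polynomial.C s) ^ 2 - Polynomial.C d) * Polynomial.X ^ 2 -
      (Polynomial.C m' * Polynomial.X ^ 4 + Polynomial.C c' * Polynomial.X ^ 2 -
        Polynomial.C d') * (Polynomial.X + Polynomial.C s) ^ 2 = 0 :=
    Polynomial.eq_zero_of_infinite_isRoot _ (hS.mono fun x hx => by
      simpa [Polynomial.IsRoot, sub_eq_zero] using h x hx)
  have h1 := congrArg (Polynomial.eval 0) h0
  simpa [hd] using h1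

namespace HasNormalForm

variable {θ θ' : ℝ → ℝ} {μ μ' : ℚ} {c c' d d' : ℝ}

/-- The normal form is unique. -/
theorem unique (hab : a < b) (hpos : ∀ r ∈ interval a b, 0 < f r)
    (h : HasNormalForm a b f θ μ c d) (h' : HasNormalForm a b f θ' μ' c' d') :
    Set.EqOn θ θ' (interval a b) ∧ μ = μ' ∧ c = c' ∧ d = d' := by
  have hμ : (0 : ℝ) < μ := by exact_mod_cast h.mu_pos
  have hμ' : (0 : ℝ) < μ' := by exact_mod_cast h'.mu_pos
  -- Both `μ² θ` and `μ'² θ'` are primitives of `1 / f²`. They differ by a constant `s`, which the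
  -- pole of `Q` will show to be zero.
  obtain ⟨s, hs⟩ := exists_eq_add_const (convex_interval a b) (g := fun r => (μ : ℝ) ^ 2 * θ r)
    (h := fun r => (μ' : ℝ) ^ 2 * θ' r) (g' := fun r => 1 / f r ^ 2)
    (fun r hr => by
      have := hpos r hr
      convert! (h.Q_eq hpos hr).2.const_mul ((μ : ℝ) ^ 2) using 1
      field_simp)
    (fun r hr => by
      have := hpos r hr
      convert! (h'.Q_eq hpos hr).2.const_mul ((μ' : ℝ) ^ 2) using 1
      field_simp)
  have hS : ((fun r => (μ' : ℝ) ^ 2 * θ' r) '' interval a b).Infinite := by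
    obtain ⟨r₀, hr₀⟩ := interval_nonempty hab
    refine (infinite_of_mem_nhds r₀ ((isOpen_interval a b).mem_nhds hr₀)).image ?_
    intro r hr r' hr' heq
    exact h'.strictMonoOn.injOn hr hr' (mul_left_cancel₀ (pow_ne_zero 2 hμ'.ne') heq)
  have hQ : ∀ r ∈ interval a b, (μ : ℝ) ^ 2 * Q c d (θ r) = μ' ^ 2 * Q c' d' (θ' r) :=
    fun r hr => by
      have := hpos r hr
      rw [(h.Q_eq hpos hr).1, (h'.Q_eq hpos hr).1]
      field_simp
  have hs0 : s = 0 := by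
    refine shift_eq_zero hS (m := 1 / μ ^ 2) (m' := 1 / μ' ^ 2) (c := μ ^ 2 * c)
      (c' := μ' ^ 2 * c') (d := μ ^ 6 * d) (d' := μ' ^ 6 * d')
      (mul_ne_zero (pow_ne_zero 6 hμ'.ne') h'.d_ne) ?_
    rintro _ ⟨r, hr, rfl⟩
    have h1 := hQ r hr
    have h2 := h.ne_zero r hr
    have h3 := h'.ne_zero r hr
    simp only
    rw [← hs r hr]
    simp only [Q] at h1
    field_simp at h1 ⊢
    linear_combination h1
  subst hs0
  -- Comparison of the two expressions for `1 / f²` as functions of the common variable `x = μ'²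
  -- θ'`, multiplied by `x²`.
  obtain ⟨e1, e2, e3⟩ := eq_zero_of_quartic hS (p := 1 / μ ^ 2 - 1 / μ' ^ 2)
    (q := μ ^ 2 * c - μ' ^ 2 * c') (r := -(μ ^ 6 * d - μ' ^ 6 * d')) (by
      rintro _ ⟨r, hr, rfl⟩
      have h1 := hQ r hr
      have h2 := h.ne_zero r hr
      have h3 := h'.ne_zero r hr
      have h4 := hs r hr
      simp only [add_zero] at h4 ⊢
      have h5 : θ r = μ' ^ 2 * θ' r / μ ^ 2 := by rw [← h4]; field_simp
      rw [h5] at h1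
      simp only [Q] at h1
      field_simp at h1 ⊢
      linear_combination h1)
  have hμμ : (μ : ℝ) = μ' := by
    have h1 : (μ : ℝ) ^ 2 = μ' ^ 2 := by
      field_simp at e1
      linarith
    exact (pow_left_inj₀ hμ.le hμ'.le two_ne_zero).1 h1
  rw [hμμ] at e2 e3 hs
  refine ⟨fun r hr => ?_, by exact_mod_cast hμμ, ?_, ?_⟩
  · have := hs r hr
    rw [add_zero] at this
    exact mul_left_cancel₀ (pow_ne_zero 2 hμ'.ne') this
  · exact mul_left_cancel₀ (pow_ne_zero 2 hμ'.ne') (by linarith)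
  · exact mul_left_cancel₀ (pow_ne_zero 6 hμ'.ne') (by linarith)

end HasNormalForm

/-! ### Infima and suprema of monotone functions at the ends -/

section Ends

variable {g : ℝ → ℝ} {l : Filter ℝ}

/-- Only the upper half of the convergence needs proof; values in the interval are never below the
infimum. -/
theorem attainsInfAt_of_eventually_le
    (h : ∀ r₀ ∈ interval a b, ∀ᶠ r in l, r ∈ interval a b ∧ g r ≤ g r₀)
    (hab : a < b) : AttainsInfAt a b g l := by
  obtain ⟨z, hz⟩ := interval_nonempty hab
  refine tendsto_order.2 ⟨fun x hx => ?_, fun x hx => ?_⟩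
  · filter_upwards [h z hz] with r hr using hx.trans_le (iInf₂_le r hr.1)
  · simp only [iInf_lt_iff] at hx
    obtain ⟨r₀, hr₀, hlt⟩ := hx
    filter_upwards [h r₀ hr₀] with r hr using (EReal.coe_le_coe_iff.2 hr.2).trans_lt hlt

theorem attainsSupAt_of_eventually_ge
    (h : ∀ r₀ ∈ interval a b, ∀ᶠ r in l, r ∈ interval a b ∧ g r₀ ≤ g r)
    (hab : a < b) : AttainsSupAt a b g l := by
  obtain ⟨z, hz⟩ := interval_nonempty hab
  refine tendsto_order.2 ⟨fun x hx => ?_, fun x hx => ?_⟩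
  · simp only [lt_iSup_iff] at hx
    obtain ⟨r₀, hr₀, hlt⟩ := hx
    filter_upwards [h r₀ hr₀] with r hr using hlt.trans_le (EReal.coe_le_coe_iff.2 hr.2)
  · filter_upwards [h z hz] with r hr
    exact (le_iSup₂ (f := fun r (_ : r ∈ interval a b) => (g r : EReal)) r hr.1).trans_lt hx

theorem not_attainsInfAt_of_eventually_ge [l.NeBot] {r₀ r₁ : ℝ} (hr₁ : r₁ ∈ interval a b)
    (hlt : g r₁ < g r₀) (h : ∀ᶠ r in l, g r₀ ≤ g r) : ¬ AttainsInfAt a b g l := fun hinf => by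
  have h1 : (g r₀ : EReal) ≤ _ :=
    ge_of_tendsto hinf (h.mono fun r hr => EReal.coe_le_coe_iff.2 hr)
  have h2 := h1.trans (iInf₂_le r₁ hr₁)
  exact hlt.not_ge (EReal.coe_le_coe_iff.1 h2)

theorem not_attainsSupAt_of_eventually_le [l.NeBot] {r₀ r₁ : ℝ} (hr₁ : r₁ ∈ interval a b)
    (hlt : g r₀ < g r₁) (h : ∀ᶠ r in l, g r ≤ g r₀) : ¬ AttainsSupAt a b g l := fun hsup => by
  have h1 : _ ≤ (g r₀ : EReal) :=
    le_of_tendsto hsup (h.mono fun r hr => EReal.coe_le_coe_iff.2 hr)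
  have h2 := (le_iSup₂ (f := fun r (_ : r ∈ interval a b) => (g r : EReal)) r₁ hr₁).trans h1
  exact hlt.not_ge (EReal.coe_le_coe_iff.1 h2)

theorem eventually_left_end {r₀ : ℝ} (hr₀ : r₀ ∈ interval a b) :
    ∀ᶠ r in Filter.comap Real.toEReal (𝓝[>] a), r ∈ interval a b ∧ r < r₀ := by
  have h1 : Set.Ioo a (r₀ : EReal) ∈ 𝓝[>] a := Ioo_mem_nhdsGT hr₀.1
  filter_upwards [Filter.preimage_mem_comap h1] with r hr
  exact ⟨⟨hr.1, hr.2.trans hr₀.2⟩, EReal.coe_lt_coe_iff.1 hr.2⟩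

theorem eventually_right_end {r₀ : ℝ} (hr₀ : r₀ ∈ interval a b) :
    ∀ᶠ r in Filter.comap Real.toEReal (𝓝[<] b), r ∈ interval a b ∧ r₀ < r := by
  have h1 : Set.Ioo (r₀ : EReal) b ∈ 𝓝[<] b := Ioo_mem_nhdsLT hr₀.2
  filter_upwards [Filter.preimage_mem_comap h1] with r hr
  exact ⟨⟨hr₀.1.trans hr.1, hr.2⟩, EReal.coe_lt_coe_iff.1 hr.1⟩

theorem left_end_neBot (hab : a < b) : (Filter.comap Real.toEReal (𝓝[>] a)).NeBot := by
  refine Filter.comap_neBot_iff.2 fun t ht => ?_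
  obtain ⟨u, hu, hut⟩ := (mem_nhdsGT_iff_exists_Ioo_subset' hab).1 ht
  obtain ⟨q, h1, h2⟩ := EReal.exists_rat_btwn_of_lt hu
  exact ⟨q, hut ⟨h1, h2⟩⟩

theorem right_end_neBot (hab : a < b) : (Filter.comap Real.toEReal (𝓝[<] b)).NeBot := by
  refine Filter.comap_neBot_iff.2 fun t ht => ?_
  obtain ⟨u, hu, hut⟩ := (mem_nhdsLT_iff_exists_Ioo_subset' hab).1 ht
  obtain ⟨q, h1, h2⟩ := EReal.exists_rat_btwn_of_lt hu
  exact ⟨q, hut ⟨h1, h2⟩⟩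

theorem exists_lt_mem_interval (hab : a < b) :
    ∃ r₁ ∈ interval a b, ∃ r₂ ∈ interval a b, r₁ < r₂ := by
  obtain ⟨r₂, hr₂⟩ := interval_nonempty hab
  obtain ⟨r₁, hr₁⟩ := interval_nonempty hr₂.1
  exact ⟨r₁, ⟨hr₁.1, hr₁.2.trans hr₂.2⟩, r₂, hr₂, EReal.coe_lt_coe_iff.1 hr₁.2⟩

theorem attainsInfAt_of_strictMonoOn (hab : a < b) (hg : StrictMonoOn g (interval a b)) :
    AttainsInfAt a b g (Filter.comap Real.toEReal (𝓝[>] a)) ∧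
      ¬ AttainsInfAt a b g (Filter.comap Real.toEReal (𝓝[<] b)) := by
  have := right_end_neBot hab
  obtain ⟨r₁, hr₁, r₂, hr₂, hlt⟩ := exists_lt_mem_interval hab
  exact ⟨attainsInfAt_of_eventually_le (fun r₀ hr₀ => (eventually_left_end hr₀).mono fun r hr =>
    ⟨hr.1, (hg hr.1 hr₀ hr.2).le⟩) hab,
    not_attainsInfAt_of_eventually_ge hr₁ (hg hr₁ hr₂ hlt)
      ((eventually_right_end hr₂).mono fun r hr => (hg hr₂ hr.1 hr.2).le)⟩

theorem attainsInfAt_of_strictAntiOn (hab : a < b) (hg : StrictAntiOn g (interval a b)) :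
    AttainsInfAt a b g (Filter.comap Real.toEReal (𝓝[<] b)) ∧
      ¬ AttainsInfAt a b g (Filter.comap Real.toEReal (𝓝[>] a)) := by
  have := left_end_neBot hab
  obtain ⟨r₁, hr₁, r₂, hr₂, hlt⟩ := exists_lt_mem_interval hab
  exact ⟨attainsInfAt_of_eventually_le (fun r₀ hr₀ => (eventually_right_end hr₀).mono fun r hr =>
    ⟨hr.1, (hg hr₀ hr.1 hr.2).le⟩) hab,
    not_attainsInfAt_of_eventually_ge hr₂ (hg hr₁ hr₂ hlt)
      ((eventually_left_end hr₁).mono fun r hr => (hg hr.1 hr₁ hr.2).le)⟩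

theorem attainsSupAt_of_strictMonoOn (hab : a < b) (hg : StrictMonoOn g (interval a b)) :
    AttainsSupAt a b g (Filter.comap Real.toEReal (𝓝[<] b)) ∧
      ¬ AttainsSupAt a b g (Filter.comap Real.toEReal (𝓝[>] a)) := by
  have := left_end_neBot hab
  obtain ⟨r₁, hr₁, r₂, hr₂, hlt⟩ := exists_lt_mem_interval hab
  exact ⟨attainsSupAt_of_eventually_ge (fun r₀ hr₀ => (eventually_right_end hr₀).mono fun r hr =>
    ⟨hr.1, (hg hr₀ hr.1 hr.2).le⟩) hab,
    not_attainsSupAt_of_eventually_le hr₂ (hg hr₁ hr₂ hlt)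
      ((eventually_left_end hr₁).mono fun r hr => (hg hr.1 hr₁ hr.2).le)⟩

theorem attainsSupAt_of_strictAntiOn (hab : a < b) (hg : StrictAntiOn g (interval a b)) :
    AttainsSupAt a b g (Filter.comap Real.toEReal (𝓝[>] a)) ∧
      ¬ AttainsSupAt a b g (Filter.comap Real.toEReal (𝓝[<] b)) := by
  have := right_end_neBot hab
  obtain ⟨r₁, hr₁, r₂, hr₂, hlt⟩ := exists_lt_mem_interval hab
  exact ⟨attainsSupAt_of_eventually_ge (fun r₀ hr₀ => (eventually_left_end hr₀).mono fun r hr =>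
    ⟨hr.1, (hg hr.1 hr₀ hr.2).le⟩) hab,
    not_attainsSupAt_of_eventually_le hr₁ (hg hr₁ hr₂ hlt)
      ((eventually_right_end hr₂).mono fun r hr => (hg hr₂ hr.1 hr.2).le)⟩

theorem strictAntiOn_of_hasDerivAt_neg {g' : ℝ → ℝ}
    (hg : ∀ r ∈ interval a b, HasDerivAt g (g' r) r) (hneg : ∀ r ∈ interval a b, g' r < 0) :
    StrictAntiOn g (interval a b) :=
  strictAntiOn_of_deriv_neg (convex_interval a b)
    (fun r hr => (hg r hr).continuousAt.continuousWithinAt) fun r hr => by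
      have hr' := interior_subset hr
      rw [(hg r hr').deriv]; exact hneg r hr'

end Ends

/-! ### The attracting centre and the classification of closing potentials -/

namespace HasNormalForm

variable {θ : ℝ → ℝ} {μ : ℚ} {c d A B : ℝ}

/-- The radius of the circles and the potential increase together, against `A |θ|`. -/
theorem strictMonoOn_or_strictAntiOn (h : HasNormalForm a b f θ μ c d) (hab : a < b)
    (hf : ContDiffOn ℝ ∞ f (interval a b)) (hpos : ∀ r ∈ interval a b, 0 < f r)
    (hA : ∀ r ∈ interval a b, 0 < A * (θ r ^ 4 + d))
    (hVeq : ∀ r ∈ interval a b, V r = A / (2 * θ r ^ 2) + B) :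
    StrictMonoOn f (interval a b) ∧ StrictMonoOn V (interval a b) ∧
        StrictAntiOn (fun r => A * |θ r|) (interval a b) ∨
      StrictAntiOn f (interval a b) ∧ StrictAntiOn V (interval a b) ∧
        StrictMonoOn (fun r => A * |θ r|) (interval a b) := by
  have hμ : (0 : ℝ) < μ := by exact_mod_cast h.mu_pos
  obtain ⟨z, hz⟩ := interval_nonempty hab
  have hA0 : A ≠ 0 := left_ne_zero_of_mul (hA z hz).ne'
  -- The derivatives of `f` and of `V` are both written as `-(A θ)` times a positive factor, so that
  -- one sign decides both.
  have hdf : ∀ r ∈ interval a b, HasDerivAt f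
      (-(A * θ r) * (f r * (A * (θ r ^ 4 + d)) / (A ^ 2 * θ r ^ 4))) r := fun r hr => by
    have := h.ne_zero r hr
    convert! hasDerivAt_deriv_of_contDiffOn hf (isOpen_interval a b) hr using 1
    rw [h.deriv_f hf hpos hr]
    field_simp
  have hdV : ∀ r ∈ interval a b, HasDerivAt V
      (-(A * θ r) * (1 / (μ ^ 2 * f r ^ 2 * θ r ^ 4))) r := fun r hr => by
    have := h.ne_zero r hr
    have := hpos r hr
    convert! h.oscillator_hasDerivAt hpos hVeq hr using 1
    field_simp
  -- The sign of `θ` is constant and is read off at `z`, which makes `A |θ|` a constant multiple of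
  -- the increasing function `θ`.
  have habs : ∀ r ∈ interval a b, A * |θ r| = A * θ z / |θ z| * θ r := fun r hr => by
    have h0 := h.ne_zero z hz
    have h1 := h.theta_mul_pos hr hz
    have h2 := abs_of_pos h1
    rw [abs_mul] at h2
    have h3 := abs_pos.2 h0
    rw [eq_comm, div_mul_eq_mul_div, div_eq_iff h3.ne', mul_assoc A, mul_assoc A, h2, mul_comm (θ z)]
  have hAθ : ∀ r ∈ interval a b, 0 < (A * θ r) * (A * θ z) := fun r hr => by
    have h1 := h.theta_mul_pos hr hz
    have h2 : (A * θ r) * (A * θ z) = A ^ 2 * (θ r * θ z) := by ring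
    rw [h2]; positivity
  have hfac : ∀ r ∈ interval a b, 0 < f r * (A * (θ r ^ 4 + d)) / (A ^ 2 * θ r ^ 4) ∧
      0 < 1 / (μ ^ 2 * f r ^ 2 * θ r ^ 4) := fun r hr => by
    have h0 := h.ne_zero r hr
    have h1 := hpos r hr
    exact ⟨div_pos (mul_pos h1 (hA r hr)) (by positivity), by positivity⟩
  have hz0 := abs_pos.2 (h.ne_zero z hz)
  rcases (mul_ne_zero hA0 (h.ne_zero z hz)).lt_or_gt with hneg | hp
  · left
    have hs : ∀ r ∈ interval a b, 0 < -(A * θ r) := fun r hr => by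
      linarith [neg_of_mul_pos_left (hAθ r hr) hneg.le]
    refine ⟨strictMonoOn_of_hasDerivAt_pos hdf fun r hr => mul_pos (hs r hr) (hfac r hr).1,
      strictMonoOn_of_hasDerivAt_pos hdV fun r hr => mul_pos (hs r hr) (hfac r hr).2, ?_⟩
    intro r hr s hs hrs
    simp only [habs r hr, habs s hs]
    exact mul_lt_mul_of_neg_left (h.strictMonoOn hr hs hrs) (div_neg_of_neg_of_pos hneg hz0)
  · right
    have hs : ∀ r ∈ interval a b, -(A * θ r) < 0 := fun r hr => by
      linarith [pos_of_mul_pos_left (hAθ r hr) hp.le]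
    refine ⟨strictAntiOn_of_hasDerivAt_neg hdf fun r hr =>
        mul_neg_of_neg_of_pos (hs r hr) (hfac r hr).1,
      strictAntiOn_of_hasDerivAt_neg hdV fun r hr =>
        mul_neg_of_neg_of_pos (hs r hr) (hfac r hr).2, ?_⟩
    intro r hr s hs hrs
    simp only [habs r hr, habs s hs]
    exact mul_lt_mul_of_pos_left (h.strictMonoOn hr hs hrs) (div_pos hp hz0)

theorem attracting_centre (h : HasNormalForm a b f θ μ c d) (hab : a < b)
    (hf : ContDiffOn ℝ ∞ f (interval a b)) (hpos : ∀ r ∈ interval a b, 0 < f r)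
    (hA : ∀ r ∈ interval a b, 0 < A * (θ r ^ 4 + d))
    (hVeq : ∀ r ∈ interval a b, V r = A / (2 * θ r ^ 2) + B) :
    (∃ l ∈ ends a b, AttainsInfAt a b f l) ∧ ∀ l ∈ ends a b,
      (AttainsInfAt a b f l ↔ AttainsSupAt a b (fun r => A * |θ r|) l) ∧
      (AttainsInfAt a b f l ↔ AttainsInfAt a b V l) := by
  rcases h.strictMonoOn_or_strictAntiOn hab hf hpos hA hVeq with ⟨h1, h2, h3⟩ | ⟨h1, h2, h3⟩
  · have e1 := attainsInfAt_of_strictMonoOn hab h1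
    have e2 := attainsInfAt_of_strictMonoOn hab h2
    have e3 := attainsSupAt_of_strictAntiOn hab h3
    refine ⟨⟨_, Or.inl rfl, e1.1⟩, ?_⟩
    rintro l (rfl | rfl)
    · exact ⟨iff_of_true e1.1 e3.1, iff_of_true e1.1 e2.1⟩
    · exact ⟨iff_of_false e1.2 e3.2, iff_of_false e1.2 e2.2⟩
  · have e1 := attainsInfAt_of_strictAntiOn hab h1
    have e2 := attainsInfAt_of_strictAntiOn hab h2
    have e3 := attainsSupAt_of_strictMonoOn hab h3
    refine ⟨⟨_, Or.inr rfl, e1.1⟩, ?_⟩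
    rintro l (rfl | rfl)
    · exact ⟨iff_of_false e1.2 e3.2, iff_of_false e1.2 e2.2⟩
    · exact ⟨iff_of_true e1.1 e3.1, iff_of_true e1.1 e2.1⟩

/-- The closing potentials, in each sense, are the oscillator potentials. -/
theorem isClosing_iff (h : HasNormalForm a b f θ μ c d) (hab : a < b)
    (hf : ContDiffOn ℝ ∞ f (interval a b)) (hpos : ∀ r ∈ interval a b, 0 < f r)
    (hcrit : ∀ r ∈ interval a b, deriv f r ≠ 0)
    (htype : ∀ ξ : ℚ, 0 < ξ → ¬ ∀ r ∈ interval a b,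
      deriv (deriv f) r * f r - deriv f r ^ 2 = -(ξ : ℝ) ^ 2) (s : Sense) :
    IsClosing a b f s V ↔ ∃ A B : ℝ, (∀ r ∈ interval a b, 0 < A * (θ r ^ 4 + d)) ∧
      ∀ r ∈ interval a b, V r = A / (2 * θ r ^ 2) + B := by
  constructor
  · rintro ⟨hV, hcl⟩
    obtain ⟨θ', μ', c', d', A, B, h', hA, hVeq⟩ := exists_hasNormalForm hf hpos hcrit htype hV
      (hcl.locally hab hf hpos hcrit hV)
    -- A closing potential brings its own normal form; uniqueness identifies it with the given one.
    obtain ⟨hθ, -, -, rfl⟩ := h.unique hab hpos h'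
    exact ⟨A, B, fun r hr => by rw [hθ hr]; exact hA r hr, fun r hr => by rw [hθ hr]; exact hVeq r hr⟩
  · rintro ⟨A, B, hA, hVeq⟩
    have hV := h.oscillator_contDiffOn hVeq
    exact ⟨hV, closingCondition_of_forall hab hf hpos hV
      (fun r hr => h.exists_isStronglyStable hf hpos hA hVeq hr)
      (fun r φ K hb => h.isClosedOrbit hf hpos hVeq hb) s⟩

end HasNormalForm

theorem IsClosing.exists_hasNormalForm {s : Sense} (hcl : IsClosing a b f s V) (hab : a < b)
    (hf : ContDiffOn ℝ ∞ f (interval a b)) (hpos : ∀ r ∈ interval a b, 0 < f r)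
    (hcrit : ∀ r ∈ interval a b, deriv f r ≠ 0)
    (htype : ∀ ξ : ℚ, 0 < ξ → ¬ ∀ r ∈ interval a b,
      deriv (deriv f) r * f r - deriv f r ^ 2 = -(ξ : ℝ) ^ 2) :
    ∃ (θ : ℝ → ℝ) (μ : ℚ) (c d : ℝ), HasNormalForm a b f θ μ c d := by
  obtain ⟨θ, μ, c, d, A, B, h, -⟩ := Bertrand.exists_hasNormalForm hf hpos hcrit htype hcl.1
    (hcl.2.locally hab hf hpos hcrit hcl.1)
  exact ⟨θ, μ, c, d, h⟩

theorem IsClosing.sameUpToConstants {W : ℝ → ℝ} {s : Sense} (hV : IsClosing a b f s V)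
    (hW : IsClosing a b f s W) (hab : a < b)
    (hf : ContDiffOn ℝ ∞ f (interval a b)) (hpos : ∀ r ∈ interval a b, 0 < f r)
    (hcrit : ∀ r ∈ interval a b, deriv f r ≠ 0)
    (htype : ∀ ξ : ℚ, 0 < ξ → ¬ ∀ r ∈ interval a b,
      deriv (deriv f) r * f r - deriv f r ^ 2 = -(ξ : ℝ) ^ 2) : SameUpToConstants a b V W := by
  obtain ⟨θ, μ, c, d, h⟩ := hV.exists_hasNormalForm hab hf hpos hcrit htype
  obtain ⟨A, B, hA, hVeq⟩ := (h.isClosing_iff hab hf hpos hcrit htype s).1 hV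
  obtain ⟨A', B', hA', hWeq⟩ := (h.isClosing_iff hab hf hpos hcrit htype s).1 hW
  obtain ⟨z, hz⟩ := interval_nonempty hab
  have h1 := hA z hz
  have h2 := hA' z hz
  have hA0 : A ≠ 0 := left_ne_zero_of_mul h1.ne'
  have hne := right_ne_zero_of_mul h1.ne'
  -- The ratio is positive because `A` and `A'` both have the sign of `θ⁴ + d`.
  refine ⟨A' / A, B' - A' / A * B, ?_, fun r hr => ?_⟩
  · have h3 : A' / A = A' * (θ z ^ 4 + d) * (A * (θ z ^ 4 + d)) / (A * (θ z ^ 4 + d)) ^ 2 := by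
      field_simp
    rw [h3]; positivity
  · have := h.ne_zero r hr
    rw [hVeq r hr, hWeq r hr]
    field_simp
    ring

end Bertrand

/-! ### The main theorem -/

theorem mainTheorem3 (a b : EReal) (hab : a < b) (f : ℝ → ℝ)
    (hf : ContDiffOn ℝ ∞ f (Bertrand.interval a b))
    (hpos : ∀ r ∈ Bertrand.interval a b, 0 < f r)
    (hcrit : ∀ r ∈ Bertrand.interval a b, deriv f r ≠ 0)
    (htype : ∀ ξ : ℚ, 0 < ξ → ¬ ∀ r ∈ Bertrand.interval a b,
      deriv (deriv f) r * f r - deriv f r ^ 2 = -(ξ : ℝ) ^ 2) :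
    -- at most one closing potential, in each sense
    (∀ (s : Bertrand.Sense) (V W : ℝ → ℝ), Bertrand.IsClosing a b f s V →
      Bertrand.IsClosing a b f s W → Bertrand.SameUpToConstants a b V W) ∧
    -- exactly one, in each sense, if and only if the metric has the normal form
    (∀ s : Bertrand.Sense,
      (∃ V : ℝ → ℝ, Bertrand.IsClosing a b f s V ∧
        ∀ W : ℝ → ℝ, Bertrand.IsClosing a b f s W → Bertrand.SameUpToConstants a b V W) ↔
      ∃ (θ : ℝ → ℝ) (μ : ℚ) (c d : ℝ), Bertrand.HasNormalForm a b f θ μ c d) ∧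
    -- the normal form is unique
    (∀ (θ θ' : ℝ → ℝ) (μ μ' : ℚ) (c c' d d' : ℝ), Bertrand.HasNormalForm a b f θ μ c d →
      Bertrand.HasNormalForm a b f θ' μ' c' d' →
        Set.EqOn θ θ' (Bertrand.interval a b) ∧ μ = μ' ∧ c = c' ∧ d = d') ∧
    ∀ (θ : ℝ → ℝ) (μ : ℚ) (c d : ℝ), Bertrand.HasNormalForm a b f θ μ c d →
      -- the closing potentials, in each sense, are the oscillator potentials
      (∀ (s : Bertrand.Sense) (V : ℝ → ℝ), Bertrand.IsClosing a b f s V ↔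
        ∃ A B : ℝ, (∀ r ∈ Bertrand.interval a b, 0 < A * (θ r ^ 4 + d)) ∧
          ∀ r ∈ Bertrand.interval a b, V r = A / (2 * θ r ^ 2) + B) ∧
      ∀ (A B : ℝ) (V : ℝ → ℝ), (∀ r ∈ Bertrand.interval a b, 0 < A * (θ r ^ 4 + d)) →
        (∀ r ∈ Bertrand.interval a b, V r = A / (2 * θ r ^ 2) + B) →
        -- the period of the nonsingular noncircular bounded orbits
        (∀ (r φ : ℝ → ℝ) (K : ℝ), Bertrand.IsOscillating a b f V r φ K →
          Bertrand.IsGraphOfPeriod r φ (Real.pi * μ)) ∧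
        -- the angular momentum on the circular orbits
        (∀ r₀ ∈ Bertrand.interval a b, ∀ K₀ : ℝ, Bertrand.IsCircularOrbit a b f V r₀ K₀ ↔
          K₀ = 1 / μ * √(A / (θ r₀ ^ 4 + d)) ∨ K₀ = -(1 / μ * √(A / (θ r₀ ^ 4 + d)))) ∧
        -- the attracting centre
        (∃ l ∈ Bertrand.ends a b, Bertrand.AttainsInfAt a b f l) ∧
        ∀ l ∈ Bertrand.ends a b,
          (Bertrand.AttainsInfAt a b f l ↔
            Bertrand.AttainsSupAt a b (fun r => A * |θ r|) l) ∧
          (Bertrand.AttainsInfAt a b f l ↔ Bertrand.AttainsInfAt a b V l) := by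
  refine ⟨fun s V W hV hW => hV.sameUpToConstants hW hab hf hpos hcrit htype, fun s => ⟨?_, ?_⟩,
    fun θ θ' μ μ' c c' d d' h h' => h.unique hab hpos h', fun θ μ c d h =>
      ⟨fun s V => h.isClosing_iff hab hf hpos hcrit htype s, fun A B V hA hVeq =>
        ⟨fun r φ K ho => h.isGraphOfPeriod hf hpos hVeq ho,
          fun r₀ hr₀ K₀ => h.isCircularOrbit_iff_eq_or hf hpos hA hVeq hr₀ K₀,
          h.attracting_centre hab hf hpos hA hVeq⟩⟩⟩
  · rintro ⟨V, hV, -⟩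
    exact hV.exists_hasNormalForm hab hf hpos hcrit htype
  · rintro ⟨θ, μ, c, d, h⟩
    obtain ⟨A, hA⟩ := h.exists_sign hf hpos hcrit hab
    have hV : Bertrand.IsClosing a b f s fun r => A / (2 * θ r ^ 2) + 0 :=
      (h.isClosing_iff hab hf hpos hcrit htype s).2 ⟨A, 0, hA, fun r _ => rfl⟩
    exact ⟨_, hV, fun W hW => hV.sameUpToConstants hW hab hf hpos hcrit htype⟩
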